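/- Theorem 6. Deciding entailment of Boolean conjunctive queries over EMFA ontologies is in \textsc{2ExpTime}. That is, there is a language $L$ that is decided by a deterministic Turing machine in time $2^{2^{p(n)}}$, for some polynomial $p$ and inputs of length $n$, such that, for every EMFA ontology $\mathcal{O}=\langle\mathcal{R},\mathcal{F}\rangle$ and every Boolean conjunctive query $\gamma$, the (standard) string encoding of $(\mathcal{O},\gamma)$ belongs to $L$ if and only if $\mathcal{O}\models\gamma$ under first-order semantics with equality and without the unique name assumption. Here a rule is a function- and constant-free formula of one of the following two forms. A TGD is a formula $\forall\vec x,\vec y.(\beta[\vec x,\vec y]\to\exists\vec w.\,\eta[\vec x,\vec w])$ with $\vec x$ non-empty. An EGD is a formula $\forall\vec x.(\beta[\vec x]\to x\approx y)$ with $x,y\in\vec x$. In both, $\beta$ and $\eta$ are non-empty conjunctions of atoms without equality over predicates of positive arity. An ontology $\langle\mathcal{R},\mathcal{F}\rangle$ consists of a finite set $\mathcal{R}$ of rules, such that no existentially quantified variable of one rule occurs in a different rule, and of a finite set $\mathcal{F}$ of equality-free facts over constants whose predicates occur in $\mathcal{R}$. A Boolean conjunctive query is the existential closure of a non-empty conjunction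 of equality-free atoms over variables. Constants have depth $1$, and $f(t_1,\dots,t_n)$ has depth $1+\max_i \mathrm{dep}(t_i)$. For a head $\eta$ as above and a map $\sigma$ from variables to ground terms, let $\mathrm{sk}(\eta)\sigma$ be obtained from $\eta$ by replacing every $w\in\vec w$ by the Skolem term $f_w(\vec x)$ and then every variable $x$ by $\sigma(x)$. For an atom set $A$, let $A[t/u]$ be obtained by replacing every occurrence of $t$ as an argument of a predicate by $u$ (occurrences inside other terms are left unchanged). The EMFA set $\mathcal{E}$ of $\mathcal{R}$ is the least set of atoms such that: (i) $P(\star,\dots,\star)\in\mathcal{E}$ for every predicate $P\neq{\approx}$ of $\mathcal{R}$, where $\star$ is a special constant; (ii) if $\beta\to\exists\vec w.\,\eta$ is a TGD of $\mathcal{R}$ and $\beta\sigma\subseteq\mathcal{E}$, then $\mathrm{sk}(\eta)\sigma\subseteq\mathcal{E}$; (iii) if $\beta\to x\approx y$ is an EGD of $\mathcal{R}$ and $\beta\sigma\subseteq\mathcal{E}$, then $\mathcal{E}[\sigma(y)/\sigma(x)]\subseteq\mathcal{E}$ if $\mathrm{dep}(\sigma(x))\le\mathrm{dep}(\sigma(y))$,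 and $\mathcal{E}[\sigma(x)/\sigma(y)]\subseteq\mathcal{E}$ if $\mathrm{dep}(\sigma(y))\le\mathrm{dep}(\sigma(x))$. A term $f(\vec u)$ is cyclic if $f$ occurs in some term of $\vec u$. The ontology is EMFA if $\mathcal{E}$ contains no cyclic terms. -/

import Mathlib

/-! Existential rules with equality, EMFA rule sets, entailment of Boolean conjunctive queries,
and the class of languages decidable in doubly exponential time. -/

namespace ExRules

/-! ### Syntax -/

/-- Variables. -/
abbrev Var := ℕ

/-- Constants that may occur in facts. -/
abbrev Constant := ℕ

/-- A predicate symbol of positive arity. There are infinitely many of each arity. The equality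
predicate is not among them: it occurs only in heads of equality generating dependencies. -/
structure Pred where
  name : ℕ
  arity : ℕ
  arity_pos : 0 < arity

/-- An atom `P(t₁, …, tₙ)` with arguments from `T`. -/
structure Atom (T : Type) where
  pred : Pred
  args : Fin pred.arity → T

/-- Apply a function to every argument of an atom. -/
def Atom.map {T U : Type} (g : T → U) (A : Atom T) : Atom U :=
  ⟨A.pred, fun i => g (A.args i)⟩

/-- The variables occurring in a conjunction of function- and constant-free atoms. -/
def varsOf (β : List (Atom Var)) : List Var :=
  β.flatMap fun A => List.ofFn A.args

/-- Existential rules. `tgd β η` is `∀ x⃗ y⃗, β[x⃗, y⃗] → ∃ w⃗, η[x⃗, w⃗]`, where `x⃗` are the variables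
common to `β` and `η`, and `w⃗` the variables of `η` that do not occur in `β`.
`egd β x y` is `∀ x⃗, β[x⃗] → x ≈ y`. -/
inductive Rule where
  | tgd (body head : List (Atom Var))
  | egd (body : List (Atom Var)) (x y : Var)

/-- The list `x⃗` of variables shared by body and head of a TGD, without repetitions. -/
def frontier (body head : List (Atom Var)) : List Var :=
  (varsOf body).dedup.filter fun v => v ∈ varsOf head

namespace Rule

/-- The atoms (without equality) of a rule. -/
def atoms : Rule → List (Atom Var)
  | tgd body head => body ++ head
  | egd body _ _ => body

/-- The existentially quantified variables of a rule. -/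
def exVars : Rule → List Var
  | tgd body head => (varsOf head).filter fun v => v ∉ varsOf body
  | egd _ _ _ => []

/-- The syntactic conditions on rules: bodies and heads are non-empty conjunctions; the list `x⃗`
is non-empty; the two variables equated by an EGD occur in its body. -/
def WellFormed : Rule → Prop
  | tgd body head => body ≠ [] ∧ head ≠ [] ∧ frontier body head ≠ []
  | egd body x y => body ≠ [] ∧ x ∈ varsOf body ∧ y ∈ varsOf body

end Rule

/-- The predicate `P` occurs in the rule set `R`. -/
def OccursIn (P : Pred) (R : List Rule) : Prop :=
  ∃ ρ ∈ R, ∃ A ∈ ρ.atoms, A.pred = P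

/-- An ontology: a finite rule set (listed) and a finite set of facts (listed). An existentially
quantified variable of one rule does not occur in a different rule, and every predicate of the
facts occurs in the rules. -/
structure Ontology where
  rules : List Rule
  facts : List (Atom Constant)
  rules_wellFormed : ∀ ρ ∈ rules, ρ.WellFormed
  exVars_apart : ∀ ρ ∈ rules, ∀ ρ' ∈ rules, ρ ≠ ρ' → ∀ w ∈ ρ.exVars, w ∉ varsOf ρ'.atoms
  facts_preds : ∀ A ∈ facts, OccursIn A.pred rules

/-- A Boolean conjunctive query: the existential closure of a non-empty conjunction of atoms over
variables. -/
structure BCQ where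
  body : List (Atom Var)
  body_ne_nil : body ≠ []

/-! ### First-order semantics -/

/-- A first-order interpretation with domain `D` (non-empty, as constants are interpreted in it;
distinct constants may denote the same element). Equality is interpreted as identity. -/
structure Interp (D : Type) where
  const : Constant → D
  rel : (P : Pred) → (Fin P.arity → D) → Prop

namespace Interp

variable {D : Type}

/-- All atoms of the conjunction `β` are true under the assignment `v`. -/
def Sat (I : Interp D) (β : List (Atom Var)) (v : Var → D) : Prop :=
  ∀ A ∈ β, I.rel A.pred fun i => v (A.args i)

/-- Truth of a rule. -/
def ModelsRule (I : Interp D) : Rule → Prop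
  | .tgd body head =>
      ∀ v : Var → D, I.Sat body v →
        ∃ v' : Var → D, (∀ x ∈ varsOf body, v' x = v x) ∧ I.Sat head v'
  | .egd body x y => ∀ v : Var → D, I.Sat body v → v x = v y

/-- Truth of a fact. -/
def ModelsFact (I : Interp D) (A : Atom Constant) : Prop :=
  I.rel A.pred fun i => I.const (A.args i)

/-- Truth of a Boolean conjunctive query. -/
def ModelsBCQ (I : Interp D) (q : BCQ) : Prop :=
  ∃ v : Var → D, I.Sat q.body v

end Interp

/-- `O ⊨ q` under first-order semantics. -/
def Ontology.Entails (O : Ontology) (q : BCQ) : Prop :=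
  ∀ (D : Type) (I : Interp D),
    (∀ ρ ∈ O.rules, I.ModelsRule ρ) → (∀ A ∈ O.facts, I.ModelsFact A) → I.ModelsBCQ q

/-! ### Equality model-faithful acyclicity -/

/-- Ground terms over the constants, the special constant `⋆`, and Skolem function symbols.
The Skolem function symbol of the existentially quantified variable `w` is represented by `w`. -/
inductive GTerm where
  | star
  | const (c : Constant)
  | app (f : Var) (n : ℕ) (ts : Fin n → GTerm)

namespace GTerm

/-- The depth of a term; constants have depth `1`. -/
def depth : GTerm → ℕ
  | star => 1
  | const _ => 1
  | app _ _ ts => (Finset.univ.sup fun i => (ts i).depth) + 1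

/-- The function symbol `f` occurs in a term. -/
def Occurs (f : Var) : GTerm → Prop
  | star => False
  | const _ => False
  | app g _ ts => g = f ∨ ∃ i, (ts i).Occurs f

/-- A term is cyclic if it is of the form `f(u⃗)` and `f` occurs in some term of `u⃗`. -/
def Cyclic : GTerm → Prop
  | star => False
  | const _ => False
  | app f _ ts => ∃ i, (ts i).Occurs f

end GTerm

/-- The substitution that carries a head `η` of a TGD to `sk(η)σ`: a variable of the body is sent to
its value under `σ`, and an existentially quantified `w` to the Skolem term `f_w(σ(x⃗))`. -/
def skolemSubst (body head : List (Atom Var)) (σ : Var → GTerm) (v : Var) : GTerm :=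
  if v ∈ varsOf body then σ v
  else .app v (frontier body head).length fun i => σ ((frontier body head).get i)

open Classical in
/-- `A[t / u]`: every occurrence of `t` as a predicate argument is replaced by `u`. -/
noncomputable def Atom.replace (A : Atom GTerm) (t u : GTerm) : Atom GTerm :=
  A.map fun s => if s = t then u else s

/-- The EMFA set of a rule set: the least set of atoms that contains the critical instance and is
closed under the TGDs (skolemised) and under the replacements, of deeper by shallower terms,
that the EGDs give rise to. -/
inductive EMFASet (R : List Rule) : Atom GTerm → Prop
  | critical (P : Pred) (hP : OccursIn P R) : EMFASet R ⟨P, fun _ => .star⟩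
  | tgd (body head : List (Atom Var)) (hρ : Rule.tgd body head ∈ R) (σ : Var → GTerm)
      (hσ : ∀ B ∈ body, EMFASet R (B.map σ)) (A : Atom Var) (hA : A ∈ head) :
      EMFASet R (A.map (skolemSubst body head σ))
  | egd_left (body : List (Atom Var)) (x y : Var) (hρ : Rule.egd body x y ∈ R) (σ : Var → GTerm)
      (hσ : ∀ B ∈ body, EMFASet R (B.map σ)) (hd : (σ x).depth ≤ (σ y).depth)
      (A : Atom GTerm) (hA : EMFASet R A) : EMFASet R (A.replace (σ y) (σ x))
  | egd_right (body : List (Atom Var)) (x y : Var) (hρ : Rule.egd body x y ∈ R) (σ : Var → GTerm)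
      (hσ : ∀ B ∈ body, EMFASet R (B.map σ)) (hd : (σ y).depth ≤ (σ x).depth)
      (A : Atom GTerm) (hA : EMFASet R A) : EMFASet R (A.replace (σ x) (σ y))

/-- An ontology is EMFA if the EMFA set of its rule set contains no cyclic terms. (Every subterm of
an argument of an atom in the EMFA set is itself an argument of an atom in the EMFA set.) -/
def Ontology.IsEMFA (O : Ontology) : Prop :=
  ∀ A, EMFASet O.rules A → ∀ i, ¬ (A.args i).Cyclic

/-! ### Encoding of instances as strings -/

open Computability (Γ')

/-- Bracket a string. -/
def bracket (s : List Γ') : List Γ' :=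
  Γ'.bra :: (s ++ [Γ'.ket])

/-- Names are written in binary, in brackets. -/
def encodeName (n : ℕ) : List Γ' :=
  bracket ((Computability.encodeNat n).map Γ'.bit)

/-- A list is written as the bracketed concatenation of the codes of its members. -/
def encodeList {α : Type} (e : α → List Γ') (l : List α) : List Γ' :=
  bracket (l.flatMap e)

/-- An atom is written as the list of its predicate name and its arguments; the arity is the number
of arguments. -/
def encodeAtom (A : Atom ℕ) : List Γ' :=
  encodeList encodeName (A.pred.name :: List.ofFn A.args)

/-- A TGD has the tag `0` and an EGD the tag `1`. -/
def encodeRule : Rule → List Γ'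
  | .tgd body head =>
      bracket (encodeName 0 ++ encodeList encodeAtom body ++ encodeList encodeAtom head)
  | .egd body x y =>
      bracket (encodeName 1 ++ encodeList encodeAtom body ++ encodeName x ++ encodeName y)

/-- The string that represents an ontology together with a query. -/
def encodeInstance (O : Ontology) (q : BCQ) : List Γ' :=
  encodeList encodeRule O.rules ++ encodeList encodeAtom O.facts ++ encodeList encodeAtom q.body

/-! ### Doubly exponential time -/

open Classical in
/-- The class 2ExpTime of languages over the alphabet `Γ`: a (deterministic, multi-stack) Turing
machine computes the characteristic function of the language, on every input of length `n` within
`2 ^ (2 ^ p n)` steps, for some polynomial `p`. -/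
def TwoExpTime (Γ : Type) : Set (Language Γ) :=
  {L | ∃ (M : Turing.TM2ComputableInTime (id : List Γ → List Γ) Computability.encodeBool
        fun w => decide (w ∈ L)) (p : Polynomial ℕ),
      ∀ n : ℕ, M.time n ≤ 2 ^ (2 ^ p.eval n)}

end ExRules

/-! Entailment is decided by saturation: all atoms of bounded size are computed that follow from the
facts by Skolemised TGDs and by replacing, in either direction, terms that an EGD equates; then the
query is evaluated on the result. Positive answers are correct for every ontology and every size
bound, because the Skolem functions can be interpreted in any model by chosen witnesses, which makes
all derivable atoms true (`Derivable.sound`).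

For completeness, let `r` send terms to smaller ones, every replacement being licensed by EGDs, and
consider the chase by TGDs in which each new term `t` is at once replaced by `r t`. Erasing the
constants carries this chase into the EMFA set (`Chase.emfaSet`), so its terms are acyclic; its
atoms are derivable (`Chase.derivable`). If it violates an EGD, the larger of the two terms can be
sent to the smaller one, at the price of forgetting `r` on still larger terms (`Normalises.refine`).
Only finitely many terms are admissible, so some `r` has a maximal set of replaced terms, in the
colexicographic order where small terms weigh most. For this `r` the chase satisfies all EGDs
(`exists_normalises_egd`) and is a model, in which an entailed query must have a match
(`exists_derivable_of_entails`).

Along a branch of an acyclic term no Skolem symbol repeats, so for instances of size `n` terms have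
size at most `(n + 8) ^ (n + 1)` and atoms at most `2 ^ (n + 8) ^ 2`. There are at most doubly
exponentially many such atoms, and `2 ^ 2 ^ (n + 8) ^ 3` bounds the number of rounds and the tables
of assignments (`ample_of_length`).

As to time, `answer` receives both bounds as lists of that length and runs in polynomial time in all
of its arguments; building the lists takes exponential and doubly exponential time. Polynomial time
is set up by structured stack programs, which compile to Turing machines and operate on a stack of
binary trees in prefix code. The polynomial-time functions on trees are closed under composition and
under folds with additive growth (`PolyTime.foldl`). -/

namespace ExRules

/-! ### Binary trees as a universal data type -/

/-- Binary trees. -/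
inductive BinTree where
  | leaf
  | node (a b : BinTree)
  deriving DecidableEq

namespace BinTree

/-- The prefix code of a tree. -/
def code : BinTree → List Bool
  | leaf => [false]
  | node a b => true :: (a.code ++ b.code)

/-- The length of the prefix code. -/
def size : BinTree → ℕ
  | leaf => 1
  | node a b => a.size + b.size + 1

/-- Left child; a leaf is its own left child. -/
def fst : BinTree → BinTree
  | leaf => leaf
  | node a _ => a

/-- Right child; a leaf is its own right child. -/
def snd : BinTree → BinTree
  | leaf => leaf
  | node _ b => b

/-- Trees as lists of trees, read along the right spine. -/
def toList : BinTree → List BinTree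
  | leaf => []
  | node a b => a :: b.toList

/-- Lists of trees as trees. -/
def ofList : List BinTree → BinTree
  | [] => leaf
  | a :: l => node a (ofList l)

@[simp] theorem code_length (x : BinTree) : x.code.length = x.size := by
  induction x with
  | leaf => rfl
  | node a b ha hb => simp [code, size, ha, hb]

theorem size_pos (x : BinTree) : 0 < x.size := by
  cases x <;> simp [size]

/-- The prefix code is self-delimiting: the first symbol tells whether two further codes follow or
none. Codes can therefore be stacked without separators. -/
theorem code_append_inj {x y : BinTree} {s t : List Bool} (h : x.code ++ s = y.code ++ t) :
    x = y ∧ s = t := by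
  induction x generalizing y s t with
  | leaf => cases y <;> simp_all [code]
  | node a b ha hb =>
    cases y with
    | leaf => simp [code] at h
    | node c d =>
      simp only [code, List.cons_append, List.append_assoc, List.cons.injEq, true_and] at h
      obtain ⟨rfl, h1⟩ := ha h
      obtain ⟨rfl, h2⟩ := hb h1
      exact ⟨rfl, h2⟩

theorem code_injective : Function.Injective code := fun x y h =>
  (code_append_inj (s := []) (t := []) (by simpa using h)).1

@[simp] theorem toList_ofList (l : List BinTree) : (ofList l).toList = l := by
  induction l with
  | nil => rfl
  | cons a l ih => simp [ofList, toList, ih]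

@[simp] theorem ofList_toList (x : BinTree) : ofList x.toList = x := by
  induction x with
  | leaf => rfl
  | node a b _ hb => simp [ofList, toList, hb]

theorem ofList_injective : Function.Injective ofList :=
  Function.LeftInverse.injective toList_ofList

/-- A truth value as a tree. -/
def ofBool : Bool → BinTree
  | false => leaf
  | true => node leaf leaf

theorem ofBool_injective : Function.Injective ofBool := by
  intro a b h
  cases a <;> cases b <;> simp_all [ofBool]

theorem size_le_of_mem_toList {a x : BinTree} (h : a ∈ x.toList) : a.size < x.size := by
  induction x with
  | leaf => simp [toList] at h
  | node b c _ hc =>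
    simp only [toList, List.mem_cons] at h
    simp only [size]
    rcases h with rfl | h
    · omega
    · have := hc h
      omega

theorem length_lt_size_ofList (l : List BinTree) : l.length < (ofList l).size := by
  induction l with
  | nil => simp [ofList, size]
  | cons a l ih => simp only [ofList, size, List.length_cons]; omega

theorem size_ofList_le {l : List BinTree} {s : ℕ} (h : ∀ a ∈ l, a.size ≤ s) :
    (ofList l).size ≤ l.length * (s + 1) + 1 := by
  induction l with
  | nil => simp [ofList, size]
  | cons a l ih =>
    have h1 := h a (by simp)
    have h2 := ih fun b hb => h b (by simp [hb])
    simp only [ofList, size, List.length_cons, Nat.add_mul]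
    omega

/-! ### Counting trees of bounded size. -/

/-- There are less than `2 ^ (s + 1)` bit strings of length at most `s`. -/
theorem exists_finset_bitStrings (s : ℕ) : ∃ F : Finset (List Bool), F.card + 1 ≤ 2 ^ (s + 1) ∧
    ∀ w : List Bool, w.length ≤ s → w ∈ F := by
  induction s with
  | zero => exact ⟨{[]}, by simp, fun w hw => by simp_all⟩
  | succ s ih =>
    obtain ⟨F, hF, hm⟩ := ih
    refine ⟨insert [] (F.image (List.cons true) ∪ F.image (List.cons false)), ?_, ?_⟩
    · have h0 := Finset.card_insert_le []
        (F.image (List.cons true) ∪ F.image (List.cons false))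
      have := Finset.card_union_le (F.image (List.cons true)) (F.image (List.cons false))
      have h1 := Finset.card_image_le (s := F) (f := List.cons true)
      have h2 := Finset.card_image_le (s := F) (f := List.cons false)
      rw [pow_succ]
      omega
    · intro w hw
      match w with
      | [] => simp
      | true :: w => simp [hm w (by simpa using hw)]
      | false :: w => simp [hm w (by simpa using hw)]

/-- A list without repetitions of trees of size at most `s` has less than `2 ^ (s + 1)` members. -/
theorem length_lt_of_nodup {l : List BinTree} {s : ℕ} (hl : l.Nodup) (h : ∀ a ∈ l, a.size ≤ s) :
    l.length < 2 ^ (s + 1) := by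
  obtain ⟨F, hF, hm⟩ := exists_finset_bitStrings s
  have h1 : (l.toFinset.image code).card = l.length := by
    rw [Finset.card_image_of_injective _ code_injective, List.toFinset_card_of_nodup hl]
  have h2 : l.toFinset.image code ⊆ F := by
    intro w hw
    simp only [Finset.mem_image, List.mem_toFinset] at hw
    obtain ⟨a, ha, rfl⟩ := hw
    exact hm _ (by simpa using h a ha)
  have := Finset.card_le_card h2
  omega

theorem finite_size_le (s : ℕ) : {x : BinTree | x.size ≤ s}.Finite := by
  obtain ⟨F, -, hm⟩ := exists_finset_bitStrings s
  refine Set.Finite.of_injOn (f := code) (t := F) ?_ code_injective.injOn F.finite_toSet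
  intro x hx
  exact hm _ (by simpa using hx)

end BinTree

open BinTree

/-! ### Tree codes of names, terms and atoms -/

/-- The tree code of a name. -/
def nameTree (n : ℕ) : BinTree :=
  ofList ((Computability.encodeNat n).map ofBool)

theorem nameTree_injective : Function.Injective nameTree := by
  intro m n h
  have h1 := List.map_injective_iff.2 ofBool_injective (ofList_injective h)
  rw [← Computability.decode_encodeNat m, h1, Computability.decode_encodeNat]

/-- The tree code of the constant with the code `c`. -/
def constTree (c : BinTree) : BinTree :=
  node leaf c

/-- The tree code of the Skolem term with function symbol and arguments given by their codes. -/
def appTree (f : BinTree) (ts : List BinTree) : BinTree :=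
  node (node leaf leaf) (node f (ofList ts))

/-- The tree code of a ground term. -/
def termTree : GTerm → BinTree
  | .star => leaf
  | .const c => constTree (nameTree c)
  | .app f _ ts => appTree (nameTree f) (List.ofFn fun i => termTree (ts i))

theorem termTree_injective : Function.Injective termTree := by
  intro s
  induction s with
  | star => intro t h; cases t <;> simp_all [termTree, constTree, appTree]
  | const c =>
    intro t h
    cases t with
    | star => simp [termTree, constTree] at h
    | const d =>
      simp only [termTree, constTree, node.injEq, true_and] at h
      rw [nameTree_injective h]
    | app => simp [termTree, constTree, appTree] at h
  | app f n ts ih =>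
    intro t h
    cases t with
    | star => simp [termTree, appTree] at h
    | const d => simp [termTree, constTree, appTree] at h
    | app g m us =>
      simp only [termTree, appTree, node.injEq, true_and] at h
      obtain ⟨h1, h2⟩ := h
      have h3 := ofList_injective h2
      obtain rfl : n = m := by simpa using congrArg List.length h3
      rw [List.ofFn_inj] at h3
      rw [nameTree_injective h1]
      congr
      funext i
      exact ih i (congrFun h3 i)

/-- The tree code of an atom whose arguments have the codes given by `g`. -/
def atomTree {T : Type} (g : T → BinTree) (A : Atom T) : BinTree :=
  node (nameTree A.pred.name) (ofList (List.ofFn fun i => g (A.args i)))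

theorem atomTree_injective {T : Type} {g : T → BinTree} (hg : Function.Injective g) :
    Function.Injective (atomTree g) := by
  rintro ⟨⟨m, k, hk⟩, a⟩ ⟨⟨n, l, hl⟩, b⟩ h
  simp only [atomTree, node.injEq] at h
  obtain ⟨h1, h2⟩ := h
  obtain rfl := nameTree_injective h1
  have h3 := ofList_injective h2
  obtain rfl : k = l := by simpa using congrArg List.length h3
  rw [List.ofFn_inj] at h3
  congr
  funext i
  exact hg (congrFun h3 i)

/-! ### Derivable atoms -/

/-- The atoms derivable from the facts of an ontology by its skolemised TGDs and by the replacements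
that its EGDs give rise to, where only atoms that satisfy `lim` are admitted. -/
inductive Derivable (O : Ontology) (lim : Atom GTerm → Prop) : Atom GTerm → Prop
  | fact (A : Atom Constant) (hA : A ∈ O.facts) (hl : lim (A.map .const)) :
      Derivable O lim (A.map .const)
  | tgd (body head : List (Atom Var)) (hρ : Rule.tgd body head ∈ O.rules) (σ : Var → GTerm)
      (hσ : ∀ B ∈ body, Derivable O lim (B.map σ)) (A : Atom Var) (hA : A ∈ head)
      (hl : lim (A.map (skolemSubst body head σ))) :
      Derivable O lim (A.map (skolemSubst body head σ))
  | egd_left (body : List (Atom Var)) (x y : Var) (hρ : Rule.egd body x y ∈ O.rules)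
      (σ : Var → GTerm) (hσ : ∀ B ∈ body, Derivable O lim (B.map σ)) (A : Atom GTerm)
      (hA : Derivable O lim A) (hl : lim (A.replace (σ y) (σ x))) :
      Derivable O lim (A.replace (σ y) (σ x))
  | egd_right (body : List (Atom Var)) (x y : Var) (hρ : Rule.egd body x y ∈ O.rules)
      (σ : Var → GTerm) (hσ : ∀ B ∈ body, Derivable O lim (B.map σ)) (A : Atom GTerm)
      (hA : Derivable O lim A) (hl : lim (A.replace (σ x) (σ y))) :
      Derivable O lim (A.replace (σ x) (σ y))

theorem Derivable.lim {O : Ontology} {lim : Atom GTerm → Prop} {A : Atom GTerm}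
    (h : Derivable O lim A) : lim A := by
  cases h <;> assumption

theorem mem_varsOf {β : List (Atom Var)} {v : Var} :
    v ∈ varsOf β ↔ ∃ A ∈ β, ∃ i, A.args i = v := by
  simp [varsOf, List.mem_ofFn]

theorem mem_frontier {body head : List (Atom Var)} {v : Var} :
    v ∈ frontier body head ↔ v ∈ varsOf body ∧ v ∈ varsOf head := by
  simp [frontier]

theorem Rule.mem_varsOf_of_mem_exVars {ρ : Rule} {w : Var} (h : w ∈ ρ.exVars) :
    w ∈ varsOf ρ.atoms := by
  cases ρ with
  | tgd body head =>
    obtain ⟨A, hA, i, hi⟩ := mem_varsOf.1 (List.mem_filter.1 h).1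
    exact mem_varsOf.2 ⟨A, List.mem_append_right _ hA, i, hi⟩
  | egd body x y => simp [Rule.exVars] at h

/-! ### Soundness -/

section Soundness

variable {D : Type} (I : Interp D) (O : Ontology)

open Classical in
/-- An assignment that satisfies the head of a TGD for the values `l` of its frontier. -/
noncomputable def headWitness (body head : List (Atom Var)) (l : List D) : Var → D :=
  if h : ∃ v : Var → D, (frontier body head).map v = l ∧ I.Sat head v then h.choose
  else fun _ => I.const 0

open Classical in
/-- Interpretations of the Skolem function symbols. -/
noncomputable def skolemFun (w : Var) (l : List D) : D :=
  if h : ∃ p : List (Atom Var) × List (Atom Var),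
      Rule.tgd p.1 p.2 ∈ O.rules ∧ w ∈ (Rule.tgd p.1 p.2).exVars then
    headWitness I h.choose.1 h.choose.2 l w
  else I.const 0

/-- The value of a ground term in an interpretation. -/
noncomputable def termVal : GTerm → D
  | .star => I.const 0
  | .const c => I.const c
  | .app w _ ts => skolemFun I O w (List.ofFn fun i => termVal (ts i))

/-- An existentially quantified variable occurs in only one rule, so the rule chosen for `w` in
`skolemFun` must be the given one. -/
theorem skolemFun_eq {body head : List (Atom Var)} (hρ : Rule.tgd body head ∈ O.rules) {w : Var}
    (hw : w ∈ (Rule.tgd body head).exVars) (l : List D) :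
    skolemFun I O w l = headWitness I body head l w := by
  have h : ∃ p : List (Atom Var) × List (Atom Var),
      Rule.tgd p.1 p.2 ∈ O.rules ∧ w ∈ (Rule.tgd p.1 p.2).exVars := ⟨(body, head), hρ, hw⟩
  have h1 : Rule.tgd h.choose.1 h.choose.2 = Rule.tgd body head := by
    by_contra hne
    exact O.exVars_apart _ hρ _ h.choose_spec.1 (Ne.symm hne) w hw
      (Rule.mem_varsOf_of_mem_exVars h.choose_spec.2)
  rw [skolemFun, dif_pos h]
  simp only [Rule.tgd.injEq] at h1
  rw [h1.1, h1.2]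

/-- Skolem functions are interpreted by head witnesses, and terms equated by an EGD have the same
value in a model, so replacing one by the other preserves truth in both directions. -/
theorem Derivable.sound {lim : Atom GTerm → Prop} (hR : ∀ ρ ∈ O.rules, I.ModelsRule ρ)
    (hF : ∀ A ∈ O.facts, I.ModelsFact A) {A : Atom GTerm} (h : Derivable O lim A) :
    I.rel A.pred fun i => termVal I O (A.args i) := by
  have key : ∀ (A : Atom GTerm) (s t : GTerm), termVal I O s = termVal I O t →
      (I.rel A.pred fun i => termVal I O (A.args i)) →
      I.rel (A.replace s t).pred fun i => termVal I O ((A.replace s t).args i) := by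
    intro A s t hst hA
    have : (fun i => termVal I O ((A.replace s t).args i)) =
        fun i : Fin A.pred.arity => termVal I O (A.args i) := by
      funext i
      simp only [Atom.replace, Atom.map]
      split_ifs with h
      · rw [h, hst]
      · rfl
    exact this ▸ hA
  induction h with
  | fact A hA hl => exact hF A hA
  | tgd body head hρ σ hσ A hA hl ih =>
    obtain ⟨v', hv', hs⟩ := hR _ hρ (fun x => termVal I O (σ x)) ih
    -- The witness of the head sees only the frontier values. This is enough, since no other body
    -- variable occurs in the head; `hex` ensures that `headWitness` is a genuine choice and not its
    -- default.
    have hex : ∃ v : Var → D, (frontier body head).map v =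
        (frontier body head).map (fun x => termVal I O (σ x)) ∧ I.Sat head v :=
      ⟨v', List.map_congr_left fun x hx => hv' x (mem_frontier.1 hx).1, hs⟩
    have hw : headWitness I body head ((frontier body head).map fun x => termVal I O (σ x)) =
        hex.choose := by
      rw [headWitness, dif_pos hex]
    have hsat := hex.choose_spec.2 A hA
    change I.rel A.pred fun i => termVal I O (skolemSubst body head σ (A.args i))
    convert hsat using 2 with i
    rw [← hw]
    have hv : A.args i ∈ varsOf head := mem_varsOf.2 ⟨A, hA, i, rfl⟩
    simp only [skolemSubst]
    split_ifs with hb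
    · have h2 := List.map_inj_left.1 hex.choose_spec.1 _ (mem_frontier.2 ⟨hb, hv⟩)
      rw [hw, h2]
    · rw [termVal, skolemFun_eq I O hρ (by simp [Rule.exVars, hv, hb])]
      congr 1
      refine List.ext_getElem (by simp) fun j h1 h2 => ?_
      simp
  | egd_left body x y hρ σ hσ A hA hl ih ih' =>
    exact key A _ _ (hR _ hρ (fun v => termVal I O (σ v)) ih).symm ih'
  | egd_right body x y hρ σ hσ A hA hl ih ih' =>
    exact key A _ _ (hR _ hρ (fun v => termVal I O (σ v)) ih) ih'

end Soundness

theorem entails_of_derivable {O : Ontology} {lim : Atom GTerm → Prop} {q : BCQ} (σ : Var → GTerm)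
    (h : ∀ A ∈ q.body, Derivable O lim (A.map σ)) : O.Entails q := fun _ I hR hF =>
  ⟨fun v => termVal I O (σ v), fun A hA => (h A hA).sound I O hR hF⟩

/-! ### Erasing constants -/

namespace GTerm

/-- Replace every constant by `⋆`. -/
def erase : GTerm → GTerm
  | star => star
  | const _ => star
  | app f n ts => app f n fun i => (ts i).erase

/-- No subterm is cyclic. -/
def Acyclic : GTerm → Prop
  | star => True
  | const _ => True
  | app f _ ts => (∀ i, ¬ (ts i).Occurs f) ∧ ∀ i, (ts i).Acyclic

@[simp] theorem depth_erase (t : GTerm) : t.erase.depth = t.depth := by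
  induction t with
  | star => rfl
  | const c => rfl
  | app f n ts ih => simp [erase, depth, ih]

@[simp] theorem occurs_erase {f : Var} (t : GTerm) : t.erase.Occurs f ↔ t.Occurs f := by
  induction t with
  | star => rfl
  | const c => rfl
  | app g n ts ih => simp [erase, Occurs, ih]

@[simp] theorem acyclic_erase (t : GTerm) : t.erase.Acyclic ↔ t.Acyclic := by
  induction t with
  | star => rfl
  | const c => rfl
  | app g n ts ih => simp [erase, Acyclic, ih]

theorem depth_lt_app (f : Var) {n : ℕ} (ts : Fin n → GTerm) (i : Fin n) :
    (ts i).depth < (app f n ts).depth := by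
  have := Finset.le_sup (f := fun i => (ts i).depth) (Finset.mem_univ i)
  simp only [depth]
  omega

theorem depth_pos (t : GTerm) : 0 < t.depth := by
  cases t <;> simp [depth]

end GTerm

/-- `IsEMFA` speaks of the arguments of atoms only. Induction extends it to all subterms, because
the arguments of a new Skolem term are themselves arguments of earlier atoms. -/
theorem EMFASet.acyclic {O : Ontology} (hO : O.IsEMFA) {A : Atom GTerm} (h : EMFASet O.rules A)
    (i : Fin A.pred.arity) : (A.args i).Acyclic := by
  have hvar : ∀ (body : List (Atom Var)) (σ : Var → GTerm),
      (∀ B ∈ body, ∀ i, ((B.map σ).args i).Acyclic) → ∀ x ∈ varsOf body, (σ x).Acyclic := by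
    intro body σ ih x hx
    obtain ⟨B, hB, j, rfl⟩ := mem_varsOf.1 hx
    exact ih B hB j
  have hrep : ∀ (A : Atom GTerm) (s t : GTerm), (∀ i, (A.args i).Acyclic) → t.Acyclic →
      ∀ i, ((A.replace s t).args i).Acyclic := by
    intro A s t hA ht i
    simp only [Atom.replace, Atom.map]
    split_ifs
    exacts [ht, hA i]
  induction h with
  | critical P hP => trivial
  | tgd body head hρ σ hσ A hA ih =>
    have hc := hO _ (EMFASet.tgd body head hρ σ hσ A hA) i
    simp only [Atom.map, skolemSubst] at hc ⊢
    split_ifs at hc ⊢ with hb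
    · exact hvar body σ (fun B hB j => ih B hB j) _ hb
    · exact ⟨fun j hj => hc ⟨j, hj⟩, fun j =>
        hvar body σ (fun B hB j => ih B hB j) _ (mem_frontier.1 (List.get_mem _ _)).1⟩
  | egd_left body x y hρ σ hσ hd A hA ih ih' =>
    exact hrep A _ _ ih' (hvar body σ (fun B hB j => ih B hB j) _ (O.rules_wellFormed _ hρ).2.1) i
  | egd_right body x y hρ σ hσ hd A hA ih ih' =>
    exact hrep A _ _ ih' (hvar body σ (fun B hB j => ih B hB j) _ (O.rules_wellFormed _ hρ).2.2) i

/-! ### Simultaneous replacement as a sequence of single replacements. -/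

/-- A set of atoms that is closed under the replacements `s ↦ τ s`, all of which decrease the rank
of a term, is closed under the simultaneous replacement `τ`. -/
theorem map_mem_of_replace {ι : Type} [LinearOrder ι] (rank : GTerm → ι) (X : Atom GTerm → Prop)
    (τ : GTerm → GTerm)
    (hτ : ∀ s, τ s ≠ s → rank (τ s) < rank s ∧ ∀ A, X A → X (A.replace s (τ s)))
    {A : Atom GTerm} (hA : X A) : X (A.map τ) := by
  classical
  have key : ∀ F : Finset GTerm, X (A.map fun s => if s ∈ F then τ s else s) := by
    intro F
    induction F using Finset.induction_on_max_value rank with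
    | empty => simpa [Atom.map] using hA
    | insert a F ha hmax ih =>
      by_cases hfix : τ a = a
      · convert ih using 2
        funext s
        by_cases hs : s = a
        · subst hs; simp [ha, hfix]
        · simp [hs]
      · have h1 := (hτ a hfix).2 _ ih
        convert h1 using 1
        simp only [Atom.replace, Atom.map, Atom.mk.injEq, heq_eq_eq, true_and]
        funext i
        by_cases hs : A.args i = a
        · simp [hs, ha]
        · by_cases hF : A.args i ∈ F
          -- The terms in `F` have rank at most that of `a`, and those that are moved land strictly
          -- below. Replacing `a` last therefore leaves the images already in place untouched.
          · have hne : τ (A.args i) ≠ a := by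
              intro h
              by_cases hfix' : τ (A.args i) = A.args i
              · exact hs (hfix'.symm.trans h)
              · have h2 := (hτ _ hfix').1
                have h3 := hmax _ hF
                rw [h] at h2
                exact absurd h3 (not_le.2 h2)
            simp [hF, hne]
          · simp [hs, hF]
  -- Only finitely many terms occur in `A`, so on `A` the map `τ` agrees with its restriction to a
  -- finite set.
  convert key (Finset.univ.image A.args) using 1
  simp [Atom.map]

/-! ### Completeness for EMFA ontologies -/

/-- A numbering of the ground terms. -/
def termCode (t : GTerm) : ℕ :=
  Encodable.encode (termTree t).code

theorem termCode_injective : Function.Injective termCode :=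
  Encodable.encode_injective.comp (code_injective.comp termTree_injective)

/-- The rank of a term: terms are compared by depth first. -/
def termRank (t : GTerm) : ℕ ×ₗ ℕ :=
  toLex (t.depth, termCode t)

theorem termRank_injective : Function.Injective termRank := fun _ _ h =>
  termCode_injective (congrArg (fun p => (ofLex p).2) h)

/-- A refinement of the rank that compares terms without their constants first. -/
def termKey (t : GTerm) : (ℕ ×ₗ ℕ) ×ₗ ℕ :=
  toLex (termRank t.erase, termCode t)

theorem termKey_injective : Function.Injective termKey := fun _ _ h =>
  termCode_injective (congrArg (fun p => (ofLex p).2) h)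

/-- This is why `termKey` compares erasures first: after erasing constants, a replacement that
lowers the key still does not raise the rank. -/
theorem termRank_erase_le {s t : GTerm} (h : termKey s < termKey t) :
    termRank s.erase ≤ termRank t.erase := by
  rcases Prod.Lex.toLex_lt_toLex.1 h with h | h
  · exact h.le
  · exact h.1.le

theorem depth_le_of_termRank_le {s t : GTerm} (h : termRank s ≤ termRank t) :
    s.depth ≤ t.depth := by
  rcases Prod.Lex.toLex_le_toLex.1 h with h | h
  · exact h.le
  · exact h.1.le

theorem depth_le_of_termKey_lt {s t : GTerm} (h : termKey s < termKey t) : s.depth ≤ t.depth := by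
  simpa using depth_le_of_termRank_le (termRank_erase_le h)

/-- Terms over the constants in the facts and the Skolem functions of an ontology. -/
inductive Built (O : Ontology) : GTerm → Prop
  | const (A : Atom Constant) (hA : A ∈ O.facts) (i : Fin A.pred.arity) :
      Built O (.const (A.args i))
  | app (body head : List (Atom Var)) (hρ : Rule.tgd body head ∈ O.rules) (w : Var)
      (hw : w ∈ (Rule.tgd body head).exVars) (ts : Fin (frontier body head).length → GTerm)
      (hts : ∀ i, Built O (ts i)) : Built O (.app w _ ts)

/-- The terms that occur in the chase of an EMFA ontology. -/
structure Admissible (O : Ontology) (t : GTerm) : Prop where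
  built : Built O t
  acyclic : t.Acyclic

/-- Atoms over admissible terms. -/
structure AdmissibleAtom (O : Ontology) (A : Atom GTerm) : Prop where
  occurs : OccursIn A.pred O.rules
  args : ∀ i, Admissible O (A.args i)

/-! ### Chases with immediate normalisation of new terms. -/

/-- The chase by TGDs in which every new term `t` is at once replaced by `r t`. -/
inductive Chase (O : Ontology) (r : GTerm → GTerm) : Atom GTerm → Prop
  | fact (A : Atom Constant) (hA : A ∈ O.facts) : Chase O r (A.map fun c => r (.const c))
  | tgd (body head : List (Atom Var)) (hρ : Rule.tgd body head ∈ O.rules) (σ : Var → GTerm)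
      (hσ : ∀ B ∈ body, Chase O r (B.map σ)) (A : Atom Var) (hA : A ∈ head) :
      Chase O r (A.map fun v => if v ∈ varsOf body then σ v else r (skolemSubst body head σ v))

/-- The replacement `r` of terms is justified by the EGDs. -/
structure Normalises (O : Ontology) (r : GTerm → GTerm) : Prop where
  idem : ∀ t, r (r t) = r t
  lt : ∀ t, r t ≠ t → termKey (r t) < termKey t
  adm : ∀ t, r t ≠ t → Admissible O t ∧ Admissible O (r t)
  emfa : ∀ t, r t ≠ t → ∀ A, EMFASet O.rules A → EMFASet O.rules (A.replace t.erase (r t).erase)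
  der : ∀ t, r t ≠ t → ∀ A, Derivable O (AdmissibleAtom O) A →
    Derivable O (AdmissibleAtom O) (A.replace t (r t))

theorem Normalises.id (O : Ontology) : Normalises O id where
  idem _ := rfl
  lt _ h := (h rfl).elim
  adm _ h := (h rfl).elim
  emfa _ h := (h rfl).elim
  der _ h := (h rfl).elim

section

variable {O : Ontology} {r : GTerm → GTerm}

/-- The frontier of a TGD is non-empty, so every built Skolem term has depth at least `2`. Hence
constants can only be replaced by constants, and normalised facts erase to the critical instance. -/
theorem Built.erase_eq_star {t : GTerm} (h : Built O t) (hd : t.depth ≤ 1) : t.erase = .star := by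
  cases h with
  | const => rfl
  | app body head hρ w hw ts hts =>
    have h0 : 0 < (frontier body head).length :=
      List.length_pos_iff.2 (O.rules_wellFormed _ hρ).2.2
    have h1 := GTerm.depth_lt_app w ts ⟨0, h0⟩
    have h2 := (ts ⟨0, h0⟩).depth_pos
    omega

theorem Normalises.erase_const (hr : Normalises O r) (c : Constant) :
    (r (.const c)).erase = .star := by
  by_cases h : r (.const c) = .const c
  · rw [h]; rfl
  · exact (hr.adm _ h).2.built.erase_eq_star (depth_le_of_termKey_lt (hr.lt _ h))

theorem skolemSubst_of_notMem {body head : List (Atom Var)} {σ : Var → GTerm} {v : Var}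
    (h : v ∉ varsOf body) : skolemSubst body head σ v =
      .app v (frontier body head).length fun i => σ ((frontier body head).get i) :=
  if_neg h

theorem skolemSubst_erase (body head : List (Atom Var)) (σ : Var → GTerm) (v : Var) :
    skolemSubst body head (fun x => (σ x).erase) v = (skolemSubst body head σ v).erase := by
  unfold skolemSubst
  split_ifs <;> rfl

/-- A chase step is a Skolemised TGD followed by replacements of the new terms, and both have
counterparts in the EMFA set. The replacements do not induce a map on erased terms, as terms with
equal erasure may have different images under `r`; so only the new terms of a single rule
application are considered at a time. -/
theorem Chase.emfaSet (hr : Normalises O r) {A : Atom GTerm} (h : Chase O r A) :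
    EMFASet O.rules (A.map GTerm.erase) := by
  classical
  induction h with
  | fact A hA =>
    convert EMFASet.critical A.pred (O.facts_preds A hA) using 1
    simp only [Atom.map, Atom.mk.injEq, heq_eq_eq, true_and]
    funext i
    exact hr.erase_const _
  | tgd body head hρ σ hσ A hA ih =>
    have h0 := EMFASet.tgd body head hρ (fun x => (σ x).erase) ih A hA
    -- `τ` moves only the erased new Skolem terms. The choice is unambiguous, because the variable
    -- `v` is the outermost function symbol of its Skolem term.
    let τ : GTerm → GTerm := fun s =>
      if h : ∃ v, v ∉ varsOf body ∧ s = (skolemSubst body head σ v).erase then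
        (r (skolemSubst body head σ h.choose)).erase else s
    have h1 : EMFASet O.rules ((A.map (skolemSubst body head fun x => (σ x).erase)).map τ) := by
      refine map_mem_of_replace termRank _ τ ?_ h0
      intro s hs
      by_cases h : ∃ v, v ∉ varsOf body ∧ s = (skolemSubst body head σ v).erase
      · have hτ : τ s = (r (skolemSubst body head σ h.choose)).erase := dif_pos h
        obtain ⟨-, h2⟩ := h.choose_spec
        rw [hτ] at hs ⊢
        have hne : r (skolemSubst body head σ h.choose) ≠ skolemSubst body head σ h.choose := by
          intro h3
          rw [h3] at hs
          exact hs h2.symm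
        constructor
        -- Erasure preserves only the weak inequality; strictness comes from `hs` and injectivity of
        -- the rank.
        · refine lt_of_le_of_ne ?_ (termRank_injective.ne hs)
          conv_rhs => rw [h2]
          exact termRank_erase_le (hr.lt _ hne)
        · have h3 := hr.emfa _ hne
          rwa [← h2] at h3
      · exact (hs (dif_neg h)).elim
    convert h1 using 1
    simp only [Atom.map, Atom.mk.injEq, heq_eq_eq, true_and]
    funext i
    rw [skolemSubst_erase]
    by_cases hb : A.args i ∈ varsOf body
    · have hf : A.args i ∈ frontier body head := mem_frontier.2 ⟨hb, mem_varsOf.2 ⟨A, hA, i, rfl⟩⟩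
      have hsk : skolemSubst body head σ (A.args i) = σ (A.args i) := if_pos hb
      -- A frontier value is an argument of every new Skolem term, hence of smaller depth than all
      -- of them, and `τ` leaves it alone.
      have h2 : ¬ ∃ v, v ∉ varsOf body ∧
          (σ (A.args i)).erase = (skolemSubst body head σ v).erase := by
        rintro ⟨v, hv, h3⟩
        have h4 := congrArg GTerm.depth h3
        obtain ⟨j, hj⟩ := List.mem_iff_get.1 hf
        have h5 := GTerm.depth_lt_app v (fun i => σ ((frontier body head).get i)) j
        rw [GTerm.depth_erase, GTerm.depth_erase, skolemSubst, if_neg hv] at h4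
        simp only [hj] at h5
        omega
      have h3 : τ (σ (A.args i)).erase = (σ (A.args i)).erase := dif_neg h2
      rw [if_pos hb, hsk, h3]
    · have h2 : ∃ v, v ∉ varsOf body ∧
          (skolemSubst body head σ (A.args i)).erase = (skolemSubst body head σ v).erase :=
        ⟨_, hb, rfl⟩
      have h3 : h2.choose = A.args i := by
        obtain ⟨h4, h5⟩ := h2.choose_spec
        generalize h2.choose = v at h4 h5 ⊢
        rw [skolemSubst_of_notMem hb, skolemSubst_of_notMem h4] at h5
        simp only [GTerm.erase, GTerm.app.injEq] at h5
        exact h5.1.symm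
      rw [if_neg hb]
      have h4 : τ (skolemSubst body head σ (A.args i)).erase =
        (r (skolemSubst body head σ h2.choose)).erase := dif_pos h2
      rw [h4, h3]

theorem Chase.fixed (hr : Normalises O r) {A : Atom GTerm} (h : Chase O r A)
    (i : Fin A.pred.arity) : r (A.args i) = A.args i := by
  induction h with
  | fact A hA => exact hr.idem _
  | tgd body head hρ σ hσ A hA ih =>
    simp only [Atom.map]
    split_ifs with hb
    · obtain ⟨B, hB, j, hj⟩ := mem_varsOf.1 hb
      rw [← hj]
      exact ih B hB j
    · exact hr.idem _

/-- The Skolemised rule is applied first, and then `r` as a simultaneous replacement, which fixes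
the old arguments by `Chase.fixed`. The intermediate atom must be admissible too; its acyclicity is
read off from its erasure, which lies in the EMFA set before any normalisation. -/
theorem Chase.derivable (hO : O.IsEMFA) (hr : Normalises O r) {A : Atom GTerm}
    (h : Chase O r A) : Derivable O (AdmissibleAtom O) A := by
  induction h with
  | fact A hA =>
    refine map_mem_of_replace (A := A.map .const) termKey _ r
      (fun s hs => ⟨hr.lt s hs, hr.der s hs⟩) ?_
    exact .fact A hA ⟨O.facts_preds A hA, fun i => ⟨.const A hA i, trivial⟩⟩
  | tgd body head hρ σ hσ A hA ih =>
    have hvar : ∀ x ∈ varsOf body, Admissible O (σ x) ∧ r (σ x) = σ x := by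
      intro x hx
      obtain ⟨B, hB, j, rfl⟩ := mem_varsOf.1 hx
      exact ⟨(ih B hB).lim.args j, (hσ B hB).fixed hr j⟩
    have hE := EMFASet.tgd body head hρ (fun x => (σ x).erase)
      (fun B hB => (hσ B hB).emfaSet hr) A hA
    have h0 : Derivable O (AdmissibleAtom O) (A.map (skolemSubst body head σ)) := by
      refine .tgd body head hρ σ ih A hA ⟨⟨_, hρ, A, by simp [Rule.atoms, hA], rfl⟩, fun i => ?_⟩
      refine ⟨?_, ?_⟩
      · simp only [Atom.map, skolemSubst]
        split_ifs with hb
        · exact (hvar _ hb).1.built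
        · refine .app body head hρ _ ?_ _ fun j =>
            (hvar _ (mem_frontier.1 (List.get_mem _ _)).1).1.built
          simpa [Rule.exVars, hb] using mem_varsOf.2 ⟨A, hA, i, rfl⟩
      · have h1 := hE.acyclic hO i
        simp only [Atom.map, skolemSubst_erase, GTerm.acyclic_erase] at h1
        exact h1
    have h1 := map_mem_of_replace termKey _ r (fun s hs => ⟨hr.lt s hs, hr.der s hs⟩) h0
    convert h1 using 1
    simp only [Atom.map, Atom.mk.injEq, heq_eq_eq, true_and]
    funext i
    split_ifs with hb
    · rw [skolemSubst, if_pos hb, (hvar _ hb).2]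
    · rfl

/-! ### Adding one replacement to a normalisation, and a maximal normalisation. -/

open Classical in
/-- Restrict `r` to the terms below `t`, and replace `t` by `u`. -/
noncomputable def refine (r : GTerm → GTerm) (t u s : GTerm) : GTerm :=
  if termKey s < termKey t then r s else if s = t then u else s

/-- The fields `emfa` and `der` ask for closure properties of sets that do not depend on `r`. The
step from `t` to `u`, justified by the chase for `r`, thus stays justified although the new map has
a different chase. Above `t` the map is reset to the identity, as `r` may send larger terms to `t`,
which would spoil idempotence; below `t` nothing changes, since `r` never raises the key. -/
theorem Normalises.refine (hO : O.IsEMFA) (hr : Normalises O r) {body : List (Atom Var)} {x y : Var}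
    (hρ : Rule.egd body x y ∈ O.rules) {σ : Var → GTerm} (hσ : ∀ B ∈ body, Chase O r (B.map σ))
    {t u : GTerm} (htu : (t = σ y ∧ u = σ x) ∨ (t = σ x ∧ u = σ y))
    (hlt : termKey u < termKey t) : Normalises O (refine r t u) := by
  have hvar : ∀ x ∈ varsOf body, Admissible O (σ x) ∧ r (σ x) = σ x := by
    intro x hx
    obtain ⟨B, hB, j, rfl⟩ := mem_varsOf.1 hx
    exact ⟨((hσ B hB).derivable hO hr).lim.args j, (hσ B hB).fixed hr j⟩
  have hx := hvar x (O.rules_wellFormed _ hρ).2.1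
  have hy := hvar y (O.rules_wellFormed _ hρ).2.2
  have hu : Admissible O u ∧ r u = u := by rcases htu with ⟨-, rfl⟩ | ⟨-, rfl⟩ <;> assumption
  have ht : Admissible O t := by rcases htu with ⟨rfl, -⟩ | ⟨rfl, -⟩; exacts [hy.1, hx.1]
  have e1 : ∀ s, termKey s < termKey t → ExRules.refine r t u s = r s := fun s hs => if_pos hs
  have e2 : ExRules.refine r t u t = u := by simp [ExRules.refine]
  have e3 : ∀ s, ¬ termKey s < termKey t → s ≠ t → ExRules.refine r t u s = s := fun s hs hne => by
    simp [ExRules.refine, hs, hne]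
  have hle : ∀ s, termKey (r s) ≤ termKey s := fun s => by
    by_cases h : r s = s
    · rw [h]
    · exact (hr.lt s h).le
  have hd := depth_le_of_termKey_lt hlt
  have cases : ∀ {P : GTerm → GTerm → Prop}, (∀ s, r s ≠ s → P s (r s)) → P t u →
      ∀ s, ExRules.refine r t u s ≠ s → P s (ExRules.refine r t u s) := by
    intro P h1 h2 s hs
    by_cases hst : termKey s < termKey t
    · rw [e1 s hst] at hs ⊢
      exact h1 s hs
    · by_cases hs' : s = t
      · subst hs'
        rwa [e2]
      · exact (hs (e3 s hst hs')).elim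
  refine ⟨fun s => ?_, cases (P := fun s s' => termKey s' < termKey s) hr.lt hlt,
    cases (P := fun s s' => Admissible O s ∧ Admissible O s') hr.adm ⟨ht, hu.1⟩,
    cases (P := fun s s' => ∀ A, EMFASet O.rules A →
      EMFASet O.rules (A.replace s.erase s'.erase)) hr.emfa ?_,
    cases (P := fun s s' => ∀ A, Derivable O (AdmissibleAtom O) A →
      Derivable O (AdmissibleAtom O) (A.replace s s')) hr.der ?_⟩
  · by_cases hst : termKey s < termKey t
    · rw [e1 s hst, e1 _ ((hle s).trans_lt hst), hr.idem]
    · by_cases hs' : s = t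
      · rw [hs', e2, e1 u hlt, hu.2]
      · rw [e3 s hst hs', e3 s hst hs']
  · intro A hA
    have hE : ∀ B ∈ body, EMFASet O.rules (B.map fun x => (σ x).erase) := fun B hB =>
      (hσ B hB).emfaSet hr
    -- The key compares depths first, so whichever direction lowers it meets the depth condition of
    -- the EMFA set.
    rcases htu with ⟨rfl, rfl⟩ | ⟨rfl, rfl⟩
    · exact .egd_left body x y hρ _ hE (by simpa using hd) A hA
    · exact .egd_right body x y hρ _ hE (by simpa using hd) A hA
  · intro A hA
    have hD : ∀ B ∈ body, Derivable O (AdmissibleAtom O) (B.map σ) := fun B hB =>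
      (hσ B hB).derivable hO hr
    have hl : AdmissibleAtom O (A.replace t u) := by
      refine ⟨hA.lim.occurs, fun i => ?_⟩
      simp only [Atom.replace, Atom.map]
      split_ifs
      exacts [hu.1, hA.lim.args i]
    rcases htu with ⟨rfl, rfl⟩ | ⟨rfl, rfl⟩
    · exact .egd_left body x y hρ σ hD A hA hl
    · exact .egd_right body x y hρ σ hD A hA hl

end

/-- Some justified replacement of terms makes the chase satisfy all EGDs. -/
theorem exists_normalises_egd {O : Ontology} (hO : O.IsEMFA) (hfin : {t | Admissible O t}.Finite) :
    ∃ r, Normalises O r ∧ ∀ (body : List (Atom Var)) (x y : Var), Rule.egd body x y ∈ O.rules →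
      ∀ σ : Var → GTerm, (∀ B ∈ body, Chase O r (B.map σ)) → σ x = σ y := by
  classical
  -- Because of the dual order, the colexicographic comparison of two maps is settled by the
  -- smallest term that exactly one of them replaces.
  let ruled : (GTerm → GTerm) → Finset ((ℕ ×ₗ ℕ) ×ₗ ℕ)ᵒᵈ := fun r =>
    (hfin.toFinset.filter fun t => r t ≠ t).image fun t => OrderDual.toDual (termKey t)
  have hmem : ∀ r, Normalises O r → ∀ t, OrderDual.toDual (termKey t) ∈ ruled r ↔ r t ≠ t := by
    intro r hr t
    simp only [ruled, Finset.mem_image, Finset.mem_filter, Set.Finite.mem_toFinset,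
      Set.mem_ofPred_eq]
    constructor
    · rintro ⟨s, ⟨-, h⟩, h1⟩
      rwa [← termKey_injective (OrderDual.toDual.injective h1)]
    · exact fun h => ⟨t, ⟨(hr.adm t h).1, h⟩, rfl⟩
  let S : Set (Colex (Finset ((ℕ ×ₗ ℕ) ×ₗ ℕ)ᵒᵈ)) :=
    {c | ∃ r, Normalises O r ∧ toColex (ruled r) = c}
  have hS : S.Finite := by
    refine ((hfin.toFinset.powerset.image fun F => toColex (F.image
      fun t => OrderDual.toDual (termKey t))).finite_toSet).subset ?_
    rintro c ⟨r, -, rfl⟩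
    simp only [Finset.coe_image, Set.mem_image, Finset.mem_coe, Finset.mem_powerset]
    exact ⟨_, Finset.filter_subset _ _, rfl⟩
  -- A maximal set of replaced terms exists because all of them are admissible. This choice takes
  -- the place of a termination argument for merging terms.
  obtain ⟨c, hc⟩ := hS.exists_maximal ⟨_, _root_.id, Normalises.id O, rfl⟩
  obtain ⟨⟨r, hr, rfl⟩, hmax⟩ := hc
  have key : ∀ (body : List (Atom Var)) (x y : Var), Rule.egd body x y ∈ O.rules →
      ∀ σ : Var → GTerm, (∀ B ∈ body, Chase O r (B.map σ)) → ∀ t u,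
      ((t = σ y ∧ u = σ x) ∨ (t = σ x ∧ u = σ y)) → ¬ termKey u < termKey t := by
    intro body x y hρ σ hσ t u htu hlt
    have hr' := hr.refine hO hρ hσ htu hlt
    have ht : r t = t := by
      have hvar : ∀ x ∈ varsOf body, r (σ x) = σ x := by
        intro x hx
        obtain ⟨B, hB, j, rfl⟩ := mem_varsOf.1 hx
        exact (hσ B hB).fixed hr j
      rcases htu with ⟨rfl, -⟩ | ⟨rfl, -⟩
      exacts [hvar y (O.rules_wellFormed _ hρ).2.2, hvar x (O.rules_wellFormed _ hρ).2.1]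
    have hne : u ≠ t := fun h => by simp [h] at hlt
    -- Passing to the refined map gains `t` and loses only terms above `t`, which is an increase and
    -- contradicts maximality.
    have h1 : toColex (ruled r) < toColex (ruled (refine r t u)) := by
      rw [Finset.Colex.toColex_lt_toColex_iff_exists_forall_lt]
      refine ⟨OrderDual.toDual (termKey t), ?_, ?_, ?_⟩
      · rw [hmem _ hr']
        simpa [refine] using hne
      · rw [hmem _ hr]
        simpa using ht
      · intro b hb hb'
        obtain ⟨s, hs, rfl⟩ := Finset.mem_image.1 hb
        have hb1 := (hmem _ hr s).1 hb
        rw [hmem _ hr', not_not] at hb'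
        rw [OrderDual.toDual_lt_toDual]
        by_contra hcon
        rcases lt_or_eq_of_le (not_lt.1 hcon) with h | h
        · rw [refine, if_pos h] at hb'
          exact hb1 hb'
        · rw [termKey_injective h] at hb1
          exact hb1 ht
    exact absurd (hmax ⟨_, hr', rfl⟩ h1.le) (not_le.2 h1)
  refine ⟨r, hr, fun body x y hρ σ hσ => ?_⟩
  by_contra hne
  rcases lt_or_gt_of_ne (termKey_injective.ne hne) with h | h
  · exact key body x y hρ σ hσ _ _ (.inl ⟨rfl, rfl⟩) h
  · exact key body x y hρ σ hσ _ _ (.inr ⟨rfl, rfl⟩) h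

/-- The chase for a maximal normalisation is itself a model, with terms as its elements and `c`
denoting `r (.const c)`. A match of the query in it consists of derivable atoms. -/
theorem exists_derivable_of_entails {O : Ontology} (hO : O.IsEMFA)
    (hfin : {t | Admissible O t}.Finite) {q : BCQ} (h : O.Entails q) :
    ∃ σ : Var → GTerm, ∀ A ∈ q.body, Derivable O (AdmissibleAtom O) (A.map σ) := by
  obtain ⟨r, hr, hegd⟩ := exists_normalises_egd hO hfin
  let I : Interp GTerm := ⟨fun c => r (.const c), fun P args => Chase O r ⟨P, args⟩⟩
  have hI : ∀ ρ ∈ O.rules, I.ModelsRule ρ := by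
    intro ρ hρ
    cases ρ with
    | tgd body head =>
      intro v hv
      exact ⟨fun x => if x ∈ varsOf body then v x else r (skolemSubst body head v x),
        fun x hx => if_pos hx, fun A hA => Chase.tgd body head hρ v hv A hA⟩
    | egd body x y => exact fun v hv => hegd body x y hρ v hv
  obtain ⟨σ, hσ⟩ := h GTerm I hI fun A hA => Chase.fact A hA
  exact ⟨σ, fun A hA => Chase.derivable hO hr (hσ A hA)⟩

/-! ### Structured stack programs -/

/-- Structured programs over a family of stacks, with an internal state. -/
inductive Prog {K : Type} (Γ : K → Type) (σ : Type) where
  | push (k : K) (f : σ → Γ k)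
  | pop (k : K) (f : σ → Option (Γ k) → σ)
  | load (f : σ → σ)
  | seq (p q : Prog Γ σ)
  | ite (c : σ → Bool) (p q : Prog Γ σ)
  | loop (c : σ → Bool) (p : Prog Γ σ)

namespace Prog

variable {K : Type} {Γ : K → Type} {σ : Type}

/-- The labels needed to run a program on a stack machine. -/
def Label : Prog Γ σ → Type
  | push _ _ => Unit
  | pop _ _ => Unit
  | load _ => Unit
  | seq p q => p.Label ⊕ q.Label
  | ite _ p q => Option (p.Label ⊕ q.Label)
  | loop _ p => Option p.Label

theorem finite_label : (p : Prog Γ σ) → Finite p.Label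
  | push _ _ => inferInstanceAs (Finite Unit)
  | pop _ _ => inferInstanceAs (Finite Unit)
  | load _ => inferInstanceAs (Finite Unit)
  | seq p q =>
    haveI := finite_label p
    haveI := finite_label q
    inferInstanceAs (Finite (p.Label ⊕ q.Label))
  | ite _ p q =>
    haveI := finite_label p
    haveI := finite_label q
    inferInstanceAs (Finite (Option (p.Label ⊕ q.Label)))
  | loop _ p =>
    haveI := finite_label p
    inferInstanceAs (Finite (Option p.Label))

/-- The first label. -/
def start : (p : Prog Γ σ) → p.Label
  | push _ _ => ()
  | pop _ _ => ()
  | load _ => ()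
  | seq p _ => Sum.inl p.start
  | ite _ _ _ => none
  | loop _ _ => none

/-- The machine code of a program, with labels embedded by `e` and with exit `next`. -/
def machine {Λ : Type} : (p : Prog Γ σ) → (p.Label → Λ) → Λ → p.Label → Turing.TM2.Stmt Γ Λ σ
  | push k f, _, next, _ => .push k f (.goto fun _ => next)
  | pop k f, _, next, _ => .pop k f (.goto fun _ => next)
  | load f, _, next, _ => .load f (.goto fun _ => next)
  | seq p q, e, next, l =>
    match l with
    | Sum.inl l => machine p (fun l => e (Sum.inl l)) (e (Sum.inr q.start)) l
    | Sum.inr l => machine q (fun l => e (Sum.inr l)) next l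
  | ite c p q, e, next, l =>
    match l with
    | none => .branch c (.goto fun _ => e (some (Sum.inl p.start)))
        (.goto fun _ => e (some (Sum.inr q.start)))
    | some (Sum.inl l) => machine p (fun l => e (some (Sum.inl l))) next l
    | some (Sum.inr l) => machine q (fun l => e (some (Sum.inr l))) next l
  | loop c p, e, next, l =>
    match l with
    | none => .branch c (.goto fun _ => e (some p.start)) (.goto fun _ => next)
    | some l => machine p (fun l => e (some l)) (e none) l

theorem iterate_bind_trans {α : Type} {f : α → Option α} {a b : α} {c : Option α} {m n : ℕ}
    (h : (flip bind f)^[m] (some a) = some b) (h' : (flip bind f)^[n] (some b) = c) :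
    (flip bind f)^[m + n] (some a) = c := by
  rw [Nat.add_comm, Function.iterate_add_apply, h, h']

variable [DecidableEq K]

/-- `Run p v S t v' S'`: the program `p` takes the state `v` and the stacks `S` to `v'` and `S'` in
`t` steps. -/
inductive Run : Prog Γ σ → σ → (∀ k, List (Γ k)) → ℕ → σ → (∀ k, List (Γ k)) → Prop
  | push (k : K) (f : σ → Γ k) (v : σ) (S : ∀ k, List (Γ k)) :
      Run (push k f) v S 1 v (Function.update S k (f v :: S k))
  | pop (k : K) (f : σ → Option (Γ k) → σ) (v : σ) (S : ∀ k, List (Γ k)) :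
      Run (pop k f) v S 1 (f v (S k).head?) (Function.update S k (S k).tail)
  | load (f : σ → σ) (v : σ) (S : ∀ k, List (Γ k)) : Run (load f) v S 1 (f v) S
  | seq {p q : Prog Γ σ} {v v' v'' : σ} {S S' S'' : ∀ k, List (Γ k)} {t t' : ℕ}
      (h : Run p v S t v' S') (h' : Run q v' S' t' v'' S'') : Run (seq p q) v S (t + t') v'' S''
  | ite_true {c : σ → Bool} {p q : Prog Γ σ} {v v' : σ} {S S' : ∀ k, List (Γ k)} {t : ℕ}
      (hc : c v = true) (h : Run p v S t v' S') : Run (ite c p q) v S (t + 1) v' S'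
  | ite_false {c : σ → Bool} {p q : Prog Γ σ} {v v' : σ} {S S' : ∀ k, List (Γ k)} {t : ℕ}
      (hc : c v = false) (h : Run q v S t v' S') : Run (ite c p q) v S (t + 1) v' S'
  | loop_false {c : σ → Bool} {p : Prog Γ σ} {v : σ} {S : ∀ k, List (Γ k)} (hc : c v = false) :
      Run (loop c p) v S 1 v S
  | loop_true {c : σ → Bool} {p : Prog Γ σ} {v v' v'' : σ} {S S' S'' : ∀ k, List (Γ k)} {t t' : ℕ}
      (hc : c v = true) (h : Run p v S t v' S') (h' : Run (loop c p) v' S' t' v'' S'') :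
      Run (loop c p) v S (t + 1 + t') v'' S''

/-- The labels are embedded by an arbitrary `e` into a possibly larger machine, so that the
induction passes to subprograms. An elementary instruction and the jump after it form one statement
and take one step; every test takes one further step. -/
theorem Run.machine {Λ : Type} {p : Prog Γ σ} {v v' : σ} {S S' : ∀ k, List (Γ k)} {t : ℕ}
    (h : Run p v S t v' S') (M : Λ → Turing.TM2.Stmt Γ Λ σ) (e : p.Label → Λ) (next : Λ)
    (hM : ∀ l, M (e l) = p.machine e next l) :
    (flip bind (Turing.TM2.step M))^[t] (some ⟨some (e p.start), v, S⟩) =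
      some ⟨some next, v', S'⟩ := by
  induction h generalizing next with
  | push k f v S =>
    have := hM ()
    simp [flip, Prog.start, Turing.TM2.step, this, Prog.machine]
  | pop k f v S =>
    have := hM ()
    simp [flip, Prog.start, Turing.TM2.step, this, Prog.machine]
  | load f v S =>
    have := hM ()
    simp [flip, Prog.start, Turing.TM2.step, this, Prog.machine]
  | seq h h' ih ih' =>
    exact iterate_bind_trans (ih _ _ fun l => hM (Sum.inl l)) (ih' _ _ fun l => hM (Sum.inr l))
  | @ite_true c p q v v' S S' t hc h ih =>
    rw [Nat.add_comm]
    refine iterate_bind_trans (b := ⟨some (e (some (Sum.inl p.start))), v, S⟩) ?_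
      (ih _ _ fun l => hM (some (Sum.inl l)))
    have := hM none
    simp [flip, Prog.start, Turing.TM2.step, this, Prog.machine, hc]
  | @ite_false c p q v v' S S' t hc h ih =>
    rw [Nat.add_comm]
    refine iterate_bind_trans (b := ⟨some (e (some (Sum.inr q.start))), v, S⟩) ?_
      (ih _ _ fun l => hM (some (Sum.inr l)))
    have := hM none
    simp [flip, Prog.start, Turing.TM2.step, this, Prog.machine, hc]
  | loop_false hc =>
    have := hM none
    simp [flip, Prog.start, Turing.TM2.step, this, Prog.machine, hc]
  | @loop_true c p v v' v'' S S' S'' t t' hc h h' ih ih' =>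
    -- The body exits to the loop head `e none`, from which the remaining rounds run.
    refine iterate_bind_trans (b := ⟨some (e none), v', S'⟩) ?_ (ih' e next hM)
    rw [Nat.add_comm]
    refine iterate_bind_trans (b := ⟨some (e (some p.start)), v, S⟩) ?_
      (ih _ _ fun l => hM (some l))
    have := hM none
    simp [flip, Prog.start, Turing.TM2.step, this, Prog.machine, hc]

/-- `p` takes the state `v` and the stacks `S` to `v'` and `S'` in at most `T` steps. -/
def RunLe (p : Prog Γ σ) (v : σ) (S : ∀ k, List (Γ k)) (T : ℕ) (v' : σ) (S' : ∀ k, List (Γ k)) :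
    Prop :=
  ∃ t ≤ T, Run p v S t v' S'

section

variable {p q : Prog Γ σ} {v v' v'' : σ} {S S' S'' : ∀ k, List (Γ k)} {T T' : ℕ}
  {c : σ → Bool}

theorem RunLe.mono (h : RunLe p v S T v' S') (hT : T ≤ T') : RunLe p v S T' v' S' := by
  obtain ⟨t, ht, h⟩ := h
  exact ⟨t, ht.trans hT, h⟩

theorem RunLe.push (k : K) (f : σ → Γ k) (v : σ) (S : ∀ k, List (Γ k)) :
    RunLe (.push k f) v S 1 v (Function.update S k (f v :: S k)) :=
  ⟨1, le_rfl, .push k f v S⟩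

theorem RunLe.pop (k : K) (f : σ → Option (Γ k) → σ) (v : σ) (S : ∀ k, List (Γ k)) :
    RunLe (.pop k f) v S 1 (f v (S k).head?) (Function.update S k (S k).tail) :=
  ⟨1, le_rfl, .pop k f v S⟩

theorem RunLe.load (f : σ → σ) (v : σ) (S : ∀ k, List (Γ k)) : RunLe (.load f) v S 1 (f v) S :=
  ⟨1, le_rfl, .load f v S⟩

theorem RunLe.seq (h : RunLe p v S T v' S') (h' : RunLe q v' S' T' v'' S'') :
    RunLe (.seq p q) v S (T + T') v'' S'' := by
  obtain ⟨t, ht, h⟩ := h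
  obtain ⟨t', ht', h'⟩ := h'
  exact ⟨t + t', Nat.add_le_add ht ht', .seq h h'⟩

theorem RunLe.ite_true (hc : c v = true) (h : RunLe p v S T v' S') :
    RunLe (.ite c p q) v S (T + 1) v' S' := by
  obtain ⟨t, ht, h⟩ := h
  exact ⟨t + 1, by omega, .ite_true hc h⟩

theorem RunLe.ite_false (hc : c v = false) (h : RunLe q v S T v' S') :
    RunLe (.ite c p q) v S (T + 1) v' S' := by
  obtain ⟨t, ht, h⟩ := h
  exact ⟨t + 1, by omega, .ite_false hc h⟩

theorem RunLe.loop_false (hc : c v = false) : RunLe (.loop c p) v S 1 v S :=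
  ⟨1, le_rfl, .loop_false hc⟩

theorem RunLe.loop_true (hc : c v = true) (h : RunLe p v S T v' S')
    (h' : RunLe (.loop c p) v' S' T' v'' S'') : RunLe (.loop c p) v S (T + 1 + T') v'' S'' := by
  obtain ⟨t, ht, h⟩ := h
  obtain ⟨t', ht', h'⟩ := h'
  exact ⟨t + 1 + t', by omega, .loop_true hc h h'⟩

end

end Prog

open Computability (Γ')
open Prog

/-! ### A machine for trees -/

/-- The stacks of the machine beside the input stack: output, main stack, two auxiliary stacks
and a counter. -/
inductive WorkStack where
  | out
  | main
  | aux
  | aux'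
  | count
  deriving DecidableEq

instance : Fintype WorkStack :=
  ⟨{.out, .main, .aux, .aux', .count}, fun k => by cases k <;> simp⟩

/-- The alphabets of the stacks; `none` is the input stack. -/
abbrev StackSym : Option WorkStack → Type
  | none => Γ'
  | some _ => Bool

/-- Programs of the machine; the internal state holds the last symbol read. -/
abbrev TreeProg := Prog (σ := Option Γ') (Γ := StackSym)

/-- The contents of all stacks. -/
def stackState (i : List Γ') (o m a b c : List Bool) : ∀ k, List (StackSym k)
  | none => i
  | some .out => o
  | some .main => m
  | some .aux => a
  | some .aux' => b
  | some .count => c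

section

variable (i i' : List Γ') (o m a b c l : List Bool)

@[simp] theorem stackState_none : stackState i o m a b c none = i := rfl
@[simp] theorem stackState_out : stackState i o m a b c (some .out) = o := rfl
@[simp] theorem stackState_main : stackState i o m a b c (some .main) = m := rfl
@[simp] theorem stackState_aux : stackState i o m a b c (some .aux) = a := rfl
@[simp] theorem stackState_aux' : stackState i o m a b c (some .aux') = b := rfl
@[simp] theorem stackState_count : stackState i o m a b c (some .count) = c := rfl

@[simp] theorem update_stackState_none :
    Function.update (stackState i o m a b c) none i' = stackState i' o m a b c := by
  funext k; rcases k with _ | (_ | _ | _ | _ | _) <;> rfl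

@[simp] theorem update_stackState_out :
    Function.update (stackState i o m a b c) (some .out) l = stackState i l m a b c := by
  funext k; rcases k with _ | (_ | _ | _ | _ | _) <;> rfl

@[simp] theorem update_stackState_main :
    Function.update (stackState i o m a b c) (some .main) l = stackState i o l a b c := by
  funext k; rcases k with _ | (_ | _ | _ | _ | _) <;> rfl

@[simp] theorem update_stackState_aux :
    Function.update (stackState i o m a b c) (some .aux) l = stackState i o m l b c := by
  funext k; rcases k with _ | (_ | _ | _ | _ | _) <;> rfl

@[simp] theorem update_stackState_aux' :
    Function.update (stackState i o m a b c) (some .aux') l = stackState i o m a l c := by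
  funext k; rcases k with _ | (_ | _ | _ | _ | _) <;> rfl

@[simp] theorem update_stackState_count :
    Function.update (stackState i o m a b c) (some .count) l = stackState i o m a b l := by
  funext k; rcases k with _ | (_ | _ | _ | _ | _) <;> rfl

end

/-- Push a fixed symbol. -/
def pushBit (k : WorkStack) (b : Bool) : TreeProg :=
  .push (some k) fun _ => b

/-- Push the symbol last read. -/
def pushRead (k : WorkStack) : TreeProg :=
  .push (some k) fun v => decide (v = some (Γ'.bit true))

/-- Pop a symbol and remember it. -/
def popRead (k : WorkStack) : TreeProg :=
  .pop (f := fun _ s => Option.map Γ'.bit s) (k := some k)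

/-- Do nothing. -/
def skip : TreeProg :=
  .load id

/-- The symbol last read was `true`. -/
def isTrue (v : Option Γ') : Bool :=
  decide (v = some (Γ'.bit true))

@[simp] theorem isTrue_bit (b : Bool) : isTrue (some (Γ'.bit b)) = b := by
  cases b <;> simp [isTrue]

theorem runLe_pushBit (k : WorkStack) (b : Bool) (v : Option Γ') (S : ∀ k, List (StackSym k)) :
    RunLe (pushBit k b) v S 1 v (Function.update S (some k) (b :: S (some k))) :=
  RunLe.push (Γ := StackSym) (some k) _ v S

theorem runLe_pushRead (k : WorkStack) (b : Bool) (S : ∀ k, List (StackSym k)) :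
    RunLe (pushRead k) (some (Γ'.bit b)) S 1 (some (Γ'.bit b))
      (Function.update S (some k) (b :: S (some k))) := by
  cases b <;> exact RunLe.push (Γ := StackSym) (some k) _ _ S

theorem runLe_popRead (k : WorkStack) (v : Option Γ') (S : ∀ k, List (StackSym k)) :
    RunLe (popRead k) v S 1 (Option.map Γ'.bit (S (some k)).head?)
      (Function.update S (some k) (S (some k)).tail) :=
  RunLe.pop (Γ := StackSym) (some k) _ v S

theorem runLe_skip (v : Option Γ') (S : ∀ k, List (StackSym k)) :
    RunLe skip v S 1 v S :=
  RunLe.load (Γ := StackSym) id v S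

/-- Handle all symbols of a stack. -/
def drain (k : WorkStack) (p : TreeProg) : TreeProg :=
  .seq (popRead k) (.loop Option.isSome (.seq p (popRead k)))

/-- `F z s` stands for the stacks when `z` is still to be handled and the data accumulated so far is
`s`; `hget` and `hset` say that `z` is the content of stack `k`. -/
theorem runLe_drain {k : WorkStack} {p : TreeProg} {α : Type}
    (F : List Bool → α → ∀ k, List (StackSym k)) (g : Bool → α → α) (T : ℕ)
    (hget : ∀ z s, F z s (some k) = z)
    (hset : ∀ z s z', Function.update (F z s) (some k) z' = F z' s)
    (hp : ∀ b z s, ∃ v, RunLe p (some (Γ'.bit b)) (F z s) T v (F z (g b s)))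
    (v : Option Γ') (z : List Bool) (s : α) :
    RunLe (drain k p) v (F z s) ((T + 2) * z.length + 2) none
      (F [] (z.foldl (fun s b => g b s) s)) := by
  induction z generalizing v s with
  | nil =>
    have h := runLe_popRead k v (F [] s)
    rw [hget, hset] at h
    exact h.seq (RunLe.loop_false rfl)
  | cons b z ih =>
    have h := runLe_popRead k v (F (b :: z) s)
    rw [hget, hset] at h
    obtain ⟨v', h1⟩ := hp b z s
    obtain ⟨t, ht, h2⟩ := ih v' (g b s)
    -- The induction hypothesis covers a whole `drain`, that is, a pop and a loop. It is taken
    -- apart, because here that pop belongs to the body of the current round.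
    cases h2 with
    | @seq _ _ _ v'' _ _ S'' _ t1 t2 h3 h4 =>
      have h5 : RunLe (.loop Option.isSome (.seq p (popRead k))) (some (Γ'.bit b)) (F z s)
          ((T + t1) + 1 + t2) none (F [] (List.foldl (fun s b => g b s) (g b s) z)) :=
        RunLe.loop_true rfl (h1.seq ⟨t1, le_rfl, h3⟩) ⟨t2, le_rfl, h4⟩
      refine (h.seq h5).mono ?_
      simp only [List.length_cons, Nat.mul_add]
      omega

/-- Move symbols of the main stack to another stack until the pending trees are complete; the
counter holds the number of pending trees beside the current one. -/
def takeLoop (k : WorkStack) : TreeProg :=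
  .loop Option.isSome (.seq (popRead .main) (.seq (pushRead k) (.seq
    (.ite isTrue (.seq (pushBit .count true) (pushBit .count true)) skip) (popRead .count))))

/-- Move the topmost tree of the main stack to another stack, in reverse order. -/
def takeTree (k : WorkStack) : TreeProg :=
  .seq (.load fun _ => some Γ'.blank) (takeLoop k)

/-- A symbol `true` announces two further trees, and every symbol settles one, so the tree is
complete exactly when a pop finds the counter empty. `F` abstracts from the choice of the target
stack. -/
theorem runLe_takeTree {k : WorkStack}
    (F : List Bool → List Bool → List Bool → ∀ k, List (StackSym k))
    (hm : ∀ m z c, F m z c (some .main) = m) (hk : ∀ m z c, F m z c (some k) = z)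
    (hc : ∀ m z c, F m z c (some .count) = c)
    (um : ∀ m z c l, Function.update (F m z c) (some .main) l = F l z c)
    (uk : ∀ m z c l, Function.update (F m z c) (some k) l = F m l c)
    (uc : ∀ m z c l, Function.update (F m z c) (some .count) l = F m z l)
    (v : Option Γ') (x : BinTree) (m z : List Bool) :
    RunLe (takeTree k) v (F (x.code ++ m) z []) (7 * x.size + 2) none
      (F m (x.code.reverse ++ z) []) := by
  have step : ∀ (b : Bool) (g : Γ') (m z c : List Bool) (v' : Option Γ') (T : ℕ)
      (S' : ∀ k, List (StackSym k)) (c' : List Bool),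
      (c' = if b then true :: true :: c else c) →
      RunLe (takeLoop k) (Option.map Γ'.bit c'.head?) (F m (b :: z) c'.tail) T v' S' →
      RunLe (takeLoop k) (some g) (F (b :: m) z c) (T + 7) v' S' := by
    intro b g m z c v' T S' c' hc' h
    have h1 := runLe_popRead .main (some g) (F (b :: m) z c)
    rw [hm, um] at h1
    have h2 := runLe_pushRead k b (F m z c)
    rw [hk, uk] at h2
    have h3 : RunLe (.ite isTrue (.seq (pushBit .count true) (pushBit .count true)) skip)
        (some (Γ'.bit b)) (F m (b :: z) c) 3 (some (Γ'.bit b)) (F m (b :: z) c') := by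
      cases b with
      | true =>
        have h4 := runLe_pushBit .count true (some (Γ'.bit true)) (F m (true :: z) c)
        rw [hc, uc] at h4
        have h5 := runLe_pushBit .count true (some (Γ'.bit true)) (F m (true :: z) (true :: c))
        rw [hc, uc] at h5
        subst hc'
        exact RunLe.ite_true (by simp) (h4.seq h5)
      | false =>
        subst hc'
        exact (RunLe.ite_false (by simp) (runLe_skip _ _)).mono (by omega)
    have h4 := runLe_popRead .count (some (Γ'.bit b)) (F m (b :: z) c')
    rw [hc, uc] at h4
    exact (RunLe.loop_true rfl (h1.seq (h2.seq (h3.seq h4))) h).mono (by omega)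
  -- In this form, with pending trees in `c` and an arbitrary continuation of the loop, the two
  -- subtrees of a node can be handled one after the other. Each symbol costs one round of at most
  -- `7` steps.
  have main : ∀ (x : BinTree) (g : Γ') (m z c : List Bool) (v' : Option Γ') (T : ℕ)
      (S' : ∀ k, List (StackSym k)),
      RunLe (takeLoop k) (Option.map Γ'.bit c.head?) (F m (x.code.reverse ++ z) c.tail) T v' S' →
      RunLe (takeLoop k) (some g) (F (x.code ++ m) z c) (T + 7 * x.size) v' S' := by
    intro x
    induction x with
    | leaf =>
      intro g m z c v' T S' h
      exact step false g m z c v' T S' c (by simp) h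
    | node x y hx hy =>
      intro g m z c v' T S' h
      have h1 := hy (Γ'.bit true) m (x.code.reverse ++ true :: z) c v' T S' (by
        simpa [code] using h)
      have h2 := hx (Γ'.bit true) (y.code ++ m) (true :: z) (true :: c) v' (T + 7 * y.size) S' h1
      have h3 := step true g (x.code ++ (y.code ++ m)) z c v' _ S' _ rfl h2
      simp only [code, size, List.cons_append, List.append_assoc]
      exact h3.mono (by omega)
  -- Loading a blank lets the first loop test succeed; the empty counter stands for one tree.
  refine ((RunLe.load _ v _).seq (main x _ m z [] none 1 _ (RunLe.loop_false rfl))).mono ?_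
  omega

/-! ### Programs as operations on a stack of trees. -/

/-- The state of the stacks when only the main stack is in use. -/
abbrev mainState (m : List Bool) : ∀ k, List (StackSym k) :=
  stackState [] [] m [] [] []

/-- The program `p` replaces the trees `xs` on top of the main stack by `ys` in at most `T`
steps. -/
def Acts (p : TreeProg) (xs : List BinTree) (T : ℕ) (ys : List BinTree) : Prop :=
  ∀ v m, ∃ v', RunLe p v (mainState (xs.flatMap code ++ m)) T v' (mainState (ys.flatMap code ++ m))

namespace Acts

variable {p q : TreeProg} {xs ys zs : List BinTree} {T T' : ℕ}

theorem mono (h : Acts p xs T ys) (hT : T ≤ T') : Acts p xs T' ys := fun v m =>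
  let ⟨v', h'⟩ := h v m
  ⟨v', h'.mono hT⟩

theorem seq (h : Acts p xs T ys) (h' : Acts q ys T' zs) : Acts (.seq p q) xs (T + T') zs := by
  intro v m
  obtain ⟨v', h⟩ := h v m
  obtain ⟨v'', h'⟩ := h' v' m
  exact ⟨v'', h.seq h'⟩

theorem frame (h : Acts p xs T ys) (zs : List BinTree) : Acts p (xs ++ zs) T (ys ++ zs) := by
  intro v m
  obtain ⟨v', h⟩ := h v (zs.flatMap code ++ m)
  exact ⟨v', by simpa using h⟩

theorem skip (xs : List BinTree) : Acts skip xs 1 xs := fun v _ => ⟨v, runLe_skip v _⟩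

end Acts

theorem acts_leaf (xs : List BinTree) : Acts (pushBit .main false) xs 1 (leaf :: xs) := by
  intro v m
  exact ⟨v, by simpa [code] using runLe_pushBit .main false v (mainState (xs.flatMap code ++ m))⟩

theorem acts_node (x y : BinTree) (xs : List BinTree) :
    Acts (pushBit .main true) (x :: y :: xs) 1 (node x y :: xs) := by
  intro v m
  exact ⟨v, by simpa [code] using
    runLe_pushBit .main true v (mainState ((x :: y :: xs).flatMap code ++ m))⟩

theorem foldl_cons_eq (z s : List Bool) :
    z.foldl (fun s b => b :: s) s = z.reverse ++ s := by
  induction z generalizing s with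
  | nil => rfl
  | cons b z ih => simp [ih]

theorem runLe_takeTree_aux (x : BinTree) (v : Option Γ') (m a b : List Bool) :
    RunLe (takeTree .aux) v (stackState [] [] (x.code ++ m) a b []) (7 * x.size + 2) none
      (stackState [] [] m (x.code.reverse ++ a) b []) :=
  runLe_takeTree (fun m z c => stackState [] [] m z b c) (fun _ _ _ => rfl) (fun _ _ _ => rfl)
    (fun _ _ _ => rfl) (by simp) (by simp) (by simp) v x m a

theorem runLe_takeTree_aux' (x : BinTree) (v : Option Γ') (m a b : List Bool) :
    RunLe (takeTree .aux') v (stackState [] [] (x.code ++ m) a b []) (7 * x.size + 2) none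
      (stackState [] [] m a (x.code.reverse ++ b) []) :=
  runLe_takeTree (fun m z c => stackState [] [] m a z c) (fun _ _ _ => rfl) (fun _ _ _ => rfl)
    (fun _ _ _ => rfl) (by simp) (by simp) (by simp) v x m b

theorem runLe_drain_aux_main (v : Option Γ') (m a b : List Bool) :
    RunLe (drain .aux (pushRead .main)) v (stackState [] [] m a b []) (3 * a.length + 2) none
      (stackState [] [] (a.reverse ++ m) [] b []) := by
  have := runLe_drain (k := .aux) (p := pushRead .main) (fun z m => stackState [] [] m z b [])
    (fun b m => b :: m) 1 (fun _ _ => rfl) (by simp)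
    (fun c z m => ⟨_, by simpa using runLe_pushRead .main c (stackState [] [] m z b [])⟩) v a m
  rwa [foldl_cons_eq] at this

theorem runLe_drain_aux'_main (v : Option Γ') (m a b : List Bool) :
    RunLe (drain .aux' (pushRead .main)) v (stackState [] [] m a b []) (3 * b.length + 2) none
      (stackState [] [] (b.reverse ++ m) a [] []) := by
  have := runLe_drain (k := .aux') (p := pushRead .main) (fun z m => stackState [] [] m a z [])
    (fun b m => b :: m) 1 (fun _ _ => rfl) (by simp)
    (fun c z m => ⟨_, by simpa using runLe_pushRead .main c (stackState [] [] m a z [])⟩) v b m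
  rwa [foldl_cons_eq] at this

theorem runLe_drain_aux'_aux (v : Option Γ') (m a b : List Bool) :
    RunLe (drain .aux' (pushRead .aux)) v (stackState [] [] m a b []) (3 * b.length + 2) none
      (stackState [] [] m (b.reverse ++ a) [] []) := by
  have := runLe_drain (k := .aux') (p := pushRead .aux) (fun z a => stackState [] [] m a z [])
    (fun b m => b :: m) 1 (fun _ _ => rfl) (by simp)
    (fun c z a => ⟨_, by simpa using runLe_pushRead .aux c (stackState [] [] m a z [])⟩) v b a
  rwa [foldl_cons_eq] at this

/-- Remove the topmost tree. -/
def dropTop : TreeProg :=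
  .seq (takeTree .aux) (drain .aux skip)

theorem acts_dropTop (x : BinTree) (xs : List BinTree) :
    Acts dropTop (x :: xs) (10 * x.size + 4) xs := by
  intro v m
  have h1 := runLe_takeTree_aux x v (xs.flatMap code ++ m) [] []
  have h2 := runLe_drain (k := .aux) (p := skip)
    (fun z (_ : Unit) => stackState [] [] (xs.flatMap code ++ m) z [] [])
    (fun _ s => s) 1 (fun _ _ => rfl) (by simp) (fun c z s => ⟨_, runLe_skip _ _⟩) none
    (x.code.reverse ++ []) ()
  refine ⟨none, ?_⟩
  simpa [dropTop] using (h1.seq h2).mono (by simp; omega)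

/-- Duplicate the topmost tree. -/
def dupTop : TreeProg :=
  .seq (takeTree .aux) (.seq (drain .aux (.seq (pushRead .main) (pushRead .aux')))
    (.seq (drain .aux' (pushRead .aux)) (drain .aux (pushRead .main))))

theorem acts_dupTop (x : BinTree) (xs : List BinTree) :
    Acts dupTop (x :: xs) (17 * x.size + 8) (x :: x :: xs) := by
  intro v m
  have h1 := runLe_takeTree_aux x v (xs.flatMap code ++ m) [] []
  have h2 := runLe_drain (k := .aux) (p := .seq (pushRead .main) (pushRead .aux'))
    (fun z (s : List Bool × List Bool) => stackState [] [] s.1 z s.2 [])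
    (fun b s => (b :: s.1, b :: s.2)) 2 (fun _ _ => rfl) (by simp) (fun c z s => ⟨_, by
      simpa using (runLe_pushRead .main c (stackState [] [] s.1 z s.2 [])).seq
        (runLe_pushRead .aux' c _)⟩) none
    (x.code.reverse ++ []) (xs.flatMap code ++ m, [])
  have h3 : ∀ (z : List Bool) (s : List Bool × List Bool),
      z.foldl (fun s b => (b :: s.1, b :: s.2)) s = (z.reverse ++ s.1, z.reverse ++ s.2) := by
    intro z
    induction z with
    | nil => intro s; rfl
    | cons b z ih => intro s; simp [ih]
  rw [h3] at h2
  have h4 := runLe_drain_aux'_aux none (x.code ++ (xs.flatMap code ++ m)) [] x.code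
  have h5 := runLe_drain_aux_main none (x.code ++ (xs.flatMap code ++ m)) x.code.reverse []
  refine ⟨none, ?_⟩
  simp only [List.append_nil, List.reverse_reverse, List.length_reverse, code_length] at *
  simpa [dupTop] using (h1.seq (h2.seq (h4.seq h5))).mono (by omega)

/-- Exchange the two topmost trees. -/
def swapTop : TreeProg :=
  .seq (takeTree .aux) (.seq (takeTree .aux') (.seq (drain .aux (pushRead .main))
    (drain .aux' (pushRead .main))))

theorem acts_swapTop (x y : BinTree) (xs : List BinTree) :
    Acts swapTop (x :: y :: xs) (10 * (x.size + y.size) + 8) (y :: x :: xs) := by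
  intro v m
  have h1 := runLe_takeTree_aux x v (y.code ++ (xs.flatMap code ++ m)) [] []
  have h2 := runLe_takeTree_aux' y none (xs.flatMap code ++ m) x.code.reverse []
  have h3 := runLe_drain_aux_main none (xs.flatMap code ++ m) x.code.reverse y.code.reverse
  have h4 := runLe_drain_aux'_main none (x.code ++ (xs.flatMap code ++ m)) [] y.code.reverse
  refine ⟨none, ?_⟩
  simp only [List.append_nil, List.reverse_reverse, List.length_reverse, code_length] at *
  simpa [swapTop] using (h1.seq (h2.seq (h3.seq h4))).mono (by omega)

/-- Replace the topmost tree by the list of bits of its code. -/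
def flattenTop : TreeProg :=
  .seq (takeTree .aux) (.seq (pushBit .main false) (drain .aux
    (.seq (.ite isTrue (.seq (pushBit .main false) (.seq (pushBit .main false)
      (pushBit .main true))) (pushBit .main false)) (pushBit .main true))))

theorem acts_flattenTop (x : BinTree) (xs : List BinTree) :
    Acts flattenTop (x :: xs) (14 * x.size + 5) (ofList (x.code.map ofBool) :: xs) := by
  intro v m
  have h1 := runLe_takeTree_aux x v (xs.flatMap code ++ m) [] []
  have h2 := runLe_pushBit .main false none
    (stackState [] [] (xs.flatMap code ++ m) x.code.reverse [] [])
  have h3 := runLe_drain (k := .aux)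
    (p := .seq (.ite isTrue (.seq (pushBit .main false) (.seq (pushBit .main false)
      (pushBit .main true))) (pushBit .main false)) (pushBit .main true))
    (fun z m => stackState [] [] m z [] []) (fun b m => true :: ((ofBool b).code ++ m)) 5
    (fun _ _ => rfl) (by simp) (fun b z m => by
      refine ⟨some (Γ'.bit b), ?_⟩
      cases b with
      | true =>
        have e1 := runLe_pushBit .main false (some (Γ'.bit true)) (stackState [] [] m z [] [])
        have e2 := runLe_pushBit .main false (some (Γ'.bit true))
          (stackState [] [] (false :: m) z [] [])
        have e3 := runLe_pushBit .main true (some (Γ'.bit true))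
          (stackState [] [] (false :: false :: m) z [] [])
        have e4 := runLe_pushBit .main true (some (Γ'.bit true))
          (stackState [] [] (true :: false :: false :: m) z [] [])
        simp only [stackState_main, update_stackState_main] at e1 e2 e3 e4
        exact (RunLe.ite_true (by simp) (e1.seq (e2.seq e3))).seq e4
      | false =>
        have e1 := runLe_pushBit .main false (some (Γ'.bit false)) (stackState [] [] m z [] [])
        have e2 := runLe_pushBit .main true (some (Γ'.bit false))
          (stackState [] [] (false :: m) z [] [])
        simp only [stackState_main, update_stackState_main] at e1 e2
        exact ((RunLe.ite_false (by simp) e1).seq e2).mono (by omega)) none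
    x.code.reverse (false :: (xs.flatMap code ++ m))
  have h4 : ∀ (w s : List Bool), w.reverse.foldl (fun m b => true :: ((ofBool b).code ++ m))
      (false :: s) = (ofList (w.map ofBool)).code ++ s := by
    intro w s
    induction w with
    | nil => simp [ofList, code]
    | cons b w ih => simp [ofList, code, ih]
  rw [h4] at h3
  simp only [stackState_main, update_stackState_main, List.append_nil, List.length_reverse,
    code_length] at h1 h2 h3
  refine ⟨none, ?_⟩
  simpa [flattenTop] using (h1.seq (h2.seq h3)).mono (by omega)

/-- Pop a symbol of the main stack that is the root of a tree. -/
theorem runLe_popMain (b : Bool) (v : Option Γ') (m : List Bool) :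
    RunLe (popRead .main) v (mainState (b :: m)) 1 (some (Γ'.bit b)) (mainState m) := by
  simpa using runLe_popRead .main v (mainState (b :: m))

/-- Branch on the root of the topmost tree. -/
def caseTop (p q : TreeProg) : TreeProg :=
  .seq (popRead .main) (.ite isTrue p q)

theorem acts_caseTop_node {p q : TreeProg} {x y : BinTree} {xs ys : List BinTree} {T : ℕ}
    (h : Acts p (x :: y :: xs) T ys) : Acts (caseTop p q) (node x y :: xs) (T + 2) ys := by
  intro v m
  obtain ⟨v', h'⟩ := h (some (Γ'.bit true)) m
  refine ⟨v', ?_⟩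
  have h1 := runLe_popMain true v ((x :: y :: xs).flatMap code ++ m)
  simpa [code, caseTop] using (h1.seq (RunLe.ite_true (by simp) h')).mono (by omega)

theorem acts_caseTop_leaf {p q : TreeProg} {xs ys : List BinTree} {T : ℕ}
    (h : Acts q xs T ys) : Acts (caseTop p q) (leaf :: xs) (T + 2) ys := by
  intro v m
  obtain ⟨v', h'⟩ := h (some (Γ'.bit false)) m
  refine ⟨v', ?_⟩
  have h1 := runLe_popMain false v (xs.flatMap code ++ m)
  simpa [code, caseTop] using (h1.seq (RunLe.ite_false (by simp) h')).mono (by omega)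

/-- Run `p` once for every member of the list on top, which is consumed. -/
def forTop (p : TreeProg) : TreeProg :=
  .seq (popRead .main) (.loop isTrue (.seq (.seq dropTop (.seq swapTop (.seq p swapTop)))
    (popRead .main)))

/-- The list serves as a counter and lies above the value between rounds. The behaviour of `p` is
required only along the sequence `y`, so a time bound is needed only for values that actually arise.
-/
theorem acts_forTop {p : TreeProg} {T M : ℕ} (y : ℕ → BinTree)
    (l : List BinTree) (hM : ∀ k ≤ l.length, (y k).size ≤ M) (hl : (ofList l).size ≤ M)
    (hp : ∀ k < l.length, Acts p [y k] T [y (k + 1)]) (xs : List BinTree) :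
    Acts (forTop p) (ofList l :: y 0 :: xs) (l.length * (50 * M + T + 30) + 2)
      (y l.length :: xs) := by
  induction l generalizing y with
  | nil =>
    intro v m
    refine ⟨some (Γ'.bit false), ?_⟩
    have h1 := runLe_popMain false v ((y 0 :: xs).flatMap code ++ m)
    simpa [code, ofList, forTop] using h1.seq (RunLe.loop_false (by simp))
  | cons a l ih =>
    have hsz : a.size + (ofList l).size + 1 ≤ M := hl
    have hx := hM 0 (by simp)
    have hfx := hM 1 (by simp)
    have h1 := (acts_dropTop a (ofList l :: y 0 :: xs)).seq ((acts_swapTop (ofList l) (y 0) xs).seq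
      (((hp 0 (by simp)).frame (ofList l :: xs)).seq (acts_swapTop (y 1) (ofList l) xs)))
    have h2 := ih (fun k => y (k + 1)) (fun k hk => hM (k + 1) (by simpa using hk)) (by omega)
      (fun k hk => hp (k + 1) (by simpa using hk))
    intro v m
    obtain ⟨v1, h1⟩ := h1 (some (Γ'.bit true)) m
    obtain ⟨v2, t, ht, h2⟩ := h2 v1 m
    refine ⟨v2, ?_⟩
    cases h2 with
    | @seq _ _ _ v3 _ _ S3 _ t1 t2 h3 h4 =>
      have h5 := runLe_popMain true v ((a :: ofList l :: y 0 :: xs).flatMap code ++ m)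
      have h6 := h5.seq (RunLe.loop_true (by simp) (h1.seq ⟨t1, le_rfl, h3⟩) ⟨t2, le_rfl, h4⟩)
      simp only [ofList, List.flatMap_cons, code, List.cons_append, List.append_assoc,
        List.length_cons] at h6 ⊢
      refine h6.mono ?_
      rw [Nat.add_mul]
      omega

/-- Push a fixed tree. -/
def pushTree : BinTree → TreeProg
  | leaf => pushBit .main false
  | node x y => .seq (pushTree y) (.seq (pushTree x) (pushBit .main true))

theorem acts_pushTree (x : BinTree) (xs : List BinTree) :
    Acts (pushTree x) xs x.size (x :: xs) := by
  induction x generalizing xs with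
  | leaf => exact acts_leaf xs
  | node x y hx hy =>
    exact ((hy xs).seq ((hx (y :: xs)).seq (acts_node x y xs))).mono (by simp only [size]; omega)

/-! ### Functions computable in bounded time -/

/-- Types whose elements are coded by trees. -/
class TreeEnc (α : Type) where
  enc : α → BinTree
  enc_injective : Function.Injective enc

open TreeEnc

instance : TreeEnc BinTree := ⟨id, Function.injective_id⟩

instance : TreeEnc Bool := ⟨ofBool, ofBool_injective⟩

instance {α β : Type} [TreeEnc α] [TreeEnc β] : TreeEnc (α × β) :=
  ⟨fun p => node (enc p.1) (enc p.2), fun p q h => by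
    simp only [node.injEq] at h
    exact Prod.ext (enc_injective h.1) (enc_injective h.2)⟩

instance {α : Type} [TreeEnc α] : TreeEnc (List α) :=
  ⟨fun l => ofList (l.map enc), fun _ _ h =>
    List.map_injective_iff.2 enc_injective (ofList_injective h)⟩

/-- The size of the code of an element. -/
def sz {α : Type} [TreeEnc α] (a : α) : ℕ :=
  (enc a).size

section

variable {α β γ δ : Type} [TreeEnc α] [TreeEnc β] [TreeEnc γ] [TreeEnc δ]

theorem enc_nil : enc ([] : List α) = leaf := rfl

theorem enc_cons (a : α) (l : List α) : enc (a :: l) = node (enc a) (enc l) := rfl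

theorem sz_tree (x : BinTree) : sz x = x.size := rfl

theorem sz_trees (l : List BinTree) : sz l = (ofList l).size := by
  change (ofList (l.map id)).size = _
  simp

theorem sz_pair (p : α × β) : sz p = sz p.1 + sz p.2 + 1 := rfl

theorem sz_nil : sz ([] : List α) = 1 := rfl

theorem sz_cons (a : α) (l : List α) : sz (a :: l) = sz a + sz l + 1 := rfl

theorem sz_pos (a : α) : 0 < sz a := size_pos _

theorem sz_append (l l' : List α) : sz (l ++ l') + 1 = sz l + sz l' := by
  induction l with
  | nil => simp [sz_nil]; omega
  | cons a l ih => simp only [List.cons_append, sz_cons]; omega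

theorem length_lt_sz (l : List α) : l.length < sz l := by
  simpa [sz, enc] using length_lt_size_ofList (l.map enc)

theorem sz_lt_of_mem {a : α} {l : List α} (h : a ∈ l) : sz a < sz l := by
  induction l with
  | nil => simp at h
  | cons b l ih =>
    rw [sz_cons]
    rcases List.mem_cons.1 h with rfl | h
    · omega
    · have := ih h; omega

theorem sz_drop_le (l : List α) (k : ℕ) : sz (l.drop k) ≤ sz l := by
  induction k generalizing l with
  | zero => simp
  | succ k ih =>
    cases l with
    | nil => simp
    | cons a l =>
      have := ih l
      simp only [List.drop_succ_cons, sz_cons]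
      omega

/-- The function `f` is computable within `T n` steps on arguments of size `n`, and the size of its
values is bounded in the same way. -/
structure Computes (f : α → β) (T : ℕ → ℕ) : Prop where
  sz_le : ∀ a, sz (f a) ≤ T (sz a)
  prog : ∃ p, ∀ a, Acts p [enc a] (T (sz a)) [enc (f a)]

theorem Computes.mono {f : α → β} {T T' : ℕ → ℕ} (h : Computes f T) (hT : ∀ n, T n ≤ T' n) :
    Computes f T' := by
  obtain ⟨h1, p, hp⟩ := h
  exact ⟨fun a => (h1 a).trans (hT _), p, fun a => (hp a).mono (hT _)⟩

/-- The size bound in `Computes` is needed here: the running time of `g` depends on the size of `f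
a`. -/
theorem Computes.comp {g : β → γ} {f : α → β} {T T' : ℕ → ℕ} (hg : Computes g T')
    (hf : Computes f T) (hT : Monotone T') :
    Computes (fun a => g (f a)) fun n => T n + T' (T n) := by
  obtain ⟨f1, p, hp⟩ := hf
  obtain ⟨g1, q, hq⟩ := hg
  refine ⟨fun a => ?_, .seq p q, fun a => ((hp a).seq ((hq (f a)).mono (hT (f1 a))))⟩
  exact ((g1 (f a)).trans (hT (f1 a))).trans (Nat.le_add_left _ _)

theorem Computes.pair {f : α → β} {g : α → γ} {T T' : ℕ → ℕ} (hf : Computes f T)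
    (hg : Computes g T') :
    Computes (fun a => (f a, g a)) fun n => 27 * n + T n + 11 * T' n + 17 := by
  obtain ⟨f1, p, hp⟩ := hf
  obtain ⟨g1, q, hq⟩ := hg
  refine ⟨fun a => ?_, .seq dupTop (.seq q (.seq swapTop (.seq p (pushBit .main true)))),
    fun a => ?_⟩
  · have := f1 a
    have := g1 a
    rw [sz_pair]
    dsimp only
    omega
  · refine ((acts_dupTop (enc a) []).seq (((hq a).frame [enc a]).seq
      ((acts_swapTop (enc (g a)) (enc a) []).seq (((hp a).frame [enc (g a)]).seq
        (acts_node _ _ []))))).mono ?_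
    have : (enc (g a)).size ≤ _ := g1 a
    simp only [sz] at *
    omega

/-- Iterate `f` once for every member of `l a`. -/
theorem Computes.iterate {f : α → α} {l : α → List β} {T T' M : ℕ → ℕ} (hf : Computes f T)
    (hT : Monotone T) (hl : Computes l T')
    (hM : ∀ a, ∀ k ≤ (l a).length, sz (f^[k] a) ≤ M (sz a)) :
    Computes (fun a => f^[(l a).length] a) fun n =>
      17 * n + 10 + T' n + T' n * (50 * (M n + T' n) + T (M n) + 30) + M n := by
  obtain ⟨f1, p, hp⟩ := hf
  obtain ⟨l1, q, hq⟩ := hl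
  refine ⟨fun a => (hM a _ le_rfl).trans (Nat.le_add_left _ _), .seq dupTop (.seq q (forTop p)),
    fun a => ?_⟩
  have h1 := acts_forTop (p := p) (T := T (M (sz a))) (M := M (sz a) + T' (sz a))
    (fun k => enc (f^[k] a)) ((l a).map enc)
    (fun k hk => (hM a k (by simpa using hk)).trans (Nat.le_add_right _ _))
    ((l1 a).trans (Nat.le_add_left _ _))
    (fun k hk => by
      rw [Function.iterate_succ_apply']
      exact (hp _).mono (hT (hM a k (by simpa using hk.le)))) []
  have h2 := (acts_dupTop (enc a) []).seq (((hq a).frame [enc a]).seq h1)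
  rw [List.length_map] at h2
  refine h2.mono ?_
  have h3 := (length_lt_sz (l a)).le.trans (l1 a)
  have h4 := Nat.mul_le_mul_right (50 * (M (sz a) + T' (sz a)) + T (M (sz a)) + 30) h3
  simp only [sz] at *
  omega

/-! ### Polynomial bounds -/

/-- The function is bounded by a power of its argument. -/
def PolyBound (T : ℕ → ℕ) : Prop :=
  ∃ d, ∀ n, T n ≤ (n + 2) ^ d

theorem PolyBound.of_le {T T' : ℕ → ℕ} (h : PolyBound T') (hT : ∀ n, T n ≤ T' n) : PolyBound T :=
  let ⟨d, hd⟩ := h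
  ⟨d, fun n => (hT n).trans (hd n)⟩

theorem PolyBound.id : PolyBound fun n => n :=
  ⟨1, fun n => by simp⟩

theorem PolyBound.const (c : ℕ) : PolyBound fun _ => c :=
  ⟨c, fun n => (Nat.lt_two_pow_self).le.trans (Nat.pow_le_pow_left (by omega) c)⟩

theorem PolyBound.add {T T' : ℕ → ℕ} (h : PolyBound T) (h' : PolyBound T') :
    PolyBound fun n => T n + T' n := by
  obtain ⟨d, hd⟩ := h
  obtain ⟨e, he⟩ := h'
  refine ⟨d + e + 1, fun n => ?_⟩
  have h1 : (n + 2) ^ d ≤ (n + 2) ^ (d + e) := Nat.pow_le_pow_right (by omega) (by omega)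
  have h2 : (n + 2) ^ e ≤ (n + 2) ^ (d + e) := Nat.pow_le_pow_right (by omega) (by omega)
  have h3 : (n + 2) ^ (d + e + 1) = (n + 2) ^ (d + e) * n + 2 * (n + 2) ^ (d + e) := by ring
  have := hd n
  have := he n
  dsimp only
  rw [h3]
  have := Nat.zero_le ((n + 2) ^ (d + e) * n)
  omega

theorem PolyBound.mul {T T' : ℕ → ℕ} (h : PolyBound T) (h' : PolyBound T') :
    PolyBound fun n => T n * T' n := by
  obtain ⟨d, hd⟩ := h
  obtain ⟨e, he⟩ := h'
  exact ⟨d + e, fun n => by rw [pow_add]; exact Nat.mul_le_mul (hd n) (he n)⟩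

theorem PolyBound.pow {T : ℕ → ℕ} (h : PolyBound T) (e : ℕ) : PolyBound fun n => T n ^ e := by
  obtain ⟨d, hd⟩ := h
  exact ⟨d * e, fun n => by rw [pow_mul]; exact Nat.pow_le_pow_left (hd n) e⟩

theorem PolyBound.comp {T T' : ℕ → ℕ} (h : PolyBound T) (h' : PolyBound T') :
    PolyBound fun n => T (T' n) := by
  obtain ⟨d, hd⟩ := h
  exact ((h'.add (.const 2)).pow d).of_le fun n => hd _

theorem monotone_pow (d : ℕ) : Monotone fun n => (n + 2) ^ d := fun _ _ h =>
  Nat.pow_le_pow_left (by omega) d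

/-- The function `f` is computable in polynomial time. -/
def PolyTime (f : α → β) : Prop :=
  ∃ d, Computes f fun n => (n + 2) ^ d

theorem Computes.polyTime {f : α → β} {T : ℕ → ℕ} (h : Computes f T) (hT : PolyBound T) :
    PolyTime f :=
  let ⟨d, hd⟩ := hT
  ⟨d, h.mono hd⟩

namespace PolyTime

theorem sz_le {f : α → β} (h : PolyTime f) : ∃ d, ∀ a, sz (f a) ≤ (sz a + 2) ^ d :=
  let ⟨d, hd⟩ := h
  ⟨d, hd.sz_le⟩

theorem congr {f g : α → β} (h : PolyTime f) (hfg : ∀ a, f a = g a) : PolyTime g :=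
  funext hfg ▸ h

theorem poly_pow (d : ℕ) : PolyBound fun n => (n + 2) ^ d :=
  ⟨d, fun _ => le_rfl⟩

/-- Functions that do not change the code. -/
theorem of_enc_eq {f : α → β} (h : ∀ a, enc (f a) = enc a) : PolyTime f := by
  refine Computes.polyTime (T := fun n => n + 1) ⟨fun a => ?_, skip, fun a => ?_⟩
    (PolyBound.id.add (.const 1))
  · simp [sz, h a]
  · rw [h a]
    exact (Acts.skip _).mono (by omega)

theorem id : PolyTime fun a : α => a :=
  of_enc_eq fun _ => rfl

theorem comp {g : β → γ} {f : α → β} (hg : PolyTime g) (hf : PolyTime f) :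
    PolyTime fun a => g (f a) := by
  obtain ⟨e, he⟩ := hg
  obtain ⟨d, hd⟩ := hf
  exact (he.comp hd (monotone_pow e)).polyTime ((poly_pow d).add ((poly_pow e).comp (poly_pow d)))

theorem pair {f : α → β} {g : α → γ} (hf : PolyTime f) (hg : PolyTime g) :
    PolyTime fun a => (f a, g a) := by
  obtain ⟨d, hd⟩ := hf
  obtain ⟨e, he⟩ := hg
  exact (hd.pair he).polyTime (((((PolyBound.const 27).mul .id).add (poly_pow d)).add
    ((PolyBound.const 11).mul (poly_pow e))).add (.const 17))

theorem const (b : β) : PolyTime fun _ : α => b := by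
  refine Computes.polyTime (T := fun n => 10 * n + 4 + sz b) ⟨fun a => Nat.le_add_left _ _,
    .seq dropTop (pushTree (enc b)), fun a => ?_⟩
    ((((PolyBound.const 10).mul .id).add (.const 4)).add (.const _))
  exact (acts_dropTop (enc a) []).seq (acts_pushTree _ _)

theorem fst_ : PolyTime fun p : α × β => p.1 := by
  refine Computes.polyTime (T := fun n => 20 * n + 14) ⟨fun p => ?_,
    caseTop (.seq swapTop dropTop) skip, fun p => ?_⟩
    (((PolyBound.const 20).mul .id).add (.const _))
  · rw [sz_pair]; omega
  · refine (acts_caseTop_node ((acts_swapTop (enc p.1) (enc p.2) []).seq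
      (acts_dropTop (enc p.2) [enc p.1]))).mono ?_
    rw [sz_pair]
    simp only [sz]
    omega

theorem snd_ : PolyTime fun p : α × β => p.2 := by
  refine Computes.polyTime (T := fun n => 10 * n + 6) ⟨fun p => ?_,
    caseTop dropTop skip, fun p => ?_⟩ (((PolyBound.const 10).mul .id).add (.const _))
  · rw [sz_pair]; omega
  · refine (acts_caseTop_node (acts_dropTop (enc p.1) [enc p.2])).mono ?_
    rw [sz_pair]
    simp only [sz]
    omega

theorem fst {f : α → β × γ} (hf : PolyTime f) : PolyTime fun a => (f a).1 :=
  fst_.comp hf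

theorem snd {f : α → β × γ} (hf : PolyTime f) : PolyTime fun a => (f a).2 :=
  snd_.comp hf

theorem cons {f : α → β} {g : α → List β} (hf : PolyTime f) (hg : PolyTime g) :
    PolyTime fun a => f a :: g a :=
  (of_enc_eq (f := fun p : β × List β => p.1 :: p.2) fun _ => rfl).comp (hf.pair hg)

theorem toList {f : α → BinTree} (hf : PolyTime f) : PolyTime fun a => (f a).toList :=
  (of_enc_eq (f := BinTree.toList) fun x => by
    change ofList (x.toList.map _root_.id) = x; simp).comp hf

theorem ofList {f : α → List BinTree} (hf : PolyTime f) : PolyTime fun a => BinTree.ofList (f a) :=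
  (of_enc_eq (f := BinTree.ofList) fun x => by
    change BinTree.ofList x = BinTree.ofList (x.map _root_.id); simp).comp hf

theorem node {f g : α → BinTree} (hf : PolyTime f) (hg : PolyTime g) :
    PolyTime fun a => BinTree.node (f a) (g a) :=
  (of_enc_eq (f := fun p : BinTree × BinTree => BinTree.node p.1 p.2) fun _ => rfl).comp
    (hf.pair hg)

/-- Case distinction on a list. -/
theorem listCases {l : α → List β} {f : α → γ} {g : α → β → List β → γ} (hl : PolyTime l)
    (hf : PolyTime f) (hg : PolyTime fun p : α × β × List β => g p.1 p.2.1 p.2.2) :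
    PolyTime fun a => match l a with
      | [] => f a
      | b :: t => g a b t := by
  obtain ⟨c, l1, p, hp⟩ := hl
  obtain ⟨d, f1, q, hq⟩ := hf
  obtain ⟨e, g1, r, hr⟩ := hg
  refine Computes.polyTime (T := fun n => 27 * n + 11 * (n + 2) ^ c + (n + 2) ^ d + 30 +
    (n + (n + 2) ^ c + 1 + 2) ^ e) ⟨fun a => ?_, .seq dupTop (.seq p (caseTop
      (.seq (pushBit .main true) (.seq swapTop (.seq (pushBit .main true) r))) q)), fun a => ?_⟩ ?_
  · split
    next h => exact (f1 a).trans (by omega)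
    next b t h =>
      refine (g1 (a, b, t)).trans (le_trans (Nat.pow_le_pow_left ?_ e) (Nat.le_add_left _ _))
      have := l1 a
      rw [h] at this
      rw [sz_pair]
      exact Nat.add_le_add_right (Nat.add_le_add_right (Nat.add_le_add_left this _) _) _
  · have h1 := (acts_dupTop (enc a) []).seq ((hp a).frame [enc a])
    have h3 := l1 a
    have hs : ∀ {T ys}, Acts (caseTop
      (.seq (pushBit .main true) (.seq swapTop (.seq (pushBit .main true) r))) q)
      [enc (l a), enc a] T ys → Acts (.seq dupTop (.seq p (caseTop
      (.seq (pushBit .main true) (.seq swapTop (.seq (pushBit .main true) r))) q)))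
      [enc a] (17 * sz a + 8 + ((sz a + 2) ^ c + T)) ys := fun h =>
        (acts_dupTop (enc a) []).seq (((hp a).frame [enc a]).seq h)
    split
    next h =>
      rw [h, enc_nil] at hs
      exact (hs (acts_caseTop_leaf (hq a))).mono (by omega)
    next b t h =>
      rw [h, enc_cons] at hs
      refine (hs (acts_caseTop_node ((acts_node _ _ _).seq ((acts_swapTop _ _ _).seq
        ((acts_node _ _ _).seq (hr (a, b, t))))))).mono ?_
      rw [h] at h3
      have h5 : sz (a, b, t) ≤ sz a + (sz a + 2) ^ c + 1 := by
        rw [sz_pair]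
        exact Nat.add_le_add_right (Nat.add_le_add_left h3 _) _
      have h4 := Nat.pow_le_pow_left (Nat.add_le_add_right h5 2) e
      have h6 : (BinTree.node (enc b) (enc t)).size = sz (b :: t) := rfl
      have h7 : (enc a).size = sz a := rfl
      rw [h6, h7]
      omega
  · exact (((((PolyBound.const 27).mul .id).add ((PolyBound.const 11).mul (poly_pow c))).add
      (poly_pow d)).add (.const 30)).add
      ((((PolyBound.id.add (poly_pow c)).add (.const 1)).add (.const 2)).pow e)

end PolyTime

end

/-! ### Closure properties of polynomial time -/

namespace PolyTime

theorem sz_foldl_le {β γ : Type} [TreeEnc γ] {F : γ → β → γ} {m : ℕ} (l : List β) (c : γ)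
    (h : ∀ c, ∀ b ∈ l, sz (F c b) ≤ sz c + m) : sz (l.foldl F c) ≤ sz c + l.length * m := by
  induction l generalizing c with
  | nil => simp
  | cons b l ih =>
    have h1 := ih (F c b) fun c b hb => h c b (List.mem_cons_of_mem _ hb)
    have h2 := h c b List.mem_cons_self
    simp only [List.foldl_cons, List.length_cons, add_mul, one_mul]
    omega

variable {α β γ : Type} [TreeEnc α] [TreeEnc β] [TreeEnc γ]

/-- Case distinction on a truth value. -/
theorem ite {c : α → Prop} [∀ a, Decidable (c a)] {f g : α → β}
    (hc : PolyTime fun a => decide (c a)) (hf : PolyTime f) (hg : PolyTime g) :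
    PolyTime fun a => if c a then f a else g a := by
  -- `false` and `true` have the same codes as `[]` and `[false]`, so branching on a truth value is
  -- a case distinction on a list.
  have h : PolyTime fun a => if c a then [false] else [] :=
    ((of_enc_eq (f := fun b : Bool => if b then [false] else []) fun b => by
      cases b <;> rfl).comp hc).congr fun a => by simp
  refine (h.listCases (g := fun a _ _ => f a) hg (hf.comp fst_)).congr fun a => ?_
  by_cases hca : c a <;> simp [hca]

theorem not {c : α → Bool} (hc : PolyTime c) : PolyTime fun a => !c a :=
  (ite (c := fun a => c a = true) (by simpa using hc) (const false) (const true)).congr fun a => by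
    cases c a <;> rfl

theorem and {c d : α → Bool} (hc : PolyTime c) (hd : PolyTime d) : PolyTime fun a => c a && d a :=
  (ite (c := fun a => c a = true) (by simpa using hc) hd (const false)).congr fun a => by
    cases c a <;> rfl

theorem tail {l : α → List β} (hl : PolyTime l) : PolyTime fun a => (l a).tail :=
  (hl.listCases (f := fun _ => []) (g := fun _ _ t => t) (const _) snd_.snd).congr fun a => by
    cases l a <;> rfl

theorem headD {l : α → List β} (hl : PolyTime l) (b : β) : PolyTime fun a => (l a).headD b :=
  (hl.listCases (f := fun _ => b) (g := fun _ x _ => x) (const _) snd_.fst).congr fun a => by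
    cases l a <;> rfl

theorem isEmpty {l : α → List β} (hl : PolyTime l) : PolyTime fun a => (l a).isEmpty :=
  (hl.listCases (f := fun _ => true) (g := fun _ _ _ => false) (const _) (const _)).congr
    fun a => by cases l a <;> rfl

/-- Bounded recursion along a list. -/
theorem foldl {l : α → List β} {i : α → γ} {F : α → γ → β → γ} (hl : PolyTime l) (hi : PolyTime i)
    (hF : PolyTime fun p : α × γ × β => F p.1 p.2.1 p.2.2)
    (hgrow : ∃ e, ∀ a c b, sz (F a c b) ≤ sz c + (sz a + sz b + 2) ^ e) :
    PolyTime fun a => (l a).foldl (F a) (i a) := by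
  obtain ⟨e, he⟩ := hgrow
  -- One round of the fold, as a map on the parameter, the remaining list and the accumulator.
  let step : α × List β × γ → α × List β × γ := fun s => match s.2.1 with
    | [] => s
    | b :: t => (s.1, t, F s.1 s.2.2 b)
  have hstep : PolyTime step :=
    listCases (l := fun s : α × List β × γ => s.2.1) (f := fun s => s)
      (g := fun s b t => (s.1, t, F s.1 s.2.2 b)) snd_.fst PolyTime.id
      (fst_.fst.pair (snd_.snd.pair (hF.comp (fst_.fst.pair (fst_.snd.snd.pair snd_.fst)))))
  have hiter : ∀ (k : ℕ) (a : α) (l : List β) (c : γ), step^[k] (a, l, c) =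
      (a, l.drop k, (l.take k).foldl (F a) c) := by
    intro k
    induction k with
    | zero => intro a l c; simp
    | succ k ih =>
      intro a l c
      rw [Function.iterate_succ_apply]
      cases l with
      | nil => exact (ih a [] c).trans (by simp)
      | cons b l => exact (ih a l (F a c b)).trans (by simp)
  obtain ⟨d, hd⟩ := hstep
  obtain ⟨d', hd'⟩ := snd_.fst (β := List β) (f := fun s : α × List β × γ => s.2) |> fun h => h
  -- Growth is additive in the accumulator, so sizes stay polynomial over all rounds; a bounded
  -- factor per round would already allow exponential growth.
  have hM : ∀ s : α × List β × γ, ∀ k ≤ s.2.1.length,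
      sz (step^[k] s) ≤ sz s + sz s * (sz s + 2) ^ e := by
    rintro ⟨a, l, c⟩ k hk
    rw [hiter]
    simp only [sz_pair] at *
    have h1 := sz_drop_le l k
    have h2 := sz_foldl_le (F := F a) (m := (sz a + (sz l + sz c + 1) + 1 + 2) ^ e) (l.take k) c
      fun c' b hb => (he a c' b).trans (Nat.add_le_add_left (Nat.pow_le_pow_left (by
        have := sz_lt_of_mem (List.mem_of_mem_take hb)
        omega) e) _)
    have h3 : (l.take k).length ≤ sz a + (sz l + sz c + 1) + 1 := by
      have := length_lt_sz l
      rw [List.length_take]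
      omega
    have h4 := Nat.mul_le_mul_right ((sz a + (sz l + sz c + 1) + 1 + 2) ^ e) h3
    omega
  have h := ((hd.iterate (M := fun n => n + n * (n + 2) ^ e) (monotone_pow d) hd'
    hM).polyTime ?_).snd.snd.comp
    (PolyTime.id.pair (hl.pair hi))
  · exact h.congr fun a => by rw [hiter]; simp
  · have hMb : PolyBound fun n => n + n * (n + 2) ^ e := PolyBound.id.add (.mul .id (poly_pow e))
    exact ((((PolyBound.const 17).mul .id).add (.const 10)).add (poly_pow d')).add
      ((poly_pow d').mul ((((PolyBound.const 50).mul (hMb.add (poly_pow d'))).add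
        ((poly_pow d).comp hMb)).add (.const 30))) |>.add hMb

theorem reverseAppend {l l' : α → List β} (hl : PolyTime l) (hl' : PolyTime l') :
    PolyTime fun a => (l a).reverse ++ l' a :=
  (hl.foldl (F := fun _ c b => b :: c) hl' (snd_.snd.cons snd_.fst)
    ⟨1, fun a c b => by rw [sz_cons, pow_one]; omega⟩).congr fun a => by simp

theorem reverse {l : α → List β} (hl : PolyTime l) : PolyTime fun a => (l a).reverse :=
  (hl.reverseAppend (const [])).congr fun a => by simp

theorem append {l l' : α → List β} (hl : PolyTime l) (hl' : PolyTime l') :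
    PolyTime fun a => l a ++ l' a :=
  (hl.reverse.reverseAppend hl').congr fun a => by simp

theorem flatMap {l : α → List β} {F : α → β → List γ} (hl : PolyTime l)
    (hF : PolyTime fun p : α × β => F p.1 p.2) : PolyTime fun a => (l a).flatMap (F a) := by
  obtain ⟨d, hd⟩ := hF.sz_le
  refine (hl.reverse.foldl (F := fun a c b => F a b ++ c) (const [])
    ((hF.comp (fst_.pair snd_.snd)).append snd_.fst) ⟨2 * d, fun a c b => ?_⟩).congr fun a => ?_
  · have h1 := hd (a, b)
    have h2 := sz_append (F a b) c
    rw [sz_pair] at h1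
    have h3 : (sz a + sz b + 1 + 2) ^ d ≤ ((sz a + sz b + 2) ^ 2) ^ d :=
      Nat.pow_le_pow_left (by nlinarith [sz_pos a, sz_pos b]) d
    rw [← pow_mul] at h3
    dsimp only at h1 h2
    omega
  · rw [List.foldl_reverse]
    induction l a with
    | nil => rfl
    | cons b l ih => rw [List.foldr_cons, ih, List.flatMap_cons]

theorem map {l : α → List β} {F : α → β → γ} (hl : PolyTime l)
    (hF : PolyTime fun p : α × β => F p.1 p.2) : PolyTime fun a => (l a).map (F a) :=
  (hl.flatMap (F := fun a b => [F a b]) (hF.cons (const []))).congr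
    fun _ => List.map_eq_flatMap.symm

theorem filter {l : α → List β} {c : α → β → Bool} (hl : PolyTime l)
    (hc : PolyTime fun p : α × β => c p.1 p.2) : PolyTime fun a => (l a).filter (c a) :=
  (hl.flatMap (F := fun a b => if c a b then [b] else [])
    (ite (by simpa using hc) (snd_.cons (const [])) (const []))).congr fun a => by
    induction l a with
    | nil => rfl
    | cons b l ih => rw [List.flatMap_cons, ih, List.filter_cons]; split <;> simp

theorem any {l : α → List β} {c : α → β → Bool} (hl : PolyTime l)
    (hc : PolyTime fun p : α × β => c p.1 p.2) : PolyTime fun a => (l a).any (c a) :=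
  (hl.filter hc).isEmpty.not.congr fun a => by
    rw [Bool.eq_iff_iff]; simp

theorem all {l : α → List β} {c : α → β → Bool} (hl : PolyTime l)
    (hc : PolyTime fun p : α × β => c p.1 p.2) : PolyTime fun a => (l a).all (c a) :=
  (hl.any (c := fun a b => !c a b) hc.not).not.congr fun a => by
    rw [Bool.eq_iff_iff]; simp

/-- The list of symbols of the code of an element. -/
theorem code {f : α → BinTree} (hf : PolyTime f) : PolyTime fun a => (f a).code := by
  refine PolyTime.comp (g := BinTree.code) ?_ hf
  refine Computes.polyTime (T := fun n => 14 * n + 5 + (n * 4 + 1)) ⟨fun x => ?_, flattenTop,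
    fun x => ?_⟩ ((((PolyBound.const 14).mul .id).add (.const 5)).add
      ((PolyBound.id.mul (.const 4)).add (.const 1)))
  · have := size_ofList_le (s := 3) (l := x.code.map ofBool) fun y hy => by
      obtain ⟨b, -, rfl⟩ := List.mem_map.1 hy
      cases b <;> decide
    rw [List.length_map, code_length] at this
    exact this.trans (Nat.le_add_left _ _)
  · exact (acts_flattenTop x []).mono (Nat.le_add_right _ _)

theorem beqBool {c d : α → Bool} (hc : PolyTime c) (hd : PolyTime d) :
    PolyTime fun a => c a == d a :=
  (ite (c := fun a => c a = true) (by simpa using hc) hd hd.not).congr fun a => by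
    cases c a <;> cases d a <;> rfl

theorem sz_bool_le (b : Bool) : sz b ≤ 3 := by
  cases b <;> decide

/-- The fold over one list consumes the other. The flag fails on a mismatch or if the second list
ends early, and nothing of it may be left at the end. -/
theorem beqListBool {l l' : α → List Bool} (hl : PolyTime l) (hl' : PolyTime l') :
    PolyTime fun a => decide (l a = l' a) := by
  let F : Bool × List Bool → Bool → Bool × List Bool := fun s b =>
    (!s.2.isEmpty && (s.1 && (b == s.2.headD false)), s.2.tail)
  have h := hl.foldl (F := fun _ => F) ((const true).pair hl')
    (((snd_.fst.snd.isEmpty.not).and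
      (snd_.fst.fst.and (snd_.snd.beqBool (snd_.fst.snd.headD false)))).pair
      snd_.fst.snd.tail) ⟨1, fun a c b => by
        have h1 := sz_bool_le (F c b).1
        have h2 : sz (F c b).2 ≤ sz c.2 := by
          have := sz_drop_le c.2 1
          rwa [List.drop_one] at this
        have := sz_pos c.1
        have := sz_pos b
        have := sz_pos a
        rw [sz_pair, sz_pair, pow_one]
        omega⟩
  refine (h.fst.and h.snd.isEmpty).congr fun a => ?_
  suffices ∀ (l l' : List Bool) (c : Bool),
      ((l.foldl F (c, l')).1 && (l.foldl F (c, l')).2.isEmpty) =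
      (c && decide (l = l')) by simpa using this (l a) (l' a) true
  intro l
  induction l with
  | nil => intro l' c; cases l' <;> simp
  | cons b l ih =>
    intro l' c
    rw [List.foldl_cons]
    cases l' with
    | nil => exact (ih [] _).trans (by simp)
    | cons b' l' =>
      refine (ih l' _).trans ?_
      cases b' <;> cases b <;> cases c <;> simp

/-- Equality is decidable in polynomial time. -/
theorem eq {f g : α → β} [DecidableEq β] (hf : PolyTime f) (hg : PolyTime g) :
    PolyTime fun a => decide (f a = g a) :=
  have h : PolyTime (enc : β → BinTree) := of_enc_eq fun _ => rfl
  ((h.comp hf).code.beqListBool (h.comp hg).code).congr fun a => by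
    rw [decide_eq_decide]
    exact ⟨fun h => enc_injective (code_injective h), fun h => by rw [h]⟩

theorem mem {f : α → β} {l : α → List β} [DecidableEq β] (hf : PolyTime f) (hl : PolyTime l) :
    PolyTime fun a => decide (f a ∈ l a) :=
  (hl.any (c := fun a b => decide (f a = b)) ((hf.comp fst_).eq snd_)).congr fun a => by
    rw [Bool.eq_iff_iff]; simp

/-- The list acts as a number in unary: each member removes one bit of the code of `f a`, and the
comparison holds if nothing is left. -/
theorem szLe {f : α → β} {l : α → List γ} (hf : PolyTime f) (hl : PolyTime l) :
    PolyTime fun a => decide (sz (f a) ≤ (l a).length) := by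
  have h : PolyTime (enc : β → BinTree) := of_enc_eq fun _ => rfl
  have h1 := hl.foldl (F := fun _ c _ => c.tail) (h.comp hf).code snd_.fst.tail
    ⟨0, fun a c b => by
      have := sz_drop_le c 1
      rw [List.drop_one] at this
      omega⟩
  refine h1.isEmpty.congr fun a => ?_
  have h2 : ∀ (l : List γ) (c : List Bool), l.foldl (fun c _ => c.tail) c = c.drop l.length := by
    intro l
    induction l with
    | nil => simp
    | cons b l ih => intro c; rw [List.foldl_cons, ih, List.drop_tail]; rfl
  rw [h2, Bool.eq_iff_iff]
  rw [List.isEmpty_iff, List.drop_eq_nil_iff, code_length, decide_eq_true_iff, sz]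

theorem dedup {l : α → List β} [DecidableEq β] (hl : PolyTime l) : PolyTime fun a => (l a).dedup :=
  (hl.reverse.foldl (F := fun _ c b => if b ∈ c then c else b :: c) (const [])
    (ite (snd_.snd.mem snd_.fst) snd_.fst (snd_.snd.cons snd_.fst)) ⟨1, fun a c b => by
      split
      · omega
      · rw [sz_cons, pow_one]; omega⟩).congr fun a => by
    rw [List.foldl_reverse]
    induction l a with
    | nil => rfl
    | cons b l ih =>
      rw [List.foldr_cons, ih]
      split
      next h => rw [List.dedup_cons_of_mem' h]
      next h => rw [List.dedup_cons_of_notMem' h]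

theorem treeFst {f : α → BinTree} (hf : PolyTime f) : PolyTime fun a => (f a).fst :=
  (hf.toList.headD leaf).congr fun a => by cases f a <;> rfl

theorem treeSnd {f : α → BinTree} (hf : PolyTime f) : PolyTime fun a => (f a).snd :=
  hf.toList.tail.ofList.congr fun a => by
    cases f a <;> simp [BinTree.toList, BinTree.snd, BinTree.ofList]

end PolyTime

/-! ### The saturation procedure on coded instances -/

/-- The value of `v` under a finite assignment, with default `d`. -/
def lookup (σ : List (BinTree × BinTree)) (d v : BinTree) : BinTree :=
  σ.foldr (fun p c => if p.1 = v then p.2 else c) d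

/-- The coded instance of a coded atom. Variables without a value are sent to Skolem terms with
arguments `ts`. -/
def instAtom (σ : List (BinTree × BinTree)) (ts : List BinTree) (A : BinTree) : BinTree :=
  node A.fst (ofList (A.snd.toList.map fun v => lookup σ (appTree v ts) v))

/-- The arguments of the members of a list of coded atoms. -/
def argsOf (S : List BinTree) : List BinTree :=
  S.flatMap fun A => A.snd.toList

/-- The list itself if its size is bounded by the length of `B`, and otherwise the empty list. -/
def clamp {α : Type} [TreeEnc α] (B : List BinTree) (l : List α) : List α :=
  if sz l ≤ B.length then l else []

/-- All assignments of members of `T` to the members of `V`, if they are few enough. -/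
def assignments (B T V : List BinTree) : List (List (BinTree × BinTree)) :=
  V.foldr (fun v c => clamp B (c.flatMap fun σ => T.map fun t => (v, t) :: σ)) [[]]

/-- All instances of members of `body` belong to `S`. -/
def holds (σ : List (BinTree × BinTree)) (body S : List BinTree) : Bool :=
  body.all fun A => decide (instAtom σ [] A ∈ S)

/-- Replacement of arguments in a coded atom. -/
def replaceArg (t u A : BinTree) : BinTree :=
  node A.fst (ofList (A.snd.toList.map fun s => if s = t then u else s))

/-- The coded list of variables common to the body and head of a TGD. -/
def treeFrontier (body head : List BinTree) : List BinTree :=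
  (argsOf body).dedup.filter fun v => decide (v ∈ argsOf head)

/-- The atoms that follow by a coded rule under an assignment. -/
def conclusions (S : List BinTree) (ρ : BinTree) (σ : List (BinTree × BinTree)) : List BinTree :=
  if ρ.fst = leaf then
    ρ.snd.snd.fst.toList.map fun A =>
      instAtom σ ((treeFrontier ρ.snd.fst.toList ρ.snd.snd.fst.toList).map fun v =>
        lookup σ leaf v) A
  else
    S.flatMap fun A =>
      [replaceArg (lookup σ leaf ρ.snd.snd.fst) (lookup σ leaf ρ.snd.snd.snd.fst) A,
        replaceArg (lookup σ leaf ρ.snd.snd.snd.fst) (lookup σ leaf ρ.snd.snd.fst) A]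

/-- The atoms that follow from `S` by a coded rule. -/
def consequences (B S : List BinTree) (ρ : BinTree) : List BinTree :=
  (assignments B (argsOf S) (argsOf ρ.snd.fst.toList)).flatMap fun σ =>
    if holds σ ρ.snd.fst.toList S = true then conclusions S ρ σ else []

/-- Add those members of `N` to `S` that are new and small enough. -/
def insertAll (L N S : List BinTree) : List BinTree :=
  N.foldr (fun A c => if sz A ≤ L.length then if A ∈ c then c else A :: c else c) S

/-- One round of the saturation. -/
def saturateStep (L B R S : List BinTree) : List BinTree :=
  clamp B (insertAll L (R.flatMap fun ρ => consequences B S ρ) S)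

/-- The atoms obtained from the coded facts `F`. -/
def saturate (L B R F : List BinTree) : List BinTree :=
  B.foldr (fun _ S => saturateStep L B R S)
    (insertAll L (F.map fun A => node A.fst (ofList (A.snd.toList.map fun c => constTree c))) [])

/-- Evaluation of the coded query `Q` on the saturation. -/
def answer (L B R F Q : List BinTree) : Bool :=
  (assignments B (argsOf (saturate L B R F)) (argsOf Q)).any fun σ => holds σ Q (saturate L B R F)

/-- The bound is independent of `l`. It supplies the growth condition for folds whose steps end with
`clamp`. -/
theorem sz_clamp_le {α : Type} [TreeEnc α] (B : List BinTree) (l : List α) :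
    sz (clamp B l) ≤ B.length + 1 := by
  unfold clamp
  split
  · omega
  · rw [sz_nil]; omega

namespace PolyTime

variable {α β γ : Type} [TreeEnc α] [TreeEnc β] [TreeEnc γ]

theorem foldr {l : α → List β} {i : α → γ} {F : α → β → γ → γ} (hl : PolyTime l) (hi : PolyTime i)
    (hF : PolyTime fun p : α × γ × β => F p.1 p.2.2 p.2.1)
    (hgrow : ∃ e, ∀ a c b, sz (F a b c) ≤ sz c + (sz a + sz b + 2) ^ e) :
    PolyTime fun a => (l a).foldr (F a) (i a) :=
  (hl.reverse.foldl (F := fun a c b => F a b c) hi hF hgrow).congr fun a => by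
    rw [List.foldl_reverse]

theorem lookup {σ : α → List (BinTree × BinTree)} {d v : α → BinTree} (hσ : PolyTime σ)
    (hd : PolyTime d) (hv : PolyTime v) : PolyTime fun a => lookup (σ a) (d a) (v a) := by
  refine hσ.foldr (F := fun a p c => if p.1 = v a then p.2 else c) hd
    (ite (snd_.snd.fst.eq (hv.comp fst_)) snd_.snd.snd snd_.fst) ⟨1, fun a c p => ?_⟩
  rw [pow_one]
  split
  · rw [sz_pair]; omega
  · omega

theorem appTree {f : α → BinTree} {ts : α → List BinTree} (hf : PolyTime f) (hts : PolyTime ts) :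
    PolyTime fun a => appTree (f a) (ts a) :=
  (const _).node (hf.node hts.ofList)

theorem instAtom {σ : α → List (BinTree × BinTree)} {ts : α → List BinTree} {A : α → BinTree}
    (hσ : PolyTime σ) (hts : PolyTime ts) (hA : PolyTime A) :
    PolyTime fun a => instAtom (σ a) (ts a) (A a) :=
  hA.treeFst.node (hA.treeSnd.toList.map
    (F := fun a v => ExRules.lookup (σ a) (ExRules.appTree v (ts a)) v)
    ((hσ.comp fst_).lookup (snd_.appTree (hts.comp fst_)) snd_)).ofList

theorem argsOf {S : α → List BinTree} (hS : PolyTime S) : PolyTime fun a => argsOf (S a) :=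
  hS.flatMap (F := fun _ (A : BinTree) => A.snd.toList) snd_.treeSnd.toList

theorem clamp {B : α → List BinTree} {l : α → List β} (hB : PolyTime B) (hl : PolyTime l) :
    PolyTime fun a => clamp (B a) (l a) :=
  ite (hl.szLe hB) hl (const [])

theorem assignments {B T V : α → List BinTree} (hB : PolyTime B) (hT : PolyTime T)
    (hV : PolyTime V) : PolyTime fun a => assignments (B a) (T a) (V a) := by
  obtain ⟨e, he⟩ := hB.sz_le
  refine hV.foldr
    (F := fun a v c => ExRules.clamp (B a) (c.flatMap fun σ => (T a).map fun t => (v, t) :: σ))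
    (const [[]]) ((hB.comp fst_).clamp (snd_.fst.flatMap
      (F := fun p σ => (T p.1).map fun t => (p.2.2, t) :: σ) ((hT.comp fst_.fst).map
        (F := fun (p : (α × List (List (BinTree × BinTree)) × BinTree) ×
          List (BinTree × BinTree)) t => (p.1.2.2, t) :: p.2)
        ((fst_.fst.snd.snd.pair snd_).cons fst_.snd))))
    ⟨e, fun a c v => ?_⟩
  refine (sz_clamp_le _ _).trans ?_
  have h1 := length_lt_sz (B a)
  have h2 : (sz a + 2) ^ e ≤ (sz a + sz v + 2) ^ e := Nat.pow_le_pow_left (by omega) e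
  have h3 := he a
  omega

theorem holds {σ : α → List (BinTree × BinTree)} {body S : α → List BinTree} (hσ : PolyTime σ)
    (hb : PolyTime body) (hS : PolyTime S) : PolyTime fun a => holds (σ a) (body a) (S a) :=
  hb.all (c := fun a A => decide (ExRules.instAtom (σ a) [] A ∈ S a))
    (((hσ.comp fst_).instAtom (const []) snd_).mem (hS.comp fst_))

theorem replaceArg {t u A : α → BinTree} (ht : PolyTime t) (hu : PolyTime u) (hA : PolyTime A) :
    PolyTime fun a => replaceArg (t a) (u a) (A a) :=
  hA.treeFst.node (hA.treeSnd.toList.map (F := fun a s => if s = t a then u a else s)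
    (ite (snd_.eq (ht.comp fst_)) (hu.comp fst_) snd_)).ofList

theorem treeFrontier {body head : α → List BinTree} (hb : PolyTime body) (hh : PolyTime head) :
    PolyTime fun a => treeFrontier (body a) (head a) :=
  hb.argsOf.dedup.filter (c := fun a v => decide (v ∈ ExRules.argsOf (head a)))
    (snd_.mem (hh.argsOf.comp fst_))

theorem conclusions {S : α → List BinTree} {ρ : α → BinTree} {σ : α → List (BinTree × BinTree)}
    (hS : PolyTime S) (hρ : PolyTime ρ) (hσ : PolyTime σ) :
    PolyTime fun a => conclusions (S a) (ρ a) (σ a) := by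
  have hx : PolyTime fun a => ExRules.lookup (σ a) leaf (ρ a).snd.snd.fst :=
    hσ.lookup (const _) hρ.treeSnd.treeSnd.treeFst
  have hy : PolyTime fun a => ExRules.lookup (σ a) leaf (ρ a).snd.snd.snd.fst :=
    hσ.lookup (const _) hρ.treeSnd.treeSnd.treeSnd.treeFst
  have hts : PolyTime fun a => (ExRules.treeFrontier (ρ a).snd.fst.toList
      (ρ a).snd.snd.fst.toList).map fun v => ExRules.lookup (σ a) leaf v :=
    (hρ.treeSnd.treeFst.toList.treeFrontier hρ.treeSnd.treeSnd.treeFst.toList).map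
      (F := fun a v => ExRules.lookup (σ a) leaf v) ((hσ.comp fst_).lookup (const _) snd_)
  exact ite (hρ.treeFst.eq (const _))
    (hρ.treeSnd.treeSnd.treeFst.toList.map (F := fun a A => ExRules.instAtom (σ a)
      ((ExRules.treeFrontier (ρ a).snd.fst.toList (ρ a).snd.snd.fst.toList).map fun v =>
        ExRules.lookup (σ a) leaf v) A) ((hσ.comp fst_).instAtom (hts.comp fst_) snd_))
    (hS.flatMap (F := fun a A => [ExRules.replaceArg (ExRules.lookup (σ a) leaf (ρ a).snd.snd.fst)
        (ExRules.lookup (σ a) leaf (ρ a).snd.snd.snd.fst) A,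
      ExRules.replaceArg (ExRules.lookup (σ a) leaf (ρ a).snd.snd.snd.fst)
        (ExRules.lookup (σ a) leaf (ρ a).snd.snd.fst) A])
      (((hx.comp fst_).replaceArg (hy.comp fst_) snd_).cons
        (((hy.comp fst_).replaceArg (hx.comp fst_) snd_).cons (const []))))

theorem consequences {B S : α → List BinTree} {ρ : α → BinTree} (hB : PolyTime B) (hS : PolyTime S)
    (hρ : PolyTime ρ) : PolyTime fun a => consequences (B a) (S a) (ρ a) :=
  (hB.assignments hS.argsOf hρ.treeSnd.treeFst.toList.argsOf).flatMap
    (F := fun a σ => if ExRules.holds σ (ρ a).snd.fst.toList (S a) = true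
      then ExRules.conclusions (S a) (ρ a) σ else [])
    (ite ((snd_.holds (hρ.treeSnd.treeFst.toList.comp fst_) (hS.comp fst_)).congr fun _ => by simp)
      ((hS.comp fst_).conclusions (hρ.comp fst_) snd_) (const []))

theorem insertAll {L N S : α → List BinTree} (hL : PolyTime L) (hN : PolyTime N) (hS : PolyTime S) :
    PolyTime fun a => insertAll (L a) (N a) (S a) := by
  refine hN.foldr (F := fun a A c => if sz A ≤ (L a).length then if A ∈ c then c else A :: c else c)
    hS (ite (snd_.snd.szLe (hL.comp fst_)) (ite (snd_.snd.mem snd_.fst) snd_.fst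
      (snd_.snd.cons snd_.fst)) snd_.fst) ⟨1, fun a c A => ?_⟩
  rw [pow_one]
  split_ifs
  · omega
  · rw [sz_cons]; omega
  · omega

theorem saturateStep {L B R S : α → List BinTree} (hL : PolyTime L) (hB : PolyTime B)
    (hR : PolyTime R) (hS : PolyTime S) :
    PolyTime fun a => saturateStep (L a) (B a) (R a) (S a) :=
  hB.clamp (hL.insertAll (hR.flatMap (F := fun a ρ => ExRules.consequences (B a) (S a) ρ)
    ((hB.comp fst_).consequences (hS.comp fst_) snd_)) hS)

theorem saturate {L B R F : α → List BinTree} (hL : PolyTime L) (hB : PolyTime B)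
    (hR : PolyTime R) (hF : PolyTime F) : PolyTime fun a => saturate (L a) (B a) (R a) (F a) := by
  obtain ⟨e, he⟩ := hB.sz_le
  refine hB.foldr (F := fun a _ S => ExRules.saturateStep (L a) (B a) (R a) S)
    (hL.insertAll (hF.map (F := fun _ A => BinTree.node A.fst (BinTree.ofList
      (A.snd.toList.map fun c => constTree c))) (snd_.treeFst.node (snd_.treeSnd.toList.map
        (F := fun _ c => constTree c) ((const leaf).node snd_)).ofList)) (const []))
    ((hL.comp fst_).saturateStep (hB.comp fst_) (hR.comp fst_) snd_.fst) ⟨e, fun a c b => ?_⟩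
  refine (sz_clamp_le _ _).trans ?_
  have h1 := length_lt_sz (B a)
  have h2 : (sz a + 2) ^ e ≤ (sz a + sz b + 2) ^ e := Nat.pow_le_pow_left (by omega) e
  have h3 := he a
  omega

/-- The time is polynomial in the bounds `L` and `B` as well as in the instance; the exponentials
enter only through the lengths of these two lists. -/
theorem answer {L B R F Q : α → List BinTree} (hL : PolyTime L) (hB : PolyTime B)
    (hR : PolyTime R) (hF : PolyTime F) (hQ : PolyTime Q) :
    PolyTime fun a => answer (L a) (B a) (R a) (F a) (Q a) :=
  (hB.assignments (hL.saturate hB hR hF).argsOf hQ.argsOf).any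
    (c := fun a σ => ExRules.holds σ (Q a) (ExRules.saturate (L a) (B a) (R a) (F a)))
    (snd_.holds (hQ.comp fst_) ((hL.saturate hB hR hF).comp fst_))

end PolyTime

/-! ### Coded conjunctions and rules -/

/-- The code of a conjunction of atoms over variables or constants. -/
def conjTrees (β : List (Atom ℕ)) : List BinTree :=
  β.map (atomTree nameTree)

/-- The code of a rule. -/
def ruleTree : Rule → BinTree
  | .tgd body head => ofList [nameTree 0, ofList (conjTrees body), ofList (conjTrees head)]
  | .egd body x y => ofList [nameTree 1, ofList (conjTrees body), nameTree x, nameTree y]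

theorem nameTree_zero : nameTree 0 = leaf := rfl

theorem nameTree_one_ne : nameTree 1 ≠ leaf := by
  intro h
  exact one_ne_zero (nameTree_injective (h.trans nameTree_zero.symm))

theorem argsOf_conjTrees (β : List (Atom ℕ)) : argsOf (conjTrees β) = (varsOf β).map nameTree := by
  simp only [argsOf, conjTrees, varsOf, List.flatMap_map, List.map_flatMap, List.map_ofFn]
  congr 1
  funext A
  simp [atomTree, BinTree.snd, Function.comp_def]

theorem treeFrontier_conjTrees (body head : List (Atom Var)) :
    treeFrontier (conjTrees body) (conjTrees head) = (frontier body head).map nameTree := by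
  simp only [treeFrontier, frontier, argsOf_conjTrees,
    List.dedup_map_of_injective nameTree_injective, List.filter_map, Function.comp_def,
    List.mem_map_of_injective nameTree_injective]

theorem replaceArg_atomTree (t u : GTerm) (A : Atom GTerm) :
    replaceArg (termTree t) (termTree u) (atomTree termTree A) =
      atomTree termTree (A.replace t u) := by
  simp only [replaceArg, atomTree, BinTree.fst, BinTree.snd, toList_ofList, List.map_ofFn,
    Atom.replace, Atom.map]
  congr 3
  funext i
  by_cases h : A.args i = t
  · simp [h]
  · simp [h, termTree_injective.eq_iff]

/-! ### Finite assignments as representations of substitutions. -/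

theorem lookup_cons (p : BinTree × BinTree) (σ : List (BinTree × BinTree)) (d v : BinTree) :
    lookup (p :: σ) d v = if p.1 = v then p.2 else lookup σ d v := rfl

/-- The finite assignment `σ` with domain `V` represents the substitution `τ`. -/
structure Represents (σ : List (BinTree × BinTree)) (τ : Var → GTerm) (V : List Var) : Prop where
  eq : ∀ v ∈ V, ∀ d, lookup σ d (nameTree v) = termTree (τ v)
  default : ∀ v ∉ V, ∀ d, lookup σ d (nameTree v) = d

theorem Represents.nil (τ : Var → GTerm) : Represents [] τ [] :=
  ⟨fun _ h => by simp at h, fun _ _ _ => rfl⟩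

theorem Represents.cons {σ : List (BinTree × BinTree)} {τ τ' : Var → GTerm} {V : List Var}
    (h : Represents σ τ' V) {v : Var} (hτ : ∀ x, x ≠ v → τ x = τ' x) :
    Represents ((nameTree v, termTree (τ v)) :: σ) τ (v :: V) := by
  refine ⟨fun x hx d => ?_, fun x hx d => ?_⟩
  · rw [lookup_cons]
    by_cases hxv : x = v
    · rw [hxv, if_pos rfl]
    · rw [if_neg fun h => hxv (nameTree_injective h).symm, hτ x hxv]
      exact h.eq x ((List.mem_cons.1 hx).resolve_left hxv) d
  · rw [List.mem_cons, not_or] at hx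
    rw [lookup_cons, if_neg fun h => hx.1 (nameTree_injective h).symm]
    exact h.default x hx.2 d

theorem mem_of_mem_clamp {α : Type} [TreeEnc α] {B : List BinTree} {l : List α} {a : α}
    (h : a ∈ clamp B l) : a ∈ l := by
  unfold clamp at h
  split at h
  · exact h
  · simp at h

/-- Clamping may lose assignments but never creates any, so this direction holds for every `B`. -/
theorem exists_represents {B T : List BinTree} (hT : ∀ t ∈ T, ∃ s, termTree s = t) (V : List Var)
    {σ : List (BinTree × BinTree)} (h : σ ∈ assignments B T (V.map nameTree)) :
    ∃ τ, Represents σ τ V := by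
  induction V generalizing σ with
  | nil =>
    obtain rfl : σ = [] := by simpa [assignments] using h
    exact ⟨fun _ => .star, .nil _⟩
  | cons v V ih =>
    obtain ⟨σ', hσ', h'⟩ := List.mem_flatMap.1 (mem_of_mem_clamp h)
    obtain ⟨t, ht, rfl⟩ := List.mem_map.1 h'
    obtain ⟨s, rfl⟩ := hT t ht
    obtain ⟨τ, hτ⟩ := ih hσ'
    refine ⟨Function.update τ v s, ?_⟩
    have := hτ.cons (τ := Function.update τ v s) (v := v) fun x hx => Function.update_of_ne hx _ _
    rwa [Function.update_self] at this

theorem instAtom_atomTree {σ : List (BinTree × BinTree)} {ts : List BinTree} {τ : Var → GTerm}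
    {A : Atom Var} (h : ∀ i, lookup σ (appTree (nameTree (A.args i)) ts) (nameTree (A.args i)) =
      termTree (τ (A.args i))) :
    instAtom σ ts (atomTree nameTree A) = atomTree termTree (A.map τ) := by
  simp only [instAtom, atomTree, BinTree.fst, BinTree.snd, toList_ofList, List.map_ofFn, Atom.map]
  congr 3
  funext i
  exact h i

theorem Represents.holds_iff {σ : List (BinTree × BinTree)} {τ : Var → GTerm}
    {body : List (Atom Var)} (h : Represents σ τ (varsOf body)) (S : List BinTree) :
    holds σ (conjTrees body) S = true ↔ ∀ A ∈ body, atomTree termTree (A.map τ) ∈ S := by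
  simp only [holds, conjTrees, List.all_eq_true, List.forall_mem_map, decide_eq_true_eq]
  refine forall₂_congr fun A hA => ?_
  rw [instAtom_atomTree fun i => h.eq _ (mem_varsOf.2 ⟨A, hA, i, rfl⟩) _]

/-- Skolemisation is done by the default of `lookup`: a head variable that does not occur in the
body has no value and falls back to its Skolem term. -/
theorem Represents.conclusions_tgd {σ : List (BinTree × BinTree)} {τ : Var → GTerm}
    {body head : List (Atom Var)} (h : Represents σ τ (varsOf body)) (S : List BinTree) :
    conclusions S (ruleTree (.tgd body head)) σ =
      head.map fun A => atomTree termTree (A.map (skolemSubst body head τ)) := by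
  have h1 : (treeFrontier (conjTrees body) (conjTrees head)).map (fun v => lookup σ leaf v) =
      List.ofFn fun i => termTree (τ ((frontier body head).get i)) := by
    rw [treeFrontier_conjTrees, List.map_map]
    conv_lhs => rw [← List.ofFn_get (frontier body head)]
    rw [List.map_ofFn]
    congr 1
    funext i
    exact h.eq _ (mem_frontier.1 (List.get_mem _ i)).1 _
  simp only [conclusions, ruleTree, ofList, BinTree.fst, BinTree.snd, nameTree_zero, if_true,
    toList_ofList, h1]
  rw [conjTrees, List.map_map]
  refine List.map_congr_left fun A _ => instAtom_atomTree fun i => ?_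
  by_cases hv : A.args i ∈ varsOf body
  · rw [h.eq _ hv, skolemSubst, if_pos hv]
  · rw [h.default _ hv, skolemSubst, if_neg hv, termTree]

theorem Represents.conclusions_egd {σ : List (BinTree × BinTree)} {τ : Var → GTerm}
    {body : List (Atom Var)} {x y : Var} (h : Represents σ τ (varsOf body)) (hx : x ∈ varsOf body)
    (hy : y ∈ varsOf body) (S : List BinTree) :
    conclusions S (ruleTree (.egd body x y)) σ = S.flatMap fun A =>
      [replaceArg (termTree (τ x)) (termTree (τ y)) A,
        replaceArg (termTree (τ y)) (termTree (τ x)) A] := by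
  simp only [conclusions, ruleTree, ofList, BinTree.fst, BinTree.snd, if_neg nameTree_one_ne,
    h.eq x hx, h.eq y hy]

/-- The conjunction in front of the implication of a rule. -/
def Rule.body : Rule → List (Atom Var)
  | .tgd body _ => body
  | .egd body _ _ => body

theorem ruleTree_body (ρ : Rule) : (ruleTree ρ).snd.fst.toList = conjTrees ρ.body := by
  cases ρ <;> simp [ruleTree, ofList, BinTree.fst, BinTree.snd, Rule.body]

theorem mem_insertAll {L N S : List BinTree} {x : BinTree} :
    x ∈ insertAll L N S ↔ x ∈ S ∨ x ∈ N ∧ sz x ≤ L.length := by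
  induction N with
  | nil => simp [insertAll]
  | cons A N ih =>
    change x ∈ (if sz A ≤ L.length then
      if A ∈ insertAll L N S then insertAll L N S else A :: insertAll L N S
      else insertAll L N S) ↔ _
    have h3 := @ih
    split_ifs with h1 h2
    · have : x = A → x ∈ insertAll L N S := fun h => h ▸ h2
      grind
    · grind
    · grind

theorem nodup_insertAll {L N S : List BinTree} (h : S.Nodup) : (insertAll L N S).Nodup := by
  induction N with
  | nil => exact h
  | cons A N ih =>
    change (if sz A ≤ L.length then
      if A ∈ insertAll L N S then insertAll L N S else A :: insertAll L N S
      else insertAll L N S).Nodup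
    split_ifs with h1 h2
    · exact ih
    · exact List.nodup_cons.2 ⟨h2, ih⟩
    · exact ih

theorem suffix_insertAll (L N S : List BinTree) : S <:+ insertAll L N S := by
  induction N with
  | nil => exact List.suffix_rfl
  | cons A N ih =>
    change S <:+ (if sz A ≤ L.length then
      if A ∈ insertAll L N S then insertAll L N S else A :: insertAll L N S
      else insertAll L N S)
    split_ifs with h1 h2
    · exact ih
    · exact ih.trans (List.suffix_cons _ _)
    · exact ih

theorem factTrees (F : List (Atom Constant)) :
    (conjTrees F).map (fun A => node A.fst (ofList (A.snd.toList.map fun c => constTree c))) =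
      F.map fun A => atomTree termTree (A.map .const) := by
  rw [conjTrees, List.map_map]
  refine List.map_congr_left fun A _ => ?_
  simp only [Function.comp_apply, atomTree, BinTree.fst, BinTree.snd, toList_ofList, List.map_ofFn,
    Atom.map, termTree]
  rfl

/-! ### Soundness of the saturation -/

section Soundness

variable {O : Ontology} {lim : Atom GTerm → Prop} {L B S : List BinTree}

/-- All members of `S` are codes of derivable atoms. -/
def Sound (O : Ontology) (lim : Atom GTerm → Prop) (S : List BinTree) : Prop :=
  ∀ x ∈ S, ∃ A, Derivable O lim A ∧ atomTree termTree A = x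

theorem Sound.exists_termTree (h : Sound O lim S) : ∀ t ∈ argsOf S, ∃ s, termTree s = t := by
  intro t ht
  obtain ⟨x, hx, ht⟩ := List.mem_flatMap.1 ht
  obtain ⟨A, -, rfl⟩ := h x hx
  simp only [atomTree, BinTree.snd, toList_ofList, List.mem_ofFn] at ht
  obtain ⟨i, rfl⟩ := ht
  exact ⟨_, rfl⟩

theorem Sound.derivable (h : Sound O lim S) {A : Atom GTerm} (hA : atomTree termTree A ∈ S) :
    Derivable O lim A := by
  obtain ⟨A', h1, h2⟩ := h _ hA
  rwa [← atomTree_injective termTree_injective h2]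

theorem Sound.conclusions (h : Sound O lim S)
    (hlim : ∀ A, sz (atomTree termTree A) ≤ L.length → lim A)
    {ρ : Rule} (hρ : ρ ∈ O.rules) {x : BinTree} (hx : x ∈ consequences B S (ruleTree ρ))
    (hs : sz x ≤ L.length) : ∃ A, Derivable O lim A ∧ atomTree termTree A = x := by
  obtain ⟨σ, hσ, hx⟩ := List.mem_flatMap.1 hx
  rw [ruleTree_body] at hσ hx
  rw [argsOf_conjTrees] at hσ
  obtain ⟨τ, hτ⟩ := exists_represents h.exists_termTree _ hσ
  split at hx
  case isFalse => simp at hx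
  next hb =>
  rw [hτ.holds_iff] at hb
  have hb' : ∀ A ∈ ρ.body, Derivable O lim (A.map τ) := fun A hA => h.derivable (hb A hA)
  cases ρ with
  | tgd body head =>
    replace hτ : Represents σ τ (varsOf body) := hτ
    rw [Represents.conclusions_tgd hτ] at hx
    obtain ⟨A, hA, rfl⟩ := List.mem_map.1 hx
    exact ⟨_, .tgd body head hρ τ hb' A hA (hlim _ hs), rfl⟩
  | egd body x y =>
    replace hτ : Represents σ τ (varsOf body) := hτ
    have hwf := O.rules_wellFormed _ hρ
    rw [Represents.conclusions_egd hτ hwf.2.1 hwf.2.2] at hx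
    obtain ⟨z, hz, hx⟩ := List.mem_flatMap.1 hx
    obtain ⟨A, hA, rfl⟩ := h z hz
    rw [replaceArg_atomTree, replaceArg_atomTree] at hx
    rcases List.mem_cons.1 hx with rfl | hx
    · exact ⟨_, .egd_right body x y hρ τ hb' A hA (hlim _ hs), rfl⟩
    · obtain rfl := List.mem_singleton.1 hx
      exact ⟨_, .egd_left body x y hρ τ hb' A hA (hlim _ hs), rfl⟩

theorem Sound.saturateStep (h : Sound O lim S)
    (hlim : ∀ A, sz (atomTree termTree A) ≤ L.length → lim A) :
    Sound O lim (saturateStep L B (O.rules.map ruleTree) S) := by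
  intro x hx
  rcases mem_insertAll.1 (mem_of_mem_clamp hx) with hx | ⟨hx, hs⟩
  · exact h x hx
  · obtain ⟨ρ', hρ', hx⟩ := List.mem_flatMap.1 hx
    obtain ⟨ρ, hρ, rfl⟩ := List.mem_map.1 hρ'
    exact h.conclusions hlim hρ hx hs

theorem sound_saturate (hlim : ∀ A, sz (atomTree termTree A) ≤ L.length → lim A) :
    Sound O lim (saturate L B (O.rules.map ruleTree) (conjTrees O.facts)) := by
  unfold saturate
  rw [factTrees]
  refine List.foldrRecOn (motive := fun S => Sound O lim S) B _ ?_
    fun S h _ _ => h.saturateStep hlim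
  intro x hx
  rcases mem_insertAll.1 hx with hx | ⟨hx, hs⟩
  · simp at hx
  · obtain ⟨A, hA, rfl⟩ := List.mem_map.1 hx
    exact ⟨_, .fact A hA (hlim _ hs), rfl⟩

/-- Cutting off sets and assignments can only lose matches, so a positive answer is right for all
`L` and `B`. The size bound itself serves as `lim`. -/
theorem entails_of_answer {q : BCQ} (h : answer L B (O.rules.map ruleTree) (conjTrees O.facts)
    (conjTrees q.body) = true) : O.Entails q := by
  have hS := sound_saturate (O := O) (L := L) (B := B)
    (lim := fun A => sz (atomTree termTree A) ≤ L.length) fun _ h => h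
  obtain ⟨σ, hσ, hq⟩ := List.any_eq_true.1 h
  rw [argsOf_conjTrees] at hσ
  obtain ⟨τ, hτ⟩ := exists_represents hS.exists_termTree _ hσ
  rw [hτ.holds_iff] at hq
  exact entails_of_derivable τ fun A hA => hS.derivable (hq A hA)

end Soundness

/-! ### Completeness of the saturation -/

theorem sz_le_of_forall {α : Type} [TreeEnc α] {l : List α} {s : ℕ} (h : ∀ a ∈ l, sz a ≤ s) :
    sz l ≤ l.length * (s + 1) + 1 := by
  have := size_ofList_le (l := l.map enc) (s := s) (List.forall_mem_map.2 h)
  rwa [List.length_map] at this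

theorem sz_argsOf_le (S : List BinTree) : sz (argsOf S) ≤ sz S := by
  induction S with
  | nil => exact le_rfl
  | cons A S ih =>
    have h1 : sz A.snd.toList ≤ sz A := by
      rw [sz_trees, ofList_toList, sz_tree]
      cases A with
      | leaf => exact le_rfl
      | node a b => simp only [BinTree.snd, size]; omega
    have h3 := sz_append A.snd.toList (argsOf S)
    change sz (A.snd.toList ++ argsOf S) ≤ _
    rw [sz_cons]
    omega

/-- The list `B` is long enough for no assignment and no set of atoms to be cut off, where `n`
bounds the number and size of variables, and the length of `L` the size of atoms. -/
def Ample (n : ℕ) (L B : List BinTree) : Prop :=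
  (2 ^ (L.length + 1) * (L.length + 1) + 1) ^ n * (n * (n + L.length + 2) + 2) + 1 ≤ B.length

theorem Ample.le {n : ℕ} {L B : List BinTree} (h : Ample n L B) (hn : 0 < n) :
    2 ^ (L.length + 1) * (L.length + 1) + 1 ≤ B.length := by
  refine le_trans ?_ h
  have h1 := Nat.le_self_pow hn.ne' (2 ^ (L.length + 1) * (L.length + 1) + 1)
  have h2 := Nat.mul_le_mul h1 (show 1 ≤ n * (n + L.length + 2) + 2 by omega)
  omega

theorem Ample.mem_assignments {n : ℕ} {L B T : List BinTree} (hB : Ample n L B)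
    (hT : ∀ t ∈ T, sz t ≤ L.length) (hT' : T.length ≤ 2 ^ (L.length + 1) * (L.length + 1) + 1)
    {V : List Var} (hV : ∀ v ∈ V, sz (nameTree v) ≤ n) (hV' : V.length ≤ n) {τ : Var → GTerm}
    (hτ : ∀ v ∈ V, termTree (τ v) ∈ T) :
    ∃ σ ∈ assignments B T (V.map nameTree), Represents σ τ V := by
  -- Number and size of the partial assignments are bounded along the way, to see that no `clamp`
  -- cuts. A new pair with its list cell adds at most `n + L.length + 2` to the size.
  suffices h : (assignments B T (V.map nameTree)).length ≤ T.length ^ V.length ∧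
      (∀ σ ∈ assignments B T (V.map nameTree), sz σ ≤ V.length * (n + L.length + 2) + 1) ∧
      ∃ σ ∈ assignments B T (V.map nameTree), Represents σ τ V from h.2.2
  induction V with
  | nil =>
    refine ⟨le_rfl, fun σ hσ => ?_, [], List.mem_singleton.2 rfl, .nil _⟩
    obtain rfl : σ = [] := by simpa [assignments] using hσ
    simp [sz_nil]
  | cons v V ih =>
    rw [List.length_cons] at hV'
    obtain ⟨h1, h2, σ, hσ, hσ'⟩ := ih (fun v hv => hV v (List.mem_cons_of_mem _ hv)) (by omega)
      fun v hv => hτ v (List.mem_cons_of_mem _ hv)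
    set C := assignments B T (V.map nameTree) with hC
    set C' := C.flatMap fun σ => T.map fun t => (nameTree v, t) :: σ with hC'
    have h3 : C'.length ≤ T.length ^ (V.length + 1) := by
      rw [hC', List.length_flatMap]
      simp only [List.length_map, List.map_const', List.sum_replicate, smul_eq_mul]
      rw [pow_succ]
      exact Nat.mul_le_mul_right _ h1
    have h4 : ∀ σ ∈ C', sz σ ≤ (V.length + 1) * (n + L.length + 2) + 1 := by
      intro σ hσ
      obtain ⟨σ', hσ', h⟩ := List.mem_flatMap.1 hσ
      obtain ⟨t, ht, rfl⟩ := List.mem_map.1 h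
      have h5 := h2 σ' hσ'
      have h6 := hT t ht
      have h7 := hV v List.mem_cons_self
      rw [sz_cons, sz_pair, add_mul]
      dsimp only
      omega
    have h5 : assignments B T ((v :: V).map nameTree) = C' := by
      change clamp B C' = C'
      refine if_pos ((sz_le_of_forall h4).trans (le_trans ?_ hB))
      refine Nat.add_le_add_right (Nat.mul_le_mul (h3.trans ?_) ?_) 1
      · exact (Nat.pow_le_pow_left hT' _).trans (Nat.pow_le_pow_right (by omega) hV')
      · have := Nat.mul_le_mul_right (n + L.length + 2) hV'
        omega
    rw [h5]
    refine ⟨h3, h4, (nameTree v, termTree (τ v)) :: σ, ?_, hσ'.cons fun _ _ => rfl⟩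
    exact List.mem_flatMap.2 ⟨σ, hσ, List.mem_map.2 ⟨_, hτ v List.mem_cons_self, rfl⟩⟩

/-- A list without repetitions of trees whose size is bounded by the length of `L`. -/
def Bounded (L S : List BinTree) : Prop :=
  S.Nodup ∧ ∀ x ∈ S, sz x ≤ L.length

theorem Bounded.length_lt {L S : List BinTree} (h : Bounded L S) :
    S.length < 2 ^ (L.length + 1) :=
  length_lt_of_nodup h.1 h.2

theorem Bounded.sz_le {L S : List BinTree} (h : Bounded L S) :
    sz S ≤ 2 ^ (L.length + 1) * (L.length + 1) + 1 :=
  (sz_le_of_forall h.2).trans (Nat.add_le_add_right (Nat.mul_le_mul_right _ h.length_lt.le) _)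

theorem Bounded.insertAll {L S : List BinTree} (h : Bounded L S) (N : List BinTree) :
    Bounded L (insertAll L N S) := by
  refine ⟨nodup_insertAll h.1, fun x hx => ?_⟩
  rcases mem_insertAll.1 hx with hx | hx
  · exact h.2 x hx
  · exact hx.2

theorem Bounded.saturateStep_eq {n : ℕ} {L B S : List BinTree} (h : Bounded L S) (hB : Ample n L B)
    (hn : 0 < n) (R : List BinTree) : saturateStep L B R S =
      ExRules.insertAll L (R.flatMap fun ρ => consequences B S ρ) S :=
  if_pos ((h.insertAll _).sz_le.trans (hB.le hn))

/-- The saturation is bounded, contains the facts and is a fixed point. -/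
theorem saturate_spec {n : ℕ} {L B : List BinTree} (hB : Ample n L B) (hn : 0 < n)
    (R F : List BinTree) :
    Bounded L (saturate L B R F) ∧
      (∀ x ∈ F.map (fun A => node A.fst (ofList (A.snd.toList.map fun c => constTree c))),
        sz x ≤ L.length → x ∈ saturate L B R F) ∧
      saturateStep L B R (saturate L B R F) = saturate L B R F := by
  unfold saturate
  set N := F.map (fun A => node A.fst (ofList (A.snd.toList.map fun c => constTree c)))
  rw [List.foldr_const]
  set f := saturateStep L B R
  -- Each round before the fixed point adds an atom, so after `k` rounds there is a fixed point or
  -- there are at least `k` atoms.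
  have key : ∀ k, Bounded L (f^[k] (insertAll L N [])) ∧
      (∀ x ∈ N, sz x ≤ L.length → x ∈ f^[k] (insertAll L N [])) ∧
      (f (f^[k] (insertAll L N [])) = f^[k] (insertAll L N []) ∨
        k ≤ (f^[k] (insertAll L N [])).length) := by
    intro k
    induction k with
    | zero =>
      refine ⟨?_, fun x hx hs => mem_insertAll.2 (.inr ⟨hx, hs⟩), .inr (Nat.zero_le _)⟩
      exact Bounded.insertAll ⟨List.nodup_nil, fun x hx => by simp at hx⟩ N
    | succ k ih =>
      rw [Function.iterate_succ_apply']
      set S := f^[k] (insertAll L N [])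
      obtain ⟨h1, h2, h3⟩ := ih
      have h4 : f S = insertAll L (R.flatMap fun ρ => consequences B S ρ) S :=
        h1.saturateStep_eq hB hn R
      have h5 : S <:+ f S := h4 ▸ suffix_insertAll _ _ _
      refine ⟨h4 ▸ h1.insertAll _, fun x hx hs => h5.subset (h2 x hx hs), ?_⟩
      rcases h3 with h3 | h3
      · left; rw [h3, h3]
      · rcases h5.length_le.eq_or_lt with h6 | h6
        · left
          have := h5.eq_of_length h6
          rw [← this, ← this]
        · right; omega
  obtain ⟨h1, h2, h3⟩ := key B.length
  -- The second alternative fails for `k = B.length`, as fewer than `2 ^ (L.length + 1)` trees are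
  -- small enough.
  refine ⟨h1, h2, h3.resolve_right fun h => ?_⟩
  have h4 := h1.length_lt
  have h5 := hB.le hn
  have h6 := Nat.mul_le_mul_left (2 ^ (L.length + 1)) (show 1 ≤ L.length + 1 by omega)
  omega

theorem Bounded.exists_represents {n : ℕ} {L B S : List BinTree} (hS : Bounded L S)
    (hB : Ample n L B) {body : List (Atom Var)} (hn : sz (conjTrees body) ≤ n) {τ : Var → GTerm}
    (hτ : ∀ A ∈ body, atomTree termTree (A.map τ) ∈ S) :
    ∃ σ ∈ assignments B (argsOf S) (argsOf (conjTrees body)), Represents σ τ (varsOf body) := by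
  have h1 := (sz_argsOf_le (conjTrees body)).trans hn
  have h2 := sz_argsOf_le S
  rw [argsOf_conjTrees] at h1 ⊢
  refine hB.mem_assignments (fun t ht => ?_) ?_ (fun v hv => ?_) ?_ fun v hv => ?_
  · obtain ⟨A, hA, ht⟩ := List.mem_flatMap.1 ht
    refine le_trans ?_ (hS.2 A hA)
    have h3 := size_le_of_mem_toList ht
    rw [sz_tree, sz_tree]
    cases A <;> simp [BinTree.snd, size] at * <;> omega
  · exact ((length_lt_sz _).le.trans h2).trans hS.sz_le
  · exact (sz_lt_of_mem (List.mem_map_of_mem hv)).le.trans h1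
  · have := length_lt_sz ((varsOf body).map nameTree)
    rw [List.length_map] at this
    omega
  · obtain ⟨A, hA, i, rfl⟩ := mem_varsOf.1 hv
    refine List.mem_flatMap.2 ⟨_, hτ A hA, ?_⟩
    simp only [atomTree, BinTree.snd, toList_ofList, List.mem_ofFn]
    exact ⟨i, rfl⟩

/-- By induction on the derivation: the premises lie in the saturation, so the assignment is listed,
and one more round would insert the conclusion, which is small enough by `hlim`. That round changes
nothing. -/
theorem mem_saturate {O : Ontology} {lim : Atom GTerm → Prop} {n : ℕ} {L B : List BinTree}
    (hB : Ample n L B) (hn : sz (O.rules.map ruleTree) ≤ n)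
    (hlim : ∀ A, lim A → sz (atomTree termTree A) ≤ L.length) {A : Atom GTerm}
    (h : Derivable O lim A) :
    atomTree termTree A ∈ saturate L B (O.rules.map ruleTree) (conjTrees O.facts) := by
  have hn0 : 0 < n := (sz_pos _).trans_le hn
  obtain ⟨h1, h2, h3⟩ := saturate_spec hB hn0 (O.rules.map ruleTree) (conjTrees O.facts)
  rw [factTrees] at h2
  set S := saturate L B (O.rules.map ruleTree) (conjTrees O.facts)
  have key : ∀ ρ ∈ O.rules, ∀ τ : Var → GTerm, (∀ A ∈ ρ.body, atomTree termTree (A.map τ) ∈ S) →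
      ∃ σ, Represents σ τ (varsOf ρ.body) ∧
        ∀ x ∈ conclusions S (ruleTree ρ) σ, sz x ≤ L.length → x ∈ S := by
    intro ρ hρ τ hτ
    have h4 : sz (conjTrees ρ.body) ≤ n := by
      refine le_trans ?_ ((sz_lt_of_mem (List.mem_map_of_mem (f := ruleTree) hρ)).le.trans hn)
      rw [sz_trees, sz_tree]
      cases ρ <;> simp only [ruleTree, Rule.body, ofList, size] <;> omega
    obtain ⟨σ, hσ, hστ⟩ := h1.exists_represents hB h4 hτ
    refine ⟨σ, hστ, fun x hx hs => ?_⟩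
    rw [← h3, h1.saturateStep_eq hB hn0]
    refine mem_insertAll.2 (.inr ⟨List.mem_flatMap.2 ⟨_, List.mem_map_of_mem hρ, ?_⟩, hs⟩)
    refine List.mem_flatMap.2 ⟨σ, by rwa [ruleTree_body], ?_⟩
    rw [ruleTree_body, if_pos ((hστ.holds_iff S).2 hτ)]
    exact hx
  induction h with
  | fact A hA hl => exact h2 _ (List.mem_map_of_mem hA) (hlim _ hl)
  | tgd body head hρ τ hτ A hA hl ih =>
    obtain ⟨σ, h4, h5⟩ := key _ hρ τ ih
    refine h5 _ ?_ (hlim _ hl)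
    rw [Represents.conclusions_tgd (body := body) h4]
    exact List.mem_map_of_mem (f := fun A => atomTree termTree (A.map (skolemSubst body head τ))) hA
  | egd_left body x y hρ τ hτ A hA hl ih ih' =>
    obtain ⟨σ, h4, h5⟩ := key _ hρ τ ih
    refine h5 _ ?_ (hlim _ hl)
    have hwf := O.rules_wellFormed _ hρ
    rw [Represents.conclusions_egd (body := body) h4 hwf.2.1 hwf.2.2, ← replaceArg_atomTree]
    exact List.mem_flatMap.2 ⟨_, ih', by simp⟩
  | egd_right body x y hρ τ hτ A hA hl ih ih' =>
    obtain ⟨σ, h4, h5⟩ := key _ hρ τ ih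
    refine h5 _ ?_ (hlim _ hl)
    have hwf := O.rules_wellFormed _ hρ
    rw [Represents.conclusions_egd (body := body) h4 hwf.2.1 hwf.2.2, ← replaceArg_atomTree]
    exact List.mem_flatMap.2 ⟨_, ih', by simp⟩

theorem answer_of_derivable {O : Ontology} {q : BCQ} {lim : Atom GTerm → Prop} {n : ℕ}
    {L B : List BinTree} (hB : Ample n L B) (hn : sz (O.rules.map ruleTree) ≤ n)
    (hq : sz (conjTrees q.body) ≤ n) (hlim : ∀ A, lim A → sz (atomTree termTree A) ≤ L.length)
    {τ : Var → GTerm} (h : ∀ A ∈ q.body, Derivable O lim (A.map τ)) :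
    answer L B (O.rules.map ruleTree) (conjTrees O.facts) (conjTrees q.body) = true := by
  have hn0 : 0 < n := (sz_pos _).trans_le hn
  have h1 := fun A hA => mem_saturate hB hn hlim (h A hA)
  obtain ⟨σ, hσ, hτ⟩ := (saturate_spec hB hn0 _ _).1.exists_represents hB hq h1
  exact List.any_eq_true.2 ⟨σ, hσ, (hτ.holds_iff _).2 h1⟩

/-! ### The size of admissible terms -/

theorem sz_conjTrees_atoms_le (ρ : Rule) : sz (conjTrees ρ.atoms) ≤ sz (ruleTree ρ) := by
  rw [sz_tree]
  cases ρ with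
  | tgd body head =>
    have := sz_append (conjTrees body) (conjTrees head)
    simp only [Rule.atoms, ruleTree, ofList, size, ← sz_trees, conjTrees, List.map_append] at *
    omega
  | egd body x y =>
    simp only [Rule.atoms, ruleTree, ofList, size, ← sz_trees]
    omega

theorem length_varsOf_lt (β : List (Atom ℕ)) : (varsOf β).length < sz (conjTrees β) := by
  have h1 := length_lt_sz (argsOf (conjTrees β))
  have h2 := sz_argsOf_le (conjTrees β)
  rw [argsOf_conjTrees, List.length_map] at h1
  rw [argsOf_conjTrees] at h2
  omega

theorem sz_nameTree_lt {β : List (Atom ℕ)} {v : ℕ} (h : v ∈ varsOf β) :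
    sz (nameTree v) < sz (conjTrees β) := by
  have h2 := sz_argsOf_le (conjTrees β)
  rw [argsOf_conjTrees] at h2
  exact (sz_lt_of_mem (List.mem_map_of_mem h)).trans_le h2

theorem length_exVars_le (ρ : Rule) : ρ.exVars.length ≤ (varsOf ρ.atoms).length := by
  cases ρ with
  | tgd body head =>
    refine (List.length_filter_le _ _).trans ?_
    simp [varsOf, Rule.atoms]
  | egd body x y => exact Nat.zero_le _

theorem length_frontier_le (body head : List (Atom Var)) :
    (frontier body head).length ≤ (varsOf (Rule.tgd body head).atoms).length := by
  refine (List.length_filter_le _ _).trans ((List.dedup_sublist _).length_le.trans ?_)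
  simp [varsOf, Rule.atoms]

theorem length_flatMap_exVars_le (R : List Rule) :
    (R.flatMap Rule.exVars).length ≤ sz (R.map ruleTree) := by
  induction R with
  | nil => exact Nat.zero_le _
  | cons ρ R ih =>
    have h1 := length_exVars_le ρ
    have h2 := length_varsOf_lt ρ.atoms
    have h3 := sz_conjTrees_atoms_le ρ
    rw [List.flatMap_cons, List.length_append, List.map_cons, sz_cons]
    omega

/-- In an acyclic term the arguments below `w` avoid `w`, so each level of nesting uses up a symbol
of `X`. A symbol has at most `n` arguments, so a level multiplies the size by at most `n + 8`, where
`8` absorbs the overhead of the code. -/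
theorem size_termTree_le {O : Ontology} {n : ℕ} (hR : sz (O.rules.map ruleTree) ≤ n)
    (hF : sz (conjTrees O.facts) ≤ n) {t : GTerm} (ht : Admissible O t) (X : Finset Var)
    (hX : ∀ f, t.Occurs f → f ∈ X) : (termTree t).size ≤ (n + 8) ^ (X.card + 1) := by
  obtain ⟨hb, ha⟩ := ht
  induction hb generalizing X with
  | const A hA i =>
    have h1 := sz_nameTree_lt (mem_varsOf.2 ⟨A, hA, i, rfl⟩ : A.args i ∈ varsOf O.facts)
    rw [sz_tree] at h1
    have h2 : (n + 8) ^ 1 ≤ (n + 8) ^ (X.card + 1) := Nat.pow_le_pow_right (by omega) (by omega)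
    rw [pow_one] at h2
    simp only [termTree, constTree, size]
    omega
  | app body head hρ w hw ts hts ih =>
    have hρn := (sz_lt_of_mem (List.mem_map_of_mem (f := ruleTree) hρ)).trans_le hR
    have hat := sz_conjTrees_atoms_le (Rule.tgd body head)
    have h1 : sz (nameTree w) < _ := sz_nameTree_lt (Rule.mem_varsOf_of_mem_exVars hw)
    have h2 := length_varsOf_lt (Rule.tgd body head).atoms
    have h3 := length_frontier_le body head
    have hwX : w ∈ X := hX w (Or.inl rfl)
    have hcard := Finset.card_erase_add_one hwX
    have h4 : ∀ a ∈ List.ofFn fun i => termTree (ts i), a.size ≤ (n + 8) ^ X.card := by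
      intro a ha'
      obtain ⟨i, rfl⟩ := List.mem_ofFn.1 ha'
      have := ih i (X.erase w) (fun f hf => Finset.mem_erase.2
        ⟨fun h => ha.1 i (h ▸ hf), hX f (Or.inr ⟨i, hf⟩)⟩) (ha.2 i)
      rwa [hcard] at this
    have h5 := size_ofList_le h4
    rw [List.length_ofFn] at h5
    have h6 : (frontier body head).length ≤ n := by omega
    have h7 := Nat.mul_le_mul_right ((n + 8) ^ X.card + 1) h6
    have h8 : (n + 8) ^ 1 ≤ (n + 8) ^ X.card := Nat.pow_le_pow_right (by omega) (by omega)
    have h9 : (n + 8) ^ (X.card + 1) = n * (n + 8) ^ X.card + 8 * (n + 8) ^ X.card := by ring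
    rw [sz_tree] at h1
    rw [pow_one] at h8
    rw [mul_add n, mul_one] at h7
    simp only [termTree, appTree, size]
    omega

theorem Built.occurs_mem {O : Ontology} {t : GTerm} (h : Built O t) {f : Var} (hf : t.Occurs f) :
    f ∈ O.rules.flatMap Rule.exVars := by
  induction h with
  | const => exact hf.elim
  | app body head hρ w hw ts hts ih =>
    rcases hf with rfl | ⟨i, hi⟩
    · exact List.mem_flatMap.2 ⟨_, hρ, hw⟩
    · exact ih i hi

theorem Admissible.size_le {O : Ontology} {n : ℕ} (hR : sz (O.rules.map ruleTree) ≤ n)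
    (hF : sz (conjTrees O.facts) ≤ n) {t : GTerm} (ht : Admissible O t) :
    (termTree t).size ≤ (n + 8) ^ (n + 1) := by
  refine (size_termTree_le hR hF ht (O.rules.flatMap Rule.exVars).toFinset
    fun f hf => List.mem_toFinset.2 (ht.built.occurs_mem hf)).trans ?_
  refine Nat.pow_le_pow_right (by omega) (Nat.add_le_add_right ?_ 1)
  exact (List.toFinset_card_le _).trans ((length_flatMap_exVars_le _).trans hR)

theorem finite_admissible (O : Ontology) : {t | Admissible O t}.Finite := by
  refine Set.Finite.of_finite_image (f := termTree) ((finite_size_le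
    ((sz (O.rules.map ruleTree) + sz (conjTrees O.facts) + 8) ^
      (sz (O.rules.map ruleTree) + sz (conjTrees O.facts) + 1))).subset ?_) termTree_injective.injOn
  rintro _ ⟨t, ht, rfl⟩
  exact ht.size_le (Nat.le_add_right _ _) (Nat.le_add_left _ _)

theorem AdmissibleAtom.size_le {O : Ontology} {n : ℕ} (hR : sz (O.rules.map ruleTree) ≤ n)
    (hF : sz (conjTrees O.facts) ≤ n) {A : Atom GTerm} (hA : AdmissibleAtom O A) :
    sz (atomTree termTree A) ≤ (n + 8) ^ (n + 2) := by
  obtain ⟨⟨ρ, hρ, A', hA', hp⟩, hargs⟩ := hA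
  have hρn := (sz_lt_of_mem (List.mem_map_of_mem (f := ruleTree) hρ)).trans_le hR
  have hat := sz_conjTrees_atoms_le ρ
  have h1 : sz (atomTree nameTree A') < sz (conjTrees ρ.atoms) :=
    sz_lt_of_mem (List.mem_map_of_mem hA')
  have h2 := length_lt_size_ofList (List.ofFn fun i => nameTree (A'.args i))
  have h3 : ∀ a ∈ List.ofFn fun i => termTree (A.args i), a.size ≤ (n + 8) ^ (n + 1) := by
    intro a ha
    obtain ⟨i, rfl⟩ := List.mem_ofFn.1 ha
    exact (hargs i).size_le hR hF
  have h4 := size_ofList_le h3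
  rw [sz_tree, atomTree, size] at h1
  rw [List.length_ofFn] at h2 h4
  have hp1 : (nameTree A'.pred.name).size = (nameTree A.pred.name).size := by rw [hp]
  have hp2 : A'.pred.arity = A.pred.arity := by rw [hp]
  have h6 : A.pred.arity ≤ n := by omega
  have h7 := Nat.mul_le_mul_right ((n + 8) ^ (n + 1) + 1) h6
  have h8 : (n + 8) ^ 1 ≤ (n + 8) ^ (n + 1) := Nat.pow_le_pow_right (by omega) (by omega)
  have h9 : (n + 8) ^ (n + 2) = n * (n + 8) ^ (n + 1) + 8 * (n + 8) ^ (n + 1) := by ring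
  rw [pow_one] at h8
  rw [mul_add n, mul_one] at h7
  rw [sz_tree, atomTree, size]
  omega

theorem pow_le_two_pow_sq (n : ℕ) : (n + 8) ^ (n + 2) ≤ 2 ^ (n + 8) ^ 2 := by
  refine (Nat.pow_le_pow_left (Nat.lt_two_pow_self (n := n + 8)).le _).trans ?_
  rw [← pow_mul]
  exact Nat.pow_le_pow_right (by omega) (by nlinarith)

/-- With `l = 2 ^ (n + 8) ^ 2` the two factors in `Ample` are at most `2 ^ ((2 * l + 2) * n)` and `2
^ (4 * l)`, and the sum of the exponents is at most `l ^ (n + 8) = 2 ^ (n + 8) ^ 3`. -/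
theorem ample_of_length {n : ℕ} {L B : List BinTree} (hL : L.length = 2 ^ (n + 8) ^ 2)
    (hB : B.length = 2 ^ 2 ^ (n + 8) ^ 3) : Ample n L B := by
  unfold Ample
  rw [hB]
  generalize hl : L.length = l at *
  have hn : n + 8 ≤ l := by
    rw [hL]
    exact (Nat.le_self_pow two_ne_zero _).trans Nat.lt_two_pow_self.le
  have h1 : 2 ^ (l + 1) * (l + 1) + 1 ≤ 2 ^ (2 * l + 2) := by
    have h2 := Nat.mul_le_mul_left (2 ^ (l + 1)) (Nat.lt_two_pow_self (n := l))
    have h3 : 2 ^ (2 * l + 2) = 2 * (2 ^ (l + 1) * 2 ^ l) := by ring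
    have h4 := Nat.one_le_two_pow (n := l + 1)
    have h5 := Nat.one_le_two_pow (n := l)
    nlinarith
  have h2 : n * (n + l + 2) + 2 + 1 ≤ 2 ^ (4 * l) := by
    have h3 := Nat.lt_two_pow_self (n := l)
    have h4 : 2 ^ (4 * l) = 2 ^ l * 2 ^ l * (2 ^ l * 2 ^ l) := by ring
    rw [h4]
    generalize 2 ^ l = y at *
    have h5 : n * (n + l + 2) + 3 ≤ y * y * 4 := by nlinarith
    exact h5.trans (Nat.mul_le_mul_left _ (by nlinarith))
  have h3 : 2 ^ (n + 8) ^ 3 = l ^ (n + 8) := by rw [hL, ← pow_mul, ← pow_succ]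
  have h4 : (2 * l + 2) * n + 4 * l ≤ l ^ (n + 8) := by
    have h5 : l ^ 3 ≤ l ^ (n + 8) := Nat.pow_le_pow_right (by omega) (by omega)
    refine le_trans ?_ h5
    have h6 : (2 * l + 2) * n ≤ (2 * l + 2) * l := Nat.mul_le_mul_left _ (by omega)
    have h7 : l ^ 3 = l * (l * l) := by ring
    have h8 : 8 * l ≤ l * l := Nat.mul_le_mul_right _ (by omega)
    have h9 : l * (8 * l) ≤ l * (l * l) := Nat.mul_le_mul_left _ h8
    nlinarith
  rw [h3]
  refine le_trans ?_ (Nat.pow_le_pow_right (by omega) h4)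
  rw [pow_add _ ((2 * l + 2) * n), pow_mul]
  have h5 := Nat.pow_le_pow_left h1 n
  have h6 : 1 ≤ (2 ^ (2 * l + 2)) ^ n := Nat.one_le_iff_ne_zero.2 (by positivity)
  calc _ ≤ (2 ^ (2 * l + 2)) ^ n * (n * (n + l + 2) + 2) + (2 ^ (2 * l + 2)) ^ n :=
        Nat.add_le_add (Nat.mul_le_mul_right _ h5) h6
    _ = (2 ^ (2 * l + 2)) ^ n * (n * (n + l + 2) + 2 + 1) := by ring
    _ ≤ _ := Nat.mul_le_mul_left _ h2

/-- The saturation procedure is correct for EMFA ontologies. -/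
theorem answer_iff_entails {O : Ontology} (hO : O.IsEMFA) (q : BCQ) {n : ℕ} {L B : List BinTree}
    (hR : sz (O.rules.map ruleTree) ≤ n) (hF : sz (conjTrees O.facts) ≤ n)
    (hq : sz (conjTrees q.body) ≤ n) (hL : L.length = 2 ^ (n + 8) ^ 2)
    (hB : B.length = 2 ^ 2 ^ (n + 8) ^ 3) :
    answer L B (O.rules.map ruleTree) (conjTrees O.facts) (conjTrees q.body) = true ↔
      O.Entails q := by
  refine ⟨entails_of_answer, fun h => ?_⟩
  obtain ⟨τ, hτ⟩ := exists_derivable_of_entails hO (finite_admissible O) h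
  refine answer_of_derivable (ample_of_length hL hB) hR hq (fun A hA => ?_) hτ
  rw [hL]
  exact (hA.size_le hR hF).trans (pow_le_two_pow_sq n)

/-! ### Exponential time bounds -/

/-- The function is bounded by `2 ^ P n` for a function `P` of the class `C`. -/
def ExpOf (C : (ℕ → ℕ) → Prop) (T : ℕ → ℕ) : Prop :=
  ∃ P, C P ∧ ∀ n, T n ≤ 2 ^ P n

/-- A class of functions that contains the constants and is closed under addition. -/
structure AddClosed (C : (ℕ → ℕ) → Prop) : Prop where
  const : ∀ c, C fun _ => c
  add : ∀ {T T' : ℕ → ℕ}, C T → C T' → C fun n => T n + T' n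

theorem addClosed_polyBound : AddClosed PolyBound :=
  ⟨.const, fun h h' => h.add h'⟩

namespace ExpOf

variable {C : (ℕ → ℕ) → Prop} {T T' : ℕ → ℕ}

theorem of_mem (h : C T) : ExpOf C T :=
  ⟨T, h, fun _ => Nat.lt_two_pow_self.le⟩

theorem exp (h : C T) : ExpOf C fun n => 2 ^ T n :=
  ⟨T, h, fun _ => le_rfl⟩

theorem mul (hC : AddClosed C) (h : ExpOf C T) (h' : ExpOf C T') : ExpOf C fun n => T n * T' n := by
  obtain ⟨P, hP, h⟩ := h
  obtain ⟨Q, hQ, h'⟩ := h'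
  exact ⟨_, hC.add hP hQ, fun n => by rw [pow_add]; exact Nat.mul_le_mul (h n) (h' n)⟩

theorem addClosed (hC : AddClosed C) : AddClosed (ExpOf C) := by
  refine ⟨fun c => of_mem (hC.const c), ?_⟩
  rintro T T' ⟨P, hP, h⟩ ⟨Q, hQ, h'⟩
  refine ⟨_, hC.add (hC.add hP hQ) (hC.const 1), fun n => ?_⟩
  have h1 : 2 ^ P n ≤ 2 ^ (P n + Q n) := Nat.pow_le_pow_right (by omega) (by omega)
  have h2 : 2 ^ Q n ≤ 2 ^ (P n + Q n) := Nat.pow_le_pow_right (by omega) (by omega)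
  have := h n
  have := h' n
  rw [pow_succ]
  dsimp only
  omega

theorem pow (hC : AddClosed C) (h : ExpOf C T) (e : ℕ) : ExpOf C fun n => T n ^ e := by
  induction e with
  | zero => simpa using (addClosed hC).const 1
  | succ e ih => simpa only [pow_succ] using mul hC ih h

end ExpOf

/-- Bounded by an exponential function of a polynomial. -/
def ExpBound : (ℕ → ℕ) → Prop :=
  ExpOf PolyBound

/-- Bounded by a doubly exponential function of a polynomial. -/
def TwoExpBound : (ℕ → ℕ) → Prop :=
  ExpOf ExpBound

theorem addClosed_expBound : AddClosed ExpBound :=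
  ExpOf.addClosed addClosed_polyBound

theorem addClosed_twoExpBound : AddClosed TwoExpBound :=
  ExpOf.addClosed addClosed_expBound

/-! ### Lists of exponential length -/

/-- Double the second component. -/
def doubleSnd {β : Type} (p : List β × List BinTree) : List β × List BinTree :=
  (p.1, p.2 ++ p.2)

/-- A list of length `2 ^ u.length`. -/
def twoPowList {β : Type} (u : List β) : List BinTree :=
  (doubleSnd^[u.length] (u, [leaf])).2

theorem iterate_doubleSnd_fst {β : Type} (p : List β × List BinTree) (k : ℕ) :
    (doubleSnd^[k] p).1 = p.1 := by
  induction k with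
  | zero => rfl
  | succ k ih => rw [Function.iterate_succ_apply', doubleSnd, ih]

theorem length_twoPowList {β : Type} (u : List β) : (twoPowList u).length = 2 ^ u.length := by
  have : ∀ k, (doubleSnd^[k] (u, [leaf])).2.length = 2 ^ k := by
    intro k
    induction k with
    | zero => rfl
    | succ k ih => rw [Function.iterate_succ_apply', doubleSnd, List.length_append, ih]; ring
  exact this _

/-! ### Exponential and doubly exponential time -/

section

variable {α β γ : Type} [TreeEnc α] [TreeEnc β] [TreeEnc γ]

/-- The function `f` is computable in exponential time. -/
def ExpTime (f : α → β) : Prop :=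
  ∃ d, Computes f fun n => 2 ^ (n + 2) ^ d

theorem Computes.expTime {f : α → β} {T : ℕ → ℕ} (h : Computes f T) (hT : ExpBound T) :
    ExpTime f := by
  obtain ⟨P, ⟨d, hd⟩, hP⟩ := hT
  exact ⟨d, h.mono fun n => (hP n).trans (Nat.pow_le_pow_right (by omega) (hd n))⟩

theorem monotone_two_pow (d : ℕ) : Monotone fun n => 2 ^ (n + 2) ^ d := fun _ _ h =>
  Nat.pow_le_pow_right (by omega) (monotone_pow d h)

theorem ExpTime.comp {g : β → γ} {f : α → β} (hg : ExpTime g) (hf : PolyTime f) :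
    ExpTime fun a => g (f a) := by
  obtain ⟨e, he⟩ := hg
  obtain ⟨d, hd⟩ := hf
  exact (he.comp hd (monotone_two_pow e)).expTime (addClosed_expBound.add
    (ExpOf.of_mem (PolyTime.poly_pow d))
    (ExpOf.exp (((PolyTime.poly_pow d).add (.const 2)).pow e)))

theorem PolyTime.comp_expTime {g : β → γ} {f : α → β} (hg : PolyTime g) (hf : ExpTime f) :
    ExpTime fun a => g (f a) := by
  obtain ⟨e, he⟩ := hg
  obtain ⟨d, hd⟩ := hf
  have h : ExpBound fun n => 2 ^ (n + 2) ^ d := ExpOf.exp (PolyTime.poly_pow d)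
  exact (he.comp hd (monotone_pow e)).expTime (addClosed_expBound.add h
    (ExpOf.pow addClosed_polyBound (addClosed_expBound.add h (addClosed_expBound.const 2)) e))

/-- The function `f` is computable in doubly exponential time. -/
def DoubleExpTime (f : α → β) : Prop :=
  ∃ T, TwoExpBound T ∧ Computes f T

theorem ExpTime.doubleExpTime {f : α → β} (h : ExpTime f) : DoubleExpTime f :=
  let ⟨d, hd⟩ := h
  ⟨_, ExpOf.of_mem (ExpOf.exp (PolyTime.poly_pow d)), hd⟩

theorem PolyTime.expTime {f : α → β} (h : PolyTime f) : ExpTime f :=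
  let ⟨d, hd⟩ := h
  hd.expTime (ExpOf.of_mem (PolyTime.poly_pow d))

theorem ExpTime.comp_expTime {g : β → γ} {f : α → β} (hg : ExpTime g) (hf : ExpTime f) :
    DoubleExpTime fun a => g (f a) := by
  obtain ⟨e, he⟩ := hg
  obtain ⟨d, hd⟩ := hf
  have h : ExpBound fun n => 2 ^ (n + 2) ^ d := ExpOf.exp (PolyTime.poly_pow d)
  exact ⟨_, addClosed_twoExpBound.add (ExpOf.of_mem h) (ExpOf.exp (ExpOf.pow addClosed_polyBound
    (addClosed_expBound.add h (addClosed_expBound.const 2)) e)), he.comp hd (monotone_two_pow e)⟩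

theorem PolyTime.comp_doubleExpTime {g : β → γ} {f : α → β} (hg : PolyTime g)
    (hf : DoubleExpTime f) : DoubleExpTime fun a => g (f a) := by
  obtain ⟨e, he⟩ := hg
  obtain ⟨T, hT, hd⟩ := hf
  exact ⟨_, addClosed_twoExpBound.add hT (ExpOf.pow addClosed_expBound
    (addClosed_twoExpBound.add hT (addClosed_twoExpBound.const 2)) e), he.comp hd (monotone_pow e)⟩

theorem DoubleExpTime.pair {f : α → β} {g : α → γ} (hf : DoubleExpTime f) (hg : DoubleExpTime g) :
    DoubleExpTime fun a => (f a, g a) := by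
  obtain ⟨T, hT, hf⟩ := hf
  obtain ⟨T', hT', hg⟩ := hg
  have hid : TwoExpBound fun n => n := ExpOf.of_mem (ExpOf.of_mem PolyBound.id)
  have hc := addClosed_twoExpBound
  exact ⟨_, hc.add (hc.add (hc.add (ExpOf.mul addClosed_expBound (hc.const 27) hid) hT)
    (ExpOf.mul addClosed_expBound (hc.const 11) hT')) (hc.const 17), hf.pair hg⟩

/-- A list is doubled `u.length` times. Each round is polynomial in a list of at most exponential
size, and there are linearly many rounds. -/
theorem expTime_twoPowList : ExpTime (twoPowList : List β → List BinTree) := by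
  have hf : PolyTime (doubleSnd : List β × List BinTree → _) :=
    .pair .fst_ (.append .snd_ .snd_)
  have hM : ∀ p : List β × List BinTree, ∀ k ≤ p.1.length,
      sz (doubleSnd^[k] p) ≤ sz p + 2 ^ sz p * sz p := by
    intro p k hk
    have h1 : sz (doubleSnd^[k] p).2 ≤ 2 ^ k * sz p.2 := by
      clear hk
      induction k with
      | zero => simp
      | succ k ih =>
        rw [Function.iterate_succ_apply', doubleSnd]
        have := sz_append (doubleSnd^[k] p).2 (doubleSnd^[k] p).2
        rw [pow_succ]
        dsimp only
        nlinarith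
    have h2 := length_lt_sz p.1
    have h3 := sz_pair p
    have h4 : 2 ^ k * sz p.2 ≤ 2 ^ sz p * sz p :=
      Nat.mul_le_mul (Nat.pow_le_pow_right (by omega) (by omega)) (by omega)
    rw [sz_pair, iterate_doubleSnd_fst]
    have h5 : sz (doubleSnd^[k] p).2 ≤ 2 ^ sz p * sz p := h1.trans h4
    have := sz_pos p.2
    omega
  obtain ⟨d, hd⟩ := hf
  obtain ⟨e, he⟩ := PolyTime.fst_ (α := List β) (β := List BinTree)
  have h := hd.iterate (M := fun n => n + 2 ^ n * n) (monotone_pow d) he hM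
  have hid : ExpBound fun n => n := ExpOf.of_mem PolyBound.id
  have hc := addClosed_expBound
  have hMb : ExpBound fun n => n + 2 ^ n * n :=
    hc.add hid (ExpOf.mul addClosed_polyBound (ExpOf.exp PolyBound.id) hid)
  have hpe : ExpBound fun n => (n + 2) ^ e := ExpOf.of_mem (PolyTime.poly_pow e)
  have h2 := PolyTime.snd_.comp_expTime (h.expTime (hc.add (hc.add (hc.add (hc.add
    (ExpOf.mul addClosed_polyBound (hc.const 17) hid) (hc.const 10)) hpe)
    (ExpOf.mul addClosed_polyBound hpe (hc.add (hc.add (ExpOf.mul addClosed_polyBound (hc.const 50)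
      (hc.add hMb hpe)) (ExpOf.pow addClosed_polyBound (hc.add hMb (hc.const 2)) d))
      (hc.const 30))))
    hMb))
  exact h2.comp (f := fun u : List β => (u, [leaf])) (.pair .id (.const [leaf]))

end

/-! ### Reading instances -/

/-- The tree code of an input symbol. -/
def symTree : Γ' → BinTree
  | .blank => leaf
  | .bit false => node leaf leaf
  | .bit true => node leaf (node leaf leaf)
  | .bra => node leaf (node leaf (node leaf leaf))
  | .ket => node leaf (node leaf (node leaf (node leaf leaf)))
  | .comma => node leaf (node leaf (node leaf (node leaf (node leaf leaf))))

instance : TreeEnc Γ' where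
  enc := symTree
  enc_injective := by
    intro a b h
    rcases a with _ | (_ | _) | _ | _ | _ <;> rcases b with _ | (_ | _) | _ | _ | _ <;>
      first | rfl | simp [symTree] at h

theorem sz_symbol_le (s : Γ') : sz s ≤ 11 := by
  rcases s with _ | (_ | _) | _ | _ | _ <;> decide

/-- Add a tree to the tree on top of a stack, read as a list. -/
def addTop (x : BinTree) (st : List BinTree) : List BinTree :=
  node x (st.headD leaf) :: st.tail

/-- One step of the parser, which reads its input from right to left. -/
def parseStep (st : List BinTree) (s : Γ') : List BinTree :=
  if s = .ket then leaf :: st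
  else if s = .bra then addTop (st.headD leaf) st.tail
  else if s = .bit true then addTop (ofBool true) st
  else if s = .bit false then addTop (ofBool false) st
  else st

/-- The tree that is coded by the reverse of a string. -/
def parseReverse (u : List Γ') : BinTree :=
  (u.foldl parseStep [leaf]).headD leaf

theorem sz_addTop_le (x : BinTree) (st : List BinTree) : sz (addTop x st) ≤ sz st + sz x + 3 := by
  cases st with
  | nil => simp only [addTop, List.headD_nil, List.tail_nil, sz_cons, sz_nil, sz_tree, size]; omega
  | cons y st => simp only [addTop, List.headD_cons, List.tail_cons, sz_cons, sz_tree, size]; omega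

namespace PolyTime

variable {α : Type} [TreeEnc α]

theorem addTop {x : α → BinTree} {st : α → List BinTree} (hx : PolyTime x) (hst : PolyTime st) :
    PolyTime fun a => addTop (x a) (st a) :=
  (hx.node (hst.headD leaf)).cons hst.tail

theorem parseReverse : PolyTime ExRules.parseReverse := by
  refine PolyTime.headD (foldl (l := fun u : List Γ' => u) (F := fun _ => parseStep) PolyTime.id
    (const [leaf]) (ite (snd_.snd.eq (const Γ'.ket)) ((const leaf).cons snd_.fst)
    (ite (snd_.snd.eq (const Γ'.bra)) ((snd_.fst.headD leaf).addTop snd_.fst.tail)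
    (ite (snd_.snd.eq (const (Γ'.bit true))) ((const (ofBool true)).addTop snd_.fst)
    (ite (snd_.snd.eq (const (Γ'.bit false))) ((const (ofBool false)).addTop snd_.fst) snd_.fst))))
    ⟨2, fun a c b => ?_⟩) leaf
  -- Each symbol adds a bounded amount to the size of the parser stack: `bra` moves the top tree and
  -- does not copy it.
  have h1 : 16 ≤ (sz a + sz b + 2) ^ 2 := by nlinarith [sz_pos a, sz_pos b]
  unfold parseStep
  split_ifs
  · rw [sz_cons, sz_tree, size]; omega
  · refine (sz_addTop_le _ _).trans ?_
    cases c with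
    | nil => simp only [List.headD_nil, List.tail_nil, sz_nil, sz_tree, size]; omega
    | cons y c => simp only [List.headD_cons, List.tail_cons, sz_cons]; omega
  · refine (sz_addTop_le _ _).trans ?_
    have : sz (ofBool true) = 3 := rfl
    omega
  · refine (sz_addTop_le _ _).trans ?_
    have : sz (ofBool false) = 1 := rfl
    omega
  · omega

end PolyTime

/-- The string `s` is read as the sequence `xs` of trees. -/
def Parses (s : List Γ') (xs : List BinTree) : Prop :=
  ∀ z st, s.foldr (fun a st => parseStep st a) (z :: st) = xs.foldr node z :: st

theorem Parses.nil : Parses [] [] := fun _ _ => rfl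

theorem Parses.append {s t : List Γ'} {xs ys : List BinTree} (hs : Parses s xs) (ht : Parses t ys) :
    Parses (s ++ t) (xs ++ ys) := fun z st => by
  rw [List.foldr_append, ht, hs, List.foldr_append]

theorem Parses.bit (b : Bool) : Parses [.bit b] [ofBool b] := fun z st => by
  cases b <;> rfl

theorem foldr_node (xs : List BinTree) : xs.foldr node leaf = ofList xs := by
  induction xs with
  | nil => rfl
  | cons x xs ih => rw [List.foldr_cons, ih, ofList]

/-- Read from the right, `ket` opens an empty list on top of the stack, and `bra` adds the finished
list as a member to the one below. -/
theorem Parses.bracket {s : List Γ'} {xs : List BinTree} (h : Parses s xs) :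
    Parses (bracket s) [ofList xs] := fun z st => by
  rw [ExRules.bracket, List.foldr_cons, List.foldr_append]
  have h1 : [Γ'.ket].foldr (fun a st => parseStep st a) (z :: st) = leaf :: z :: st := rfl
  rw [h1, h, foldr_node]
  rfl

theorem Parses.flatMap {α : Type} {e : α → List Γ'} {f : α → BinTree} (h : ∀ a, Parses (e a) [f a])
    (l : List α) : Parses (l.flatMap e) (l.map f) := by
  induction l with
  | nil => exact .nil
  | cons a l ih => exact (h a).append ih

theorem parses_encodeList {α : Type} {e : α → List Γ'} {f : α → BinTree}
    (h : ∀ a, Parses (e a) [f a]) (l : List α) : Parses (encodeList e l) [ofList (l.map f)] :=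
  (Parses.flatMap h l).bracket

theorem parses_encodeName (n : ℕ) : Parses (encodeName n) [nameTree n] := by
  have h := Parses.flatMap (e := fun b => [Γ'.bit b]) Parses.bit (Computability.encodeNat n)
  rw [← List.map_eq_flatMap] at h
  exact h.bracket

theorem parses_encodeAtom (A : Atom ℕ) : Parses (encodeAtom A) [atomTree nameTree A] := by
  have h := parses_encodeList parses_encodeName (A.pred.name :: List.ofFn A.args)
  rw [List.map_cons, List.map_ofFn] at h
  exact h

theorem parses_encodeRule (ρ : Rule) : Parses (encodeRule ρ) [ruleTree ρ] := by
  cases ρ with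
  | tgd body head =>
    exact (((parses_encodeName 0).append (parses_encodeList parses_encodeAtom body)).append
      (parses_encodeList parses_encodeAtom head)).bracket
  | egd body x y =>
    exact ((((parses_encodeName 1).append (parses_encodeList parses_encodeAtom body)).append
      (parses_encodeName x)).append (parses_encodeName y)).bracket

theorem parseReverse_encodeInstance (O : Ontology) (q : BCQ) :
    parseReverse (encodeInstance O q).reverse =
      ofList [ofList (O.rules.map ruleTree), ofList (conjTrees O.facts),
        ofList (conjTrees q.body)] := by
  have h := ((parses_encodeList parses_encodeRule O.rules).append
    (parses_encodeList parses_encodeAtom O.facts)).append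
    (parses_encodeList parses_encodeAtom q.body) leaf []
  rw [parseReverse, List.foldl_reverse, encodeInstance, h, foldr_node]
  rfl

/-! ### The decision procedure -/

/-- A list whose length exceeds the size of a tree by `8`. -/
def padding (x : BinTree) : List Bool :=
  List.replicate 8 false ++ x.code

/-- The bound on the size of atoms. -/
def atomBound (x : BinTree) : List BinTree :=
  twoPowList ((padding x).flatMap fun _ => padding x)

/-- The bound on the number of rounds and assignments. -/
def roundBound (x : BinTree) : List BinTree :=
  twoPowList (twoPowList ((padding x).flatMap fun _ => (padding x).flatMap fun _ => padding x))

/-- The decision procedure, on the reverse of its input. -/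
def decideReverse (u : List Γ') : Bool :=
  answer (atomBound (parseReverse u)) (roundBound (parseReverse u)) (parseReverse u).fst.toList
    (parseReverse u).snd.fst.toList (parseReverse u).snd.snd.fst.toList

theorem length_padding (x : BinTree) : (padding x).length = x.size + 8 := by
  rw [padding, List.length_append, List.length_replicate, code_length, add_comm]

theorem length_atomBound (x : BinTree) : (atomBound x).length = 2 ^ (x.size + 8) ^ 2 := by
  simp only [atomBound, length_twoPowList, List.length_flatMap, List.map_const', List.sum_replicate,
    length_padding, smul_eq_mul, pow_two]

theorem length_roundBound (x : BinTree) : (roundBound x).length = 2 ^ 2 ^ (x.size + 8) ^ 3 := by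
  simp only [roundBound, length_twoPowList, List.length_flatMap, List.map_const',
    List.sum_replicate, length_padding, smul_eq_mul]
  congr 2
  ring

theorem decideReverse_iff_entails {O : Ontology} (hO : O.IsEMFA) (q : BCQ) :
    decideReverse (encodeInstance O q).reverse = true ↔ O.Entails q := by
  rw [decideReverse, parseReverse_encodeInstance]
  have := answer_iff_entails hO q (n := (ofList [ofList (O.rules.map ruleTree),
    ofList (conjTrees O.facts), ofList (conjTrees q.body)]).size)
    (by rw [sz_trees]; simp only [ofList, size]; omega)
    (by rw [sz_trees]; simp only [ofList, size]; omega)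
    (by rw [sz_trees]; simp only [ofList, size]; omega) (length_atomBound _) (length_roundBound _)
  simpa only [ofList, BinTree.fst, BinTree.snd, toList_ofList] using this

/-- `atomBound` takes exponential time. `roundBound` composes two maps of exponential time and so
takes doubly exponential time, which the polynomial-time `answer` preserves. -/
theorem doubleExpTime_decideReverse : DoubleExpTime decideReverse := by
  have hp : PolyTime fun u => padding (parseReverse u) :=
    (PolyTime.const _).append PolyTime.parseReverse.code
  have hp2 : PolyTime fun u =>
      (padding (parseReverse u)).flatMap fun _ => padding (parseReverse u) :=
    hp.flatMap (F := fun u _ => padding (parseReverse u)) (hp.comp .fst_)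
  have hp3 : PolyTime fun u => (padding (parseReverse u)).flatMap fun _ =>
      (padding (parseReverse u)).flatMap fun _ => padding (parseReverse u) :=
    hp.flatMap
      (F := fun u _ => (padding (parseReverse u)).flatMap fun _ => padding (parseReverse u))
      (hp2.comp .fst_)
  have hL : ExpTime fun u => atomBound (parseReverse u) := expTime_twoPowList.comp hp2
  have hB : DoubleExpTime fun u => roundBound (parseReverse u) :=
    expTime_twoPowList.comp_expTime (expTime_twoPowList.comp hp3)
  have hx := PolyTime.parseReverse.expTime.doubleExpTime
  have hans : PolyTime fun p : (List BinTree × List BinTree) × BinTree =>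
      answer p.1.1 p.1.2 p.2.fst.toList p.2.snd.fst.toList p.2.snd.snd.fst.toList :=
    .answer (.fst .fst_) (.snd .fst_) (.toList (.treeFst .snd_))
      (.toList (.treeFst (.treeSnd .snd_))) (.toList (.treeFst (.treeSnd (.treeSnd .snd_))))
  have h := hans.comp_doubleExpTime ((hL.doubleExpTime.pair hB).pair hx)
  exact h

/-! ### Reading the input and writing the output -/

/-- Push a string on the main stack. -/
def pushBits : List Bool → TreeProg
  | [] => skip
  | b :: l => .seq (pushBits l) (pushBit .main b)

theorem runLe_pushBits (l : List Bool) (v : Option Γ') (i : List Γ') (m : List Bool) :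
    RunLe (pushBits l) v (stackState i [] m [] [] []) (l.length + 1) v
      (stackState i [] (l ++ m) [] [] []) := by
  induction l with
  | nil => exact (runLe_skip _ _).mono (by simp)
  | cons b l ih =>
    have h := ih.seq (runLe_pushBit .main b v (stackState i [] (l ++ m) [] [] []))
    rw [update_stackState_main] at h
    exact h.mono (by simp)

/-- Push the code of the symbol last read, provided that it belongs to the list. -/
def pushSymbol : List Γ' → TreeProg
  | [] => skip
  | s :: l => .ite (fun v => decide (v = some s)) (pushBits (symTree s).code) (pushSymbol l)

theorem runLe_pushSymbol {s : Γ'} {l : List Γ'} (h : s ∈ l) (i : List Γ') (m : List Bool) :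
    RunLe (pushSymbol l) (some s) (stackState i [] m [] [] []) (l.length + 12) (some s)
      (stackState i [] ((symTree s).code ++ m) [] [] []) := by
  induction l with
  | nil => simp at h
  | cons s' l ih =>
    by_cases hs : s = s'
    · subst hs
      refine (RunLe.ite_true (by simp) (runLe_pushBits _ _ _ _)).mono ?_
      have : (symTree s).size ≤ 11 := sz_symbol_le s
      rw [code_length, List.length_cons]
      omega
    · refine (RunLe.ite_false (by simpa using hs)
        (ih ((List.mem_cons.1 h).resolve_left hs))).mono ?_
      rw [List.length_cons, Nat.add_right_comm]

/-- Pop a symbol of the input. -/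
def popInput : TreeProg :=
  .pop none fun _ s => s

theorem runLe_popInput (v : Option Γ') (i : List Γ') (m : List Bool) :
    RunLe popInput v (stackState i [] m [] [] []) 1 i.head? (stackState i.tail [] m [] [] []) := by
  have h := RunLe.pop (Γ := StackSym) none (fun _ s => s) v (stackState i [] m [] [] [])
  rwa [update_stackState_none] at h

/-- The list of all symbols. -/
def symbols : List Γ' :=
  [.blank, .bit false, .bit true, .bra, .ket, .comma]

theorem mem_symbols (s : Γ') : s ∈ symbols := by
  rcases s with _ | (_ | _) | _ | _ | _ <;> simp [symbols]

/-- Read the input symbol by symbol. -/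
def readLoop : TreeProg :=
  .loop Option.isSome (.seq (pushSymbol symbols)
    (.seq (pushBit .main true) popInput))

/-- Replace the input by the code of its reverse on the main stack. -/
def readInput : TreeProg :=
  .seq (pushBit .main false) (.seq popInput readLoop)

/-- Symbols are consed in the order of reading, so the resulting list is the reversed input, as the
parser wants it. A round takes at most `18` steps for the symbol and one each for the list cell, the
pop and the test. -/
theorem runLe_readLoop (w u : List Γ') :
    RunLe readLoop w.head? (stackState w.tail [] (enc u).code [] [] []) (21 * w.length + 1) none
      (mainState (enc (w.reverse ++ u)).code) := by
  induction w generalizing u with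
  | nil => exact RunLe.loop_false rfl
  | cons s w ih =>
    have h1 := runLe_pushSymbol (mem_symbols s) w (enc u).code
    have h2 := runLe_pushBit .main true (some s)
      (stackState w [] ((symTree s).code ++ (enc u).code) [] [] [])
    rw [update_stackState_main] at h2
    have h3 := runLe_popInput (some s) w (enc (s :: u)).code
    have hc : symbols.length = 6 := rfl
    have h4 := RunLe.loop_true (c := Option.isSome) rfl (h1.seq (h2.seq h3)) (ih (s :: u))
    rw [hc] at h4
    have h5 : (s :: w).reverse ++ u = w.reverse ++ s :: u := by simp
    rw [h5]
    exact h4.mono (by simp; omega)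

theorem runLe_readInput (v : Option Γ') (w : List Γ') :
    RunLe readInput v (stackState w [] [] [] [] []) (21 * w.length + 3) none
      (mainState (enc w.reverse).code) := by
  have h1 := runLe_pushBit .main false v (stackState w [] [] [] [] [])
  rw [update_stackState_main] at h1
  have h2 := runLe_popInput v w (enc ([] : List Γ')).code
  have h3 := runLe_readLoop w []
  rw [List.append_nil] at h3
  exact (h1.seq (h2.seq h3)).mono (by omega)

/-- Move the truth value coded on the main stack to the output. -/
def writeOutput : TreeProg :=
  .seq (popRead .main) (.seq (.ite isTrue
    (.seq (pushBit .out true) (.seq (popRead .main) (popRead .main))) (pushBit .out false))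
    (.load fun _ => none))

/-- The final configuration has to equal `Turing.haltList`, so the internal state is reset and the
main stack emptied; the code of `true` leaves two more symbols to pop. -/
theorem runLe_writeOutput (v : Option Γ') (b : Bool) :
    RunLe writeOutput v (mainState (enc b).code) 6 none (stackState [] [b] [] [] [] []) := by
  have h1 := runLe_popRead .main v (mainState (enc b).code)
  rw [update_stackState_main] at h1
  have h4 := fun v' => RunLe.load (Γ := StackSym) (fun _ => (none : Option Γ')) v'
    (stackState [] [b] [] [] [] [])
  cases b with
  | true =>
    have h2 := runLe_pushBit .out true (some (Γ'.bit true)) (mainState [false, false])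
    rw [update_stackState_out] at h2
    have h3 := runLe_popRead .main (some (Γ'.bit true))
      (stackState [] [true] [false, false] [] [] [])
    rw [update_stackState_main] at h3
    have h3' := runLe_popRead .main (some (Γ'.bit false)) (stackState [] [true] [false] [] [] [])
    rw [update_stackState_main] at h3'
    exact (h1.seq ((RunLe.ite_true rfl (h2.seq (h3.seq h3'))).seq (h4 _))).mono le_rfl
  | false =>
    have h2 := runLe_pushBit .out false (some (Γ'.bit false)) (mainState [])
    rw [update_stackState_out] at h2
    exact (h1.seq ((RunLe.ite_false rfl h2).seq (h4 _))).mono (by omega)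

/-! ### The Turing machine of a program -/

/-- The Turing machine that runs a program and halts. -/
noncomputable def Prog.toFinTM2 (p : TreeProg) : Turing.FinTM2 :=
  haveI := p.finite_label
  haveI : Fintype p.Label := Fintype.ofFinite _
  { K := Option WorkStack
    k₀ := none
    k₁ := some .out
    Γ := StackSym
    Λ := Option p.Label
    main := some p.start
    σ := Option Γ'
    initialState := none
    Γk₀Fin := inferInstanceAs (Fintype Γ')
    m := fun l => match l with
      | none => .halt
      | some l => p.machine some none l }

/-- The step beyond `T` executes the halting statement at the label `none`. -/
theorem Prog.RunLe.outputs {p : TreeProg} {w : List Γ'} {b : Bool} {T : ℕ}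
    (h : RunLe p none (stackState w [] [] [] [] []) T none (stackState [] [b] [] [] [] [])) :
    Nonempty (Turing.TM2OutputsInTime p.toFinTM2 w (some [b]) (T + 1)) := by
  obtain ⟨t, ht, h⟩ := h
  have h1 := h.machine p.toFinTM2.m some none fun _ => rfl
  have hi : Turing.initList p.toFinTM2 w =
      ⟨some (some p.start), none, stackState w [] [] [] [] []⟩ := by
    unfold Turing.initList
    congr 1
    funext k
    rcases k with _ | (_ | _ | _ | _ | _) <;> rfl
  have ho : Turing.haltList p.toFinTM2 [b] = ⟨none, none, stackState [] [b] [] [] [] []⟩ := by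
    unfold Turing.haltList
    congr 1
    funext k
    rcases k with _ | (_ | _ | _ | _ | _) <;> rfl
  refine ⟨⟨⟨t + 1, ?_⟩, Nat.add_le_add_right ht 1⟩⟩
  rw [hi, Option.map_some, ho]
  exact iterate_bind_trans h1 rfl

theorem DoubleExpTime.exists_pow {α β : Type} [TreeEnc α] [TreeEnc β] {f : α → β}
    (h : DoubleExpTime f) : ∃ d, Computes f fun n => 2 ^ 2 ^ (n + 2) ^ d := by
  obtain ⟨T, ⟨E, ⟨P, ⟨d, hd⟩, hP⟩, hE⟩, h⟩ := h
  refine ⟨d, h.mono fun n => (hE n).trans (Nat.pow_le_pow_right (by omega) ((hP n).trans ?_))⟩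
  exact Nat.pow_le_pow_right (by omega) (hd n)

/-- A language is in 2ExpTime if membership of the reverse of a string is decidable in doubly
exponential time. -/
theorem mem_twoExpTime {f : List Γ' → Bool} (hf : DoubleExpTime f) :
    ({w | f w.reverse = true} : Language Γ') ∈ TwoExpTime Γ' := by
  obtain ⟨d, -, p, hp⟩ := hf.exists_pow
  have hrun : ∀ w : List Γ', RunLe (.seq readInput (.seq p writeOutput)) none
      (stackState w [] [] [] [] [])
      (21 * w.length + 9 + 2 ^ 2 ^ (12 * w.length + 3) ^ d) none
      (stackState [] [f w.reverse] [] [] [] []) := by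
    intro w
    obtain ⟨v, h⟩ := hp w.reverse none []
    simp only [List.flatMap_cons, List.flatMap_nil, List.append_nil] at h
    refine ((runLe_readInput none w).seq (h.seq (runLe_writeOutput v _))).mono ?_
    -- A symbol has a code of size at most `11`, and its list cell adds `1`.
    have h1 : sz w.reverse ≤ 12 * w.length + 1 := by
      have := sz_le_of_forall (l := w.reverse) fun s _ => sz_symbol_le s
      rw [List.length_reverse] at this
      omega
    have h2 : 2 ^ 2 ^ (sz w.reverse + 2) ^ d ≤ 2 ^ 2 ^ (12 * w.length + 3) ^ d :=
      Nat.pow_le_pow_right (by omega) (Nat.pow_le_pow_right (by omega)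
        (Nat.pow_le_pow_left (by omega) d))
    omega
  refine ⟨⟨⟨Prog.toFinTM2 (.seq readInput (.seq p writeOutput)), Equiv.refl Γ', Equiv.refl Bool⟩,
    fun n => 21 * n + 9 + 2 ^ 2 ^ (12 * n + 3) ^ d + 1, fun w => Classical.choice ?_⟩,
    .C 21 * .X + .C 10 + (.C 12 * .X + .C 3) ^ d + 1, fun n => ?_⟩
  · have h := (hrun w).outputs
    have h1 : w.map (Equiv.refl Γ').invFun = w := List.map_id w
    have h2 : (Computability.encodeBool (@decide (w ∈ ({w | f w.reverse = true} : Language Γ'))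
        (Classical.propDecidable _))).map (Equiv.refl Bool).invFun = [f w.reverse] := by
      have h3 : @decide (w ∈ ({w | f w.reverse = true} : Language Γ')) (Classical.propDecidable _) =
          f w.reverse := by
        rw [Bool.eq_iff_iff]
        exact @decide_eq_true_iff _ (Classical.propDecidable _)
      rw [h3]
      rfl
    exact cast (congrArg₂ (fun (l : List Γ') (l' : List Bool) => Nonempty
      (Turing.TM2OutputsInTime (Prog.toFinTM2 (.seq readInput (.seq p writeOutput))) l (some l')
        (21 * w.length + 9 + 2 ^ 2 ^ (12 * w.length + 3) ^ d + 1))) h1.symm h2.symm) h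
  · simp only [Polynomial.eval_add, Polynomial.eval_mul, Polynomial.eval_C, Polynomial.eval_X,
      Polynomial.eval_pow, Polynomial.eval_one]
    generalize (12 * n + 3) ^ d = y
    generalize 21 * n = x
    -- Both summands are at most `2 ^ 2 ^ (x + 10 + y)`; the final `1` in the polynomial pays for
    -- their sum.
    have h1 : x + 10 ≤ 2 ^ 2 ^ (x + 10 + y) := by
      have h2 := Nat.lt_two_pow_self (n := x + 10 + y)
      have h3 := Nat.lt_two_pow_self (n := 2 ^ (x + 10 + y))
      omega
    have h2 : 2 ^ 2 ^ y ≤ 2 ^ 2 ^ (x + 10 + y) :=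
      Nat.pow_le_pow_right (by omega) (Nat.pow_le_pow_right (by omega) (by omega))
    have h3 : 2 ^ (2 ^ (x + 10 + y) + 1) ≤ 2 ^ 2 ^ (x + 10 + y + 1) := by
      refine Nat.pow_le_pow_right (by omega) ?_
      have := Nat.one_le_two_pow (n := x + 10 + y)
      rw [pow_succ]
      omega
    rw [pow_succ] at h3
    omega

end ExRules

/-- Entailment of Boolean conjunctive queries over EMFA ontologies is in 2ExpTime: some language in
2ExpTime gives the correct answer on all instances whose ontology is EMFA. -/
theorem theorem6 :
    ∃ L ∈ ExRules.TwoExpTime Computability.Γ',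
      ∀ (O : ExRules.Ontology) (q : ExRules.BCQ), O.IsEMFA →
        (ExRules.encodeInstance O q ∈ L ↔ O.Entails q) :=
  ⟨_, ExRules.mem_twoExpTime ExRules.doubleExpTime_decideReverse,
    fun _ q hO => ExRules.decideReverse_iff_entails hO q⟩
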